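/- Conventions. $\Bbbk$ is a commutative ring, operators are written on the right and the Koszul sign rule is used; $s$ denotes suspension, $(sX)^d=X^{d+1}$. An $A_\infty$-category $\mathcal A$ is a $\mathbb Z$-graded $\Bbbk$-quiver with $\Bbbk$-linear maps $b_n:s\mathcal A(X_0,X_1)\otimes\dots\otimes s\mathcal A(X_{n-1},X_n)\to s\mathcal A(X_0,X_n)$, $n\ge1$, of degree $1$, such that $\sum_{r+n+t=k}(1^{\otimes r}\otimes b_n\otimes1^{\otimes t})b_{r+1+t}=0$ for all $k\ge1$. An $A_\infty$-functor $\varphi:\mathcal A\to\mathcal B$ is a map on objects with degree $0$ maps $\varphi_n:T^ns\mathcal A\to s\mathcal B$, $n\ge1$, such that $\sum_{l;\,i_1+\dots+i_l=k}(\varphi_{i_1}\otimes\dots\otimes\varphi_{i_l})b_l=\sum_{r+n+t=k}(1^{\otimes r}\otimes b_n\otimes1^{\otimes t})\varphi_{r+1+t}$; its matrix elements are $\varphi_{a\alpha}=\sum_{i_1+\dots+i_\alpha=a}\varphi_{i_1}\otimes\dots\otimes\varphi_{i_\alpha}$, with $\varphi_{00}=1$. For functors $\varphi,\psi:\mathcal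 A\to\mathcal B$ the elements of degree $e$ of $sA_\infty(\mathcal A,\mathcal B)(\varphi,\psi)$ are the systems $r=(r_k)_{k\ge0}$ of degree $e$ maps $r_k:T^ks\mathcal A(X,Y)\to s\mathcal B(X\varphi,Y\psi)$, with differential $$(rB_1)_k=\sum_{a+q+c=k}^{\alpha,\beta}(\varphi_{a\alpha}\otimes r_q\otimes\psi_{c\beta})b_{\alpha+1+\beta}-(-1)^e\sum_{a+q+c=k}(1^{\otimes a}\otimes b_q\otimes1^{\otimes c})r_{a+1+c}.$$ Let $\mathcal Q$ be a differential graded $\Bbbk$-quiver. The free $A_\infty$-category $\mathcal{FQ}$ has the objects of $\mathcal Q$ and $s\mathcal{FQ}(X,Y)=\bigoplus_t s\mathcal F_t\mathcal Q(X,Y)$, $s\mathcal F_t\mathcal Q(X,Y)=T^{n}s\mathcal Q(X,Y)[-|t|]$ (the shift is put on the last tensor factor), where $t$ runs over the plane rooted trees all of whose internal vertices have at least two inputs, $n$ is the number of input vertices and $|t|$ that of internal vertices of $t$. For $k>1$, $b_k=s^{|t_1|}\otimes\dots\otimes s^{|t_{k-1}|}\otimes s^{|t_k|-|t|}:s\mathcal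 F_{t_1}\mathcal Q\otimes\dots\otimes s\mathcal F_{t_k}\mathcal Q\to s\mathcal F_t\mathcal Q$, where $t$ is obtained by joining the roots of $t_1,\dots,t_k$ to a new vertex; on $s\mathcal F_t\mathcal Q$ the map $b_1$ is the sum of the differential of $T^ns\mathcal Q[-|t|]$ and of the maps $(-1)^{1+h}s^{-1}:s\mathcal F_t\mathcal Q\to s\mathcal F_{t'}\mathcal Q$ over all pairs of a tree $t'$ and an internal edge $e$ of it whose contraction gives $t$; here $h$ is the number of the upper vertex of $e$ when the internal vertices of $t'$ are numbered from $1$ in the order: root vertex, then the vertices of the first subtree, then those of the second, and so on. The quiver $s\mathcal Q$ is the summand of the tree without internal vertices. For chain morphisms $\varphi,\psi:(s\mathcal Q,b_1)\to(s\mathcal A,b_1)$ let $$sA_1(\mathcal Q,\mathcal A)(\varphi,\psi)=\prod_{X}s\mathcal A(X\varphi,X\psi)\times\prod_{X,Y}\mathsf C\bigl(s\mathcal Q(X,Y),s\mathcal A(X\varphi,Y\psi)\bigr),$$ with $(rB_1)_0=r_0b_1$ and $(rB_1)_1=r_1b_1+(\varphi_1\otimes r_0)b_2+(r_0\otimes\psi_1)b_2-(-1)^{\deg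 r}b_1r_1$, where $\mathsf C$ is the complex of homogeneous $\Bbbk$-linear maps. Statement. Let $\mathcal A$ be an $A_\infty$-category, let $\varphi,\psi:\mathcal{FQ}\to\mathcal A$ be $A_\infty$-functors, let $(P,d)$ be a complex of $\Bbbk$-modules and let $u:P\to sA_\infty(\mathcal{FQ},\mathcal A)(\varphi,\psi)$ be a chain map. For a homogeneous map $f:P\to sA_\infty(\mathcal{FQ},\mathcal A)(\varphi,\psi)$ denote by $f_k$ its $k$-th component and by $f':P\to sA_1(\mathcal Q,\mathcal A)(\varphi,\psi)$, $pf'=(pf_0,(pf_1)|_{s\mathcal Q})$, its composition with restriction (where $\varphi,\psi$ are restricted to $\mathcal Q$). Then $h\mapsto(h',h_k)_{k>1}$ is a bijection from the (possibly empty) set of maps $h:P\to sA_\infty(\mathcal{FQ},\mathcal A)(\varphi,\psi)$ of degree $-1$ with $u=dh+hB_1$ onto the set of data consisting of 1. a map $h':P\to sA_1(\mathcal Q,\mathcal A)(\varphi,\psi)$ of degree $-1$ with $dh'+h'B_1=u'$; 2. arbitrary $\Bbbk$-linear maps $h_k:P\to\prod_{X,Y}\mathsf C\bigl((s\mathcal{FQ})^{\otimes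 k}(X,Y),s\mathcal A(X\varphi,Y\psi)\bigr)$ of degree $-1$ for all $k>1$. The inverse bijection is determined by a recurrent formula: a degree $-1$ map $h$ whose restriction $h'$ satisfies $dh'+h'B_1=u'$ satisfies $u=dh+hB_1$ if and only if for all $k>1$, $i\in\mathbb Z$ and $p\in P^i$ $$(-1)^ib_k(ph_1)=pu_k-(pd)h_k-\sum_{a+q+c=k}^{\alpha,\beta}(\varphi_{a\alpha}\otimes ph_q\otimes\psi_{c\beta})b_{\alpha+1+\beta}-(-1)^i\sum_{a+q+c=k}^{a+c>0}(1^{\otimes a}\otimes b_q\otimes1^{\otimes c})(ph_{a+1+c}):(s\mathcal{FQ})^{\otimes k}\to s\mathcal A.$$ -/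

import Mathlib

universe uk u v u' v' w

set_option linter.checkUnivs false

noncomputable section

namespace AInf

/-- The sign `(-1)^n`, as an element of the ground ring. -/
def sgn (k : Type uk) [CommRing k] (n : ℤ) : k := ((n.negOnePow : ℤ) : k)

/-! ### Graded quivers and composable strings -/

/-- A `ℤ`-graded `k`-linear quiver with set of objects `S`. Each `Hom X Y` is the direct sum of its homogeneous
components `gr X Y d`. -/
structure GrQuiver (k : Type uk) [CommRing k] (S : Type u) where
  Hom : S → S → Type v
  [acg : ∀ X Y, AddCommGroup (Hom X Y)]
  [mod : ∀ X Y, Module k (Hom X Y)]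
  gr : ∀ X Y, ℤ → Submodule k (Hom X Y)
  internal : ∀ X Y, DirectSum.IsInternal (gr X Y)

attribute [instance] GrQuiver.acg GrQuiver.mod

variable {k : Type uk} [CommRing k]

/-- A homogeneous element of `V(X,Y)` together with its degree. -/
abbrev Arrow {S : Type u} (V : GrQuiver.{uk, u, v} k S) (X Y : S) := Σ d : ℤ, V.gr X Y d

theorem Arrow.ext {S : Type u} {V : GrQuiver.{uk, u, v} k S} {X Y : S} {x y : Arrow V X Y}
    (h₁ : x.1 = y.1) (h₂ : (x.2 : V.Hom X Y) = y.2) : x = y := by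
  obtain ⟨d, x, hx⟩ := x
  obtain ⟨e, y, hy⟩ := y
  obtain rfl : d = e := h₁
  obtain rfl : x = y := h₂
  rfl

/-- Composable strings `x₁, …, xₙ` (`n ≥ 0`) of homogeneous elements
`xᵢ ∈ V(Xᵢ₋₁, Xᵢ)` with `X₀ = X`, `Xₙ = Y`. They stand for the elements
`x₁ ⊗ ⋯ ⊗ xₙ` of `TⁿV(X,Y)`. -/
inductive Str {S : Type u} (V : GrQuiver.{uk, u, v} k S) : S → S → Type (max u v)
  | nil (X : S) : Str V X X
  | cons {X Y Z : S} (x : Arrow V X Y) (s : Str V Y Z) : Str V X Z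

namespace Str

variable {S : Type u} {V : GrQuiver.{uk, u, v} k S}

def append : ∀ {X Y Z : S}, Str V X Y → Str V Y Z → Str V X Z
  | _, _, _, nil _, t => t
  | _, _, _, cons x s, t => cons x (append s t)

def length : ∀ {X Y : S}, Str V X Y → ℕ
  | _, _, nil _ => 0
  | _, _, cons _ s => length s + 1

def deg : ∀ {X Y : S}, Str V X Y → ℤ
  | _, _, nil _ => 0
  | _, _, cons x s => x.1 + deg s

def single {X Y : S} (x : Arrow V X Y) : Str V X Y := cons x (nil Y)

theorem length_append : ∀ {X Y Z : S} (s : Str V X Y) (t : Str V Y Z),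
    (s.append t).length = s.length + t.length
  | _, _, _, nil _, t => by simp [append, length]
  | _, _, _, cons x s, t => by simp [append, length, length_append s t]; omega

theorem deg_append : ∀ {X Y Z : S} (s : Str V X Y) (t : Str V Y Z),
    (s.append t).deg = s.deg + t.deg
  | _, _, _, nil _, t => by simp [append, deg]
  | _, _, _, cons x s, t => by simp [append, deg, deg_append s t]; omega

theorem append_assoc : ∀ {X Y Z W : S} (s : Str V X Y) (t : Str V Y Z) (r : Str V Z W),
    (s.append t).append r = s.append (t.append r)
  | _, _, _, _, nil _, t, r => rfl
  | _, _, _, _, cons x s, t, r => by simp [append, append_assoc s t r]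

end Str

/-- A way to write a string as a concatenation `left · right`. -/
structure Split2 {S : Type u} (V : GrQuiver.{uk, u, v} k S) (X Y : S) where
  {Z : S}
  left : Str V X Z
  right : Str V Z Y

/-- A way to write a string as a concatenation `left · mid · right`. -/
structure Split3 {S : Type u} (V : GrQuiver.{uk, u, v} k S) (X Y : S) where
  {Z : S}
  {W : S}
  left : Str V X Z
  mid : Str V Z W
  right : Str V W Y

/-- All decompositions of a string into two consecutive (possibly empty) pieces. -/
def Str.splits {S : Type u} {V : GrQuiver.{uk, u, v} k S} : ∀ {X Y : S}, Str V X Y → List (Split2 V X Y)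
  | _, _, .nil X => [⟨.nil X, .nil X⟩]
  | _, _, .cons x s => ⟨.nil _, .cons x s⟩ :: (s.splits.map fun p => ⟨.cons x p.left, p.right⟩)

/-- All decompositions of a string into three consecutive (possibly empty) pieces. -/
def Str.splits3 {S : Type u} {V : GrQuiver.{uk, u, v} k S} {X Y : S} (s : Str V X Y) :
    List (Split3 V X Y) :=
  s.splits.flatMap fun p => p.right.splits.map fun q => ⟨p.left, q.left, q.right⟩

/-- A function on composable strings which is `k`-linear in every entry, i.e. a `k`-linear map
on the tensor powers. -/
structure IsMultilinear {S : Type u} {V : GrQuiver.{uk, u, v} k S} {X Y : S} {M : Type w} [AddCommGroup M]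
    [Module k M] (f : Str V X Y → M) : Prop where
  add : ∀ {Z W : S} (s : Str V X Z) (t : Str V W Y) (d : ℤ) (x y : V.gr Z W d),
    f (s.append (.cons ⟨d, x + y⟩ t)) = f (s.append (.cons ⟨d, x⟩ t)) + f (s.append (.cons ⟨d, y⟩ t))
  smul : ∀ {Z W : S} (s : Str V X Z) (t : Str V W Y) (d : ℤ) (c : k) (x : V.gr Z W d),
    f (s.append (.cons ⟨d, c • x⟩ t)) = c • f (s.append (.cons ⟨d, x⟩ t))

theorem IsMultilinear.zero {S : Type u} {V : GrQuiver.{uk, u, v} k S} {X Y : S} {M : Type w}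
    [AddCommGroup M] [Module k M] {f : Str V X Y → M} (hf : IsMultilinear f)
    {Z W : S} (s : Str V X Z) (t : Str V W Y) (d : ℤ) :
    f (s.append (.cons ⟨d, 0⟩ t)) = 0 := by
  have := hf.smul s t d 0 0
  simpa using this

/-! ### `A_∞`-categories and functors, in terms of suspended quivers

An `A_∞`-category `𝒜` is recorded by the graded quiver `s𝒜` and the maps `bₙ` of degree `1`. -/

/-- A graded quiver `s𝒜` with a system of `k`-linear maps `bₙ : Tⁿs𝒜 → s𝒜`, `n ≥ 1`, of
degree `1`. -/
structure OpQuiver (k : Type uk) [CommRing k] (S : Type u) extends GrQuiver.{uk, u, v} k S where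
  b : ∀ {X Y : S}, Str toGrQuiver X Y → Hom X Y
  b_nil : ∀ X, b (.nil X) = 0
  b_multilinear : ∀ X Y, IsMultilinear (b (X := X) (Y := Y))
  b_mem : ∀ {X Y} (s : Str toGrQuiver X Y), b s ∈ gr X Y (s.deg + 1)

/-- The value `(x₁ ⊗ ⋯ ⊗ xₙ)bₙ`, as a homogeneous element. -/
def OpQuiver.bArr {S : Type u} (A : OpQuiver.{uk, u, v} k S) {X Y : S} (s : Str A.toGrQuiver X Y) :
    Arrow A.toGrQuiver X Y :=
  ⟨s.deg + 1, A.b s, A.b_mem s⟩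

/-- An `A_∞`-category: `∑ (1^{⊗r} ⊗ bₙ ⊗ 1^{⊗t}) b_{r+1+t} = 0`. Operators act on the right,
hence the Koszul sign. -/
structure AInfCat (k : Type uk) [CommRing k] (S : Type u) extends OpQuiver.{uk, u, v} k S where
  b_b : ∀ {X Y : S} (s : Str toGrQuiver X Y),
    (s.splits3.map fun p => sgn k p.right.deg •
      b (p.left.append (.cons (toOpQuiver.bArr p.mid) p.right))).sum = 0

/-- A pointed cocategory homomorphism: maps `fₙ : TⁿV → W`, `n ≥ 1`, of degree `0`. -/
structure CocatHom {S : Type u} (V : GrQuiver.{uk, u, v} k S) {S' : Type u'} (W : GrQuiver.{uk, u', v'} k S') where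
  obj : S → S'
  map : ∀ {X Y : S}, Str V X Y → W.Hom (obj X) (obj Y)
  map_nil : ∀ X, map (.nil X) = 0
  map_multilinear : ∀ X Y, IsMultilinear (map (X := X) (Y := Y))
  map_mem : ∀ {X Y} (s : Str V X Y), map s ∈ W.gr (obj X) (obj Y) s.deg

namespace CocatHom

variable {S : Type u} {V : GrQuiver.{uk, u, v} k S} {S' : Type u'} {W : GrQuiver.{uk, u', v'} k S'}

def arr (f : CocatHom V W) {X Y : S} (s : Str V X Y) : Arrow W (f.obj X) (f.obj Y) :=
  ⟨s.deg, f.map s, f.map_mem s⟩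

/-- Auxiliary to `comps`: the strings coming from the decompositions of `a · s` whose first
piece starts with `a`. -/
def compsAux (f : CocatHom V W) : ∀ {X Y Z : S}, Str V X Y → Str V Y Z →
    List (Str W (f.obj X) (f.obj Z))
  | _, _, _, a, .nil _ => [.single (f.arr a)]
  | _, _, _, a, .cons x s =>
      compsAux f (a.append (.single x)) s ++ (compsAux f (.single x) s).map (.cons (f.arr a))

/-- The strings `s₁f, …, s_l f`, for all decompositions `s = s₁ ⋯ s_l` of `s` into non-empty
consecutive pieces. Their sum is the value of the cocategory homomorphism on `s`; those of
length `l` give the matrix element `f_{kl} = ∑ f_{i₁} ⊗ ⋯ ⊗ f_{i_l}`, `k = length s`. -/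
def comps (f : CocatHom V W) : ∀ {X Y : S}, Str V X Y → List (Str W (f.obj X) (f.obj Y))
  | _, _, .nil X => [.nil (f.obj X)]
  | _, _, .cons x s => compsAux f (.single x) s

end CocatHom

/-- An `A_∞`-functor: a pointed cocategory homomorphism which commutes with `b`. -/
structure AInfFunctor {S : Type u} (A : OpQuiver.{uk, u, v} k S) {S' : Type u'} (B : OpQuiver.{uk, u', v'} k S') extends
    CocatHom A.toGrQuiver B.toGrQuiver where
  comm : ∀ {X Y : S} (s : Str A.toGrQuiver X Y),
    ((toCocatHom.comps s).map B.b).sum =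
      (s.splits3.map fun p => sgn k p.right.deg •
        map (p.left.append (.cons (A.bArr p.mid) p.right))).sum

/-! ### Complexes and homotopies -/

/-- A complex of `k`-modules `P`, with differential `d` of degree `1`. -/
structure Cx (k : Type uk) [CommRing k] where
  carrier : Type w
  [acg : AddCommGroup carrier]
  [mod : Module k carrier]
  gr : ℤ → Submodule k carrier
  internal : DirectSum.IsInternal gr
  d : carrier →ₗ[k] carrier
  d_mem : ∀ i, ∀ p ∈ gr i, d p ∈ gr (i + 1)
  d_d : ∀ p, d (d p) = 0

attribute [instance] Cx.acg Cx.mod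

/-- A graded `k`-module, given by submodules `gr e` of an ambient module, with a map `D` defined
on homogeneous elements. (The graded module is the family `gr`; its sum need not
be the whole ambient module.) -/
structure GrWithD (k : Type uk) [CommRing k] where
  carrier : Type w
  [acg : AddCommGroup carrier]
  [mod : Module k carrier]
  gr : ℤ → Submodule k carrier
  D : ∀ e : ℤ, gr e → carrier

attribute [instance] GrWithD.acg GrWithD.mod

/-- `k`-linear maps of degree `m` from `P` to the graded module `C`. -/
def GrMap (P : Cx.{uk, w} k) {M : Type v} [AddCommGroup M] [Module k M]
    (C : ℤ → Submodule k M) (m : ℤ) : Submodule k (P.carrier →ₗ[k] M) where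
  carrier := {f | ∀ i, ∀ p ∈ P.gr i, f p ∈ C (i + m)}
  add_mem' hf hg i p hp := (C _).add_mem (hf i p hp) (hg i p hp)
  zero_mem' _ _ _ := (C _).zero_mem
  smul_mem' c _ hf i p hp := (C _).smul_mem c (hf i p hp)

/-- The composition of a degree `m` map with a linear map of degree `0`. -/
def GrMap.comp {P : Cx.{uk, w} k} {M : Type v} [AddCommGroup M] [Module k M]
    {C : ℤ → Submodule k M} {m : ℤ} (f : GrMap P C m) {N : Type v'} [AddCommGroup N] [Module k N]
    {C' : ℤ → Submodule k N} (g : M →ₗ[k] N) (hg : ∀ e, ∀ r ∈ C e, g r ∈ C' e) :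
    GrMap P C' m :=
  ⟨g.comp f.1, fun i p hp => hg _ _ (f.2 i p hp)⟩

/-- `u` commutes with the differentials: `du = uD`. -/
def IsChainMap {P : Cx.{uk, w} k} {C : GrWithD.{uk, v} k} (u : GrMap P C.gr 0) : Prop :=
  ∀ (i : ℤ) (p : P.carrier) (hp : p ∈ P.gr i), u.1 (P.d p) = C.D (i + 0) ⟨u.1 p, u.2 i p hp⟩

/-- The degree `-1` map `h` satisfies `u = dh + hD`. -/
def IsHomotopy {P : Cx.{uk, w} k} {C : GrWithD.{uk, v} k} (u : GrMap P C.gr 0)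
    (h : GrMap P C.gr (-1)) : Prop :=
  ∀ (i : ℤ) (p : P.carrier) (hp : p ∈ P.gr i),
    u.1 p = h.1 (P.d p) + C.D (i + -1) ⟨h.1 p, h.2 i p hp⟩

/-! ### `A_∞`-transformations -/

section Trans

variable {S : Type u} {V : GrQuiver.{uk, u, v} k S} {S' : Type u'} {W : GrQuiver.{uk, u', v'} k S'}

/-- Systems of functions `r = (rₙ)_{n ≥ 0}`; `rₙ` is the restriction to strings of length `n`. -/
abbrev PreTrans (φ ψ : CocatHom V W) := ∀ X Y : S, Str V X Y → W.Hom (φ.obj X) (ψ.obj Y)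

/-- The module of `(φ,ψ)`-transformations `r = (rₙ)_{n ≥ 0}` of degree `e`, that is, the
component of degree `e` of the graded module `sA_∞(𝒜,ℬ)(φ,ψ)`. -/
def Trans (φ ψ : CocatHom V W) (e : ℤ) : Submodule k (PreTrans φ ψ) where
  carrier := {r | ∀ X Y, IsMultilinear (r X Y) ∧
    ∀ s : Str V X Y, r X Y s ∈ W.gr (φ.obj X) (ψ.obj Y) (s.deg + e)}
  add_mem' {a b} ha hb X Y :=
    ⟨⟨fun s t d x y => by
        simp only [Pi.add_apply, (ha X Y).1.add, (hb X Y).1.add]; abel,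
      fun s t d c x => by
        simp only [Pi.add_apply, (ha X Y).1.smul, (hb X Y).1.smul, smul_add]⟩,
      fun s => Submodule.add_mem _ ((ha X Y).2 s) ((hb X Y).2 s)⟩
  zero_mem' X Y := ⟨⟨by simp, by simp⟩, fun s => Submodule.zero_mem _⟩
  smul_mem' c a ha X Y :=
    ⟨⟨fun s t d x y => by simp only [Pi.smul_apply, (ha X Y).1.add, smul_add],
      fun s t d c' x => by
        simp only [Pi.smul_apply, (ha X Y).1.smul]; rw [smul_comm]⟩,
      fun s => Submodule.smul_mem _ _ ((ha X Y).2 s)⟩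

def transArr {φ ψ : CocatHom V W} {e : ℤ} (r : Trans φ ψ e) {X Y : S} (s : Str V X Y) :
    Arrow W (φ.obj X) (ψ.obj Y) :=
  ⟨s.deg + e, r.1 X Y s, (r.2 X Y).2 s⟩

/-- Functions on the strings of length `n`. -/
abbrev PreComp (φ ψ : CocatHom V W) (n : ℕ) :=
  ∀ X Y : S, {s : Str V X Y // s.length = n} → W.Hom (φ.obj X) (ψ.obj Y)

/-- The component of degree `e` of the graded module `∏_{X,Y} C(V^{⊗n}(X,Y), W(Xφ,Yψ))`. -/
def Comp (φ ψ : CocatHom V W) (n : ℕ) (e : ℤ) : Submodule k (PreComp φ ψ n) where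
  carrier := {r | ∀ X Y,
    (∀ {Z Z' : S} (s : Str V X Z) (t : Str V Z' Y) (d : ℤ) (x y : V.gr Z Z' d) (h₀ h₁ h₂),
      r X Y ⟨s.append (.cons ⟨d, x + y⟩ t), h₀⟩ =
        r X Y ⟨s.append (.cons ⟨d, x⟩ t), h₁⟩ + r X Y ⟨s.append (.cons ⟨d, y⟩ t), h₂⟩) ∧
    (∀ {Z Z' : S} (s : Str V X Z) (t : Str V Z' Y) (d : ℤ) (c : k) (x : V.gr Z Z' d) (h₀ h₁),
      r X Y ⟨s.append (.cons ⟨d, c • x⟩ t), h₀⟩ =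
        c • r X Y ⟨s.append (.cons ⟨d, x⟩ t), h₁⟩) ∧
    ∀ s, r X Y s ∈ W.gr (φ.obj X) (ψ.obj Y) (s.1.deg + e)}
  add_mem' {a b} ha hb X Y :=
    ⟨fun s t d x y h₀ h₁ h₂ => by
        simp only [Pi.add_apply, (ha X Y).1 s t d x y h₀ h₁ h₂, (hb X Y).1 s t d x y h₀ h₁ h₂]
        abel,
      fun s t d c x h₀ h₁ => by
        simp only [Pi.add_apply, (ha X Y).2.1 s t d c x h₀ h₁, (hb X Y).2.1 s t d c x h₀ h₁,
          smul_add],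
      fun s => Submodule.add_mem _ ((ha X Y).2.2 s) ((hb X Y).2.2 s)⟩
  zero_mem' X Y := ⟨by simp, by simp, fun s => Submodule.zero_mem _⟩
  smul_mem' c a ha X Y :=
    ⟨fun s t d x y h₀ h₁ h₂ => by
        simp only [Pi.smul_apply, (ha X Y).1 s t d x y h₀ h₁ h₂, smul_add],
      fun s t d c' x h₀ h₁ => by
        simp only [Pi.smul_apply, (ha X Y).2.1 s t d c' x h₀ h₁]; rw [smul_comm],
      fun s => Submodule.smul_mem _ _ ((ha X Y).2.2 s)⟩

/-- The projection `pr_n : r ↦ r_n`. -/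
def prComp (φ ψ : CocatHom V W) (n : ℕ) : PreTrans φ ψ →ₗ[k] PreComp φ ψ n where
  toFun r X Y s := r X Y s.1
  map_add' _ _ := rfl
  map_smul' _ _ := rfl

theorem prComp_mem (φ ψ : CocatHom V W) (n : ℕ) (e : ℤ) (r : PreTrans φ ψ)
    (hr : r ∈ Trans φ ψ e) : prComp φ ψ n r ∈ Comp φ ψ n e := fun X Y =>
  ⟨fun s t d x y _ _ _ => (hr X Y).1.add s t d x y,
    fun s t d c x _ _ => (hr X Y).1.smul s t d c x, fun s => (hr X Y).2 s.1⟩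

end Trans

/-- For a transformation `r` of degree `e` and a string `s` of length `n`: the value at `s` of
`∑ (φ_{aα} ⊗ r_q ⊗ ψ_{cβ}) b_{α+1+β}`, the sum over `a + q + c = n` and all `α`, `β`. -/
def transB {S : Type u} {V : GrQuiver.{uk, u, v} k S} {S' : Type u'} {B : OpQuiver.{uk, u', v'} k S'}
    {φ ψ : CocatHom V B.toGrQuiver} {e : ℤ} (r : Trans φ ψ e) {X Y : S} (s : Str V X Y) :
    B.Hom (φ.obj X) (ψ.obj Y) :=
  (s.splits3.map fun p => sgn k (e * p.right.deg) •
    ((φ.comps p.left).map fun a => ((ψ.comps p.right).map fun c =>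
      B.b (a.append (.cons (transArr r p.mid) c))).sum).sum).sum

/-- For a transformation `r` and a string `s` of length `n`: the value at `s` of
`∑ (1^{⊗a} ⊗ b_q ⊗ 1^{⊗c}) r_{a+1+c}`, the sum over `a + q + c = n` (with `q ≥ 1`). -/
def bTrans {S : Type u} {A : OpQuiver.{uk, u, v} k S} {S' : Type u'} {W : GrQuiver.{uk, u', v'} k S'}
    {φ ψ : CocatHom A.toGrQuiver W} (r : PreTrans φ ψ) {X Y : S} (s : Str A.toGrQuiver X Y) :
    W.Hom (φ.obj X) (ψ.obj Y) :=
  (s.splits3.map fun p => sgn k p.right.deg •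
    r X Y (p.left.append (.cons (A.bArr p.mid) p.right))).sum

/-- The same sum as `bTrans`, restricted to the terms with `a + c > 0`. -/
def bTransProper {S : Type u} {A : OpQuiver.{uk, u, v} k S} {S' : Type u'} {W : GrQuiver.{uk, u', v'} k S'}
    {φ ψ : CocatHom A.toGrQuiver W} (r : PreTrans φ ψ) {X Y : S} (s : Str A.toGrQuiver X Y) :
    W.Hom (φ.obj X) (ψ.obj Y) :=
  ((s.splits3.filter fun p => 0 < p.left.length + p.right.length).map fun p =>
    sgn k p.right.deg • r X Y (p.left.append (.cons (A.bArr p.mid) p.right))).sum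

/-- `(sA_∞(𝒜,ℬ)(φ,ψ), B₁)`, where `rB₁ = rb - (-1)^r br`. -/
def sAInf {S : Type u} {A : OpQuiver.{uk, u, v} k S} {S' : Type u'} {B : OpQuiver.{uk, u', v'} k S'} (φ ψ : AInfFunctor A B) :
    GrWithD k where
  carrier := PreTrans φ.toCocatHom ψ.toCocatHom
  gr := Trans φ.toCocatHom ψ.toCocatHom
  D e r := fun _ _ s => transB r s - sgn k e • bTrans r.1 s

/-! ### Differential graded quivers and `A₁`-transformations -/

/-- A differential graded quiver `𝒬`, recorded by `(s𝒬, d)`. -/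
structure DGQuiver (k : Type uk) [CommRing k] (S : Type u) extends GrQuiver.{uk, u, v} k S where
  d : ∀ {X Y : S}, Hom X Y →ₗ[k] Hom X Y
  d_mem : ∀ {X Y : S} (i : ℤ), ∀ x ∈ gr X Y i, d x ∈ gr X Y (i + 1)
  d_d : ∀ {X Y : S} (x : Hom X Y), d (d x) = 0

def DGQuiver.dArr {S : Type u} (Q : DGQuiver.{uk, u, v} k S) {X Y : S} (x : Arrow Q.toGrQuiver X Y) :
    Arrow Q.toGrQuiver X Y :=
  ⟨x.1 + 1, Q.d x.2.1, Q.d_mem _ _ x.2.2⟩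

/-- A chain morphism of differential graded quivers `(s𝒬, d) → (s𝒜, b₁)`, i.e. an
`A₁`-functor. -/
structure A1Functor {S : Type u} (Q : DGQuiver.{uk, u, v} k S) {S' : Type u'} (A : OpQuiver.{uk, u', v'} k S') where
  obj : S → S'
  map : ∀ {X Y : S}, Arrow Q.toGrQuiver X Y → A.Hom (obj X) (obj Y)
  map_add : ∀ {X Y : S} (d : ℤ) (x y : Q.gr X Y d), map ⟨d, x + y⟩ = map ⟨d, x⟩ + map ⟨d, y⟩
  map_smul : ∀ {X Y : S} (d : ℤ) (c : k) (x : Q.gr X Y d), map ⟨d, c • x⟩ = c • map ⟨d, x⟩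
  map_mem : ∀ {X Y : S} (x : Arrow Q.toGrQuiver X Y), map x ∈ A.gr (obj X) (obj Y) x.1
  chain : ∀ {X Y : S} (x : Arrow Q.toGrQuiver X Y),
    A.b (.single ⟨x.1, map x, map_mem x⟩) = map (Q.dArr x)

def A1Functor.arr {S : Type u} {Q : DGQuiver.{uk, u, v} k S} {S' : Type u'} {A : OpQuiver.{uk, u', v'} k S'} (f : A1Functor Q A)
    {X Y : S} (x : Arrow Q.toGrQuiver X Y) : Arrow A.toGrQuiver (f.obj X) (f.obj Y) :=
  ⟨x.1, f.map x, f.map_mem x⟩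

section A1

variable {S : Type u} {Q : DGQuiver.{uk, u, v} k S} {S' : Type u'} {A : OpQuiver.{uk, u', v'} k S'}

/-- Pairs of systems of functions `(r₀, r₁)`. -/
abbrev PreTrans1 (φ ψ : A1Functor Q A) :=
  (∀ X : S, A.Hom (φ.obj X) (ψ.obj X)) ×
    (∀ X Y : S, Arrow Q.toGrQuiver X Y → A.Hom (φ.obj X) (ψ.obj Y))

/-- The component of degree `e` of the graded module
`∏_X s𝒜(Xφ,Xψ) × ∏_{X,Y} C(s𝒬(X,Y), s𝒜(Xφ,Yψ))`. -/
def Trans1 (φ ψ : A1Functor Q A) (e : ℤ) : Submodule k (PreTrans1 φ ψ) where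
  carrier := {r | (∀ X, r.1 X ∈ A.gr (φ.obj X) (ψ.obj X) e) ∧ ∀ X Y,
    (∀ (d : ℤ) (x y : Q.gr X Y d), r.2 X Y ⟨d, x + y⟩ = r.2 X Y ⟨d, x⟩ + r.2 X Y ⟨d, y⟩) ∧
    (∀ (d : ℤ) (c : k) (x : Q.gr X Y d), r.2 X Y ⟨d, c • x⟩ = c • r.2 X Y ⟨d, x⟩) ∧
    ∀ x : Arrow Q.toGrQuiver X Y, r.2 X Y x ∈ A.gr (φ.obj X) (ψ.obj Y) (x.1 + e)}
  add_mem' {a b} ha hb :=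
    ⟨fun X => Submodule.add_mem _ (ha.1 X) (hb.1 X), fun X Y =>
      ⟨fun d x y => by
        simp only [Prod.snd_add, Pi.add_apply, (ha.2 X Y).1, (hb.2 X Y).1]; abel,
      fun d c x => by
        simp only [Prod.snd_add, Pi.add_apply, (ha.2 X Y).2.1, (hb.2 X Y).2.1, smul_add],
      fun x => Submodule.add_mem _ ((ha.2 X Y).2.2 x) ((hb.2 X Y).2.2 x)⟩⟩
  zero_mem' := ⟨fun X => Submodule.zero_mem _, fun X Y =>
    ⟨by simp, by simp, fun x => Submodule.zero_mem _⟩⟩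
  smul_mem' c a ha :=
    ⟨fun X => Submodule.smul_mem _ _ (ha.1 X), fun X Y =>
      ⟨fun d x y => by
        simp only [Prod.smul_snd, Pi.smul_apply, (ha.2 X Y).1, smul_add],
      fun d c' x => by
        simp only [Prod.smul_snd, Pi.smul_apply, (ha.2 X Y).2.1]; rw [smul_comm],
      fun x => Submodule.smul_mem _ _ ((ha.2 X Y).2.2 x)⟩⟩

/-- `(sA₁(𝒬,𝒜)(φ,ψ), B₁)`, where `(rB₁)₀ = r₀b₁` and
`(rB₁)₁ = r₁b₁ + (φ₁ ⊗ r₀)b₂ + (r₀ ⊗ ψ₁)b₂ - (-1)^r dr₁`. -/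
def sA1 (φ ψ : A1Functor Q A) : GrWithD k where
  carrier := PreTrans1 φ ψ
  gr := Trans1 φ ψ
  D e r :=
    (fun X => A.b (.single ⟨e, r.1.1 X, r.2.1 X⟩),
     fun X Y x =>
      A.b (.single ⟨x.1 + e, r.1.2 X Y x, (r.2.2 X Y).2.2 x⟩)
      + A.b (.cons (φ.arr x) (.single ⟨e, r.1.1 Y, r.2.1 Y⟩))
      + sgn k (e * x.1) • A.b (.cons ⟨e, r.1.1 X, r.2.1 X⟩ (.single (ψ.arr x)))
      - sgn k e • r.1.2 X Y (Q.dArr x))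

end A1

/-! ### Tensor powers of a quiver -/

section Tensor

variable {S : Type u} (V : GrQuiver.{uk, u, v} k S)

/-- The defining relations of the tensor product. -/
inductive TRel (X Y : S) : (Str V X Y →₀ k) → Prop
  | add {Z W : S} (s : Str V X Z) (t : Str V W Y) (d : ℤ) (x y : V.gr Z W d) :
      TRel X Y (Finsupp.single (s.append (.cons ⟨d, x + y⟩ t)) 1
        - Finsupp.single (s.append (.cons ⟨d, x⟩ t)) 1
        - Finsupp.single (s.append (.cons ⟨d, y⟩ t)) 1)
  | smul {Z W : S} (s : Str V X Z) (t : Str V W Y) (d : ℤ) (c : k) (x : V.gr Z W d) :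
      TRel X Y (Finsupp.single (s.append (.cons ⟨d, c • x⟩ t)) 1
        - c • Finsupp.single (s.append (.cons ⟨d, x⟩ t)) 1)

/-- The module `TV(X,Y) = ⨁ₙ TⁿV(X,Y)`, where `TⁿV(X,Y)` is the direct sum of the
`V(X₀,X₁) ⊗ ⋯ ⊗ V(Xₙ₋₁,Xₙ)`, `X₀ = X`, `Xₙ = Y`: the free module on
the composable strings of homogeneous elements, modulo linearity in every entry. -/
def T (X Y : S) : Type (max uk u v) :=
  (Str V X Y →₀ k) ⧸ Submodule.span k {r | TRel V X Y r}

instance T.instAddCommGroup (X Y : S) : AddCommGroup (T V X Y) :=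
  inferInstanceAs (AddCommGroup ((Str V X Y →₀ k) ⧸ Submodule.span k {r | TRel V X Y r}))

instance T.instModule (X Y : S) : Module k (T V X Y) :=
  inferInstanceAs (Module k ((Str V X Y →₀ k) ⧸ Submodule.span k {r | TRel V X Y r}))

namespace T

variable {V}

/-- The element `x₁ ⊗ ⋯ ⊗ xₙ`. -/
def tprod {X Y : S} (s : Str V X Y) : T V X Y :=
  Submodule.Quotient.mk (Finsupp.single s 1)

/-- The linear map induced by a multilinear function on strings. -/
def lift {X Y : S} {M : Type w} [AddCommGroup M] [Module k M] (f : Str V X Y → M)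
    (hf : IsMultilinear f) : T V X Y →ₗ[k] M :=
  (Submodule.span k {r | TRel V X Y r}).liftQ (Finsupp.linearCombination k f) (by
    rw [Submodule.span_le]
    rintro _ (⟨s, t, d, x, y⟩ | ⟨s, t, d, c, x⟩)
    · simp [hf.add]
    · simp [hf.smul])

@[simp] theorem lift_tprod {X Y : S} {M : Type w} [AddCommGroup M] [Module k M]
    (f : Str V X Y → M) (hf : IsMultilinear f) (s : Str V X Y) : lift f hf (tprod s) = f s := by
  unfold lift tprod
  erw [Submodule.liftQ_apply]
  simp

theorem tprod_multilinear (X Y : S) : IsMultilinear (tprod (V := V) (X := X) (Y := Y)) where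
  add s t d x y := by
    have h := (Submodule.Quotient.mk_eq_zero (Submodule.span k {r | TRel V X Y r})).2
      (Submodule.subset_span (TRel.add s t d x y))
    rw [Submodule.Quotient.mk_sub, Submodule.Quotient.mk_sub, sub_sub, sub_eq_zero] at h
    exact h
  smul s t d c x := by
    have h := (Submodule.Quotient.mk_eq_zero (Submodule.span k {r | TRel V X Y r})).2
      (Submodule.subset_span (TRel.smul s t d c x))
    rw [Submodule.Quotient.mk_sub, Submodule.Quotient.mk_smul, sub_eq_zero] at h
    exact h

theorem span_tprod (X Y : S) : Submodule.span k (Set.range (tprod (V := V) (X := X) (Y := Y))) = ⊤ := by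
  rw [eq_top_iff]
  rintro x -
  induction x using Submodule.Quotient.induction_on with
  | H x =>
    induction x using Finsupp.induction_linear with
    | zero => exact Submodule.zero_mem _
    | add f g hf hg => exact Submodule.add_mem _ hf hg
    | single s c =>
      have : (Submodule.Quotient.mk (Finsupp.single s c) : T V X Y) = c • tprod s := by
        rw [← Finsupp.smul_single_one]; rfl
      erw [this]
      exact Submodule.smul_mem _ _ (Submodule.subset_span ⟨s, rfl⟩)

theorem hom_ext {X Y : S} {M : Type w} [AddCommGroup M] [Module k M] {f g : T V X Y →ₗ[k] M}
    (h : ∀ s, f (tprod s) = g (tprod s)) : f = g :=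
  LinearMap.ext_on (span_tprod X Y) (by rintro _ ⟨s, rfl⟩; exact h s)

/-- `Tⁿ V(X,Y)`. -/
def len (X Y : S) (n : ℕ) : Submodule k (T V X Y) :=
  Submodule.span k {x | ∃ s : Str V X Y, s.length = n ∧ tprod s = x}

/-- The component of degree `e` of `Tⁿ V(X,Y)`. -/
def part (X Y : S) (n : ℕ) (e : ℤ) : Submodule k (T V X Y) :=
  Submodule.span k {x | ∃ s : Str V X Y, s.length = n ∧ s.deg = e ∧ tprod s = x}

theorem tprod_append_left {X Y Z : S} (s : Str V X Y) :
    IsMultilinear fun t : Str V Y Z => tprod (s.append t) where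
  add a b d x y := by
    simp only [← Str.append_assoc]; exact (tprod_multilinear X Z).add _ _ _ _ _
  smul a b d c x := by
    simp only [← Str.append_assoc]; exact (tprod_multilinear X Z).smul _ _ _ _ _

/-- Concatenation of tensors. -/
def mul {X Y Z : S} : T V X Y →ₗ[k] T V Y Z →ₗ[k] T V X Z :=
  lift (fun s => lift (fun t => tprod (s.append t)) (tprod_append_left s))
    ⟨fun a b d x y => hom_ext fun t => by
        simp only [lift_tprod, LinearMap.add_apply, Str.append_assoc, Str.append]
        exact (tprod_multilinear X Z).add _ _ _ _ _,
      fun a b d c x => hom_ext fun t => by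
        simp only [lift_tprod, LinearMap.smul_apply, Str.append_assoc, Str.append]
        exact (tprod_multilinear X Z).smul _ _ _ _ _⟩

@[simp] theorem mul_tprod {X Y Z : S} (s : Str V X Y) (t : Str V Y Z) :
    mul (tprod s) (tprod t) = tprod (s.append t) := by
  simp [mul]

theorem mul_mem_part {X Y Z : S} {m n : ℕ} {d e : ℤ} {x : T V X Y} {y : T V Y Z}
    (hx : x ∈ part X Y m d) (hy : y ∈ part Y Z n e) : mul x y ∈ part X Z (m + n) (d + e) := by
  unfold part at hx
  induction hx using Submodule.span_induction with
  | mem x hx =>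
    obtain ⟨s, rfl, rfl, rfl⟩ := hx
    unfold part at hy
    induction hy using Submodule.span_induction with
    | mem y hy =>
      obtain ⟨t, rfl, rfl, rfl⟩ := hy
      rw [mul_tprod]
      exact Submodule.subset_span ⟨_, Str.length_append _ _, Str.deg_append _ _, rfl⟩
    | zero => simp
    | add a b _ _ ha hb => rw [map_add]; exact Submodule.add_mem _ ha hb
    | smul c a _ ha => rw [map_smul]; exact Submodule.smul_mem _ _ ha
  | zero => simp
  | add a b _ _ ha hb => rw [map_add, LinearMap.add_apply]; exact Submodule.add_mem _ ha hb
  | smul c a _ ha => rw [map_smul, LinearMap.smul_apply]; exact Submodule.smul_mem _ _ ha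

/-- The projection of `T V(X,Y)` to its part of degree `e`. -/
def proj (X Y : S) (e : ℤ) : T V X Y →ₗ[k] T V X Y :=
  lift (fun s => if s.deg = e then tprod s else 0)
    ⟨fun s t d x y => by
        simp only [Str.deg_append, Str.deg, (tprod_multilinear X Y).add]
        split_ifs <;> simp,
      fun s t d c x => by
        simp only [Str.deg_append, Str.deg, (tprod_multilinear X Y).smul]
        split_ifs <;> simp⟩

theorem proj_of_mem {X Y : S} {n : ℕ} {d : ℤ} {x : T V X Y} (hx : x ∈ part X Y n d) (e : ℤ) :
    proj X Y e x = if d = e then x else 0 := by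
  unfold part at hx
  induction hx using Submodule.span_induction with
  | mem x hx =>
    obtain ⟨s, rfl, rfl, rfl⟩ := hx
    simp [proj]
  | zero => simp
  | add a b _ _ ha hb => rw [map_add, ha, hb]; split_ifs <;> simp
  | smul c a _ ha => rw [map_smul, ha]; split_ifs <;> simp

end T

end Tensor

/-- The differential `∑ 1^{⊗i} ⊗ d ⊗ 1^{⊗j}` at `x₁ ⊗ ⋯ ⊗ xₙ`. -/
def dStr {S : Type u} (Q : DGQuiver.{uk, u, v} k S) : ∀ {X Y : S}, Str Q.toGrQuiver X Y → T Q.toGrQuiver X Y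
  | _, _, .nil _ => 0
  | _, _, .cons x s =>
      sgn k s.deg • T.tprod (.cons (Q.dArr x) s) + T.mul (T.tprod (.single x)) (dStr Q s)

theorem sgn_succ (n : ℤ) : sgn k (n + 1) = -sgn k n := by
  simp [sgn, Int.negOnePow_succ]

theorem T.tprod_cons_add {S : Type u} {V : GrQuiver.{uk, u, v} k S} {X Y Z : S} (d : ℤ) (x y : V.gr X Y d)
    (s : Str V Y Z) : T.tprod (.cons ⟨d, x + y⟩ s) =
      T.tprod (.cons ⟨d, x⟩ s) + T.tprod (.cons ⟨d, y⟩ s) :=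
  (T.tprod_multilinear X Z).add (.nil X) s d x y

theorem T.tprod_cons_smul {S : Type u} {V : GrQuiver.{uk, u, v} k S} {X Y Z : S} (d : ℤ) (c : k)
    (x : V.gr X Y d) (s : Str V Y Z) : T.tprod (.cons ⟨d, c • x⟩ s) =
      c • T.tprod (.cons ⟨d, x⟩ s) :=
  (T.tprod_multilinear X Z).smul (.nil X) s d c x

theorem dStr_multilinear {S : Type u} (Q : DGQuiver.{uk, u, v} k S) (X Y : S) :
    IsMultilinear (dStr Q (X := X) (Y := Y)) where
  add s t d x y := by
    induction s with
    | nil X =>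
      simp only [Str.append, dStr, Str.single]
      have h : Q.dArr ⟨d, x + y⟩ = ⟨d + 1, ⟨Q.d x.1, Q.d_mem _ _ x.2⟩ + ⟨Q.d y.1, Q.d_mem _ _ y.2⟩⟩ := by
        unfold DGQuiver.dArr
        congr 1
        apply Subtype.ext
        simp
      rw [h, T.tprod_cons_add, T.tprod_cons_add, map_add]
      simp only [LinearMap.add_apply, smul_add, DGQuiver.dArr]
      abel
    | cons a s ih =>
      simp only [Str.append, dStr, ih]
      rw [show ∀ z : Q.gr _ _ d, Str.cons (Q.dArr a) (s.append (.cons ⟨d, z⟩ t)) =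
        (Str.cons (Q.dArr a) s).append (.cons ⟨d, z⟩ t) from fun _ => rfl,
        (T.tprod_multilinear _ _).add]
      simp only [Str.deg_append, Str.deg, smul_add, map_add]
      simp only [Str.append]
      abel
  smul s t d c x := by
    induction s with
    | nil X =>
      simp only [Str.append, dStr, Str.single]
      have h : Q.dArr ⟨d, c • x⟩ = ⟨d + 1, c • ⟨Q.d x.1, Q.d_mem _ _ x.2⟩⟩ := by
        unfold DGQuiver.dArr
        congr 1
        apply Subtype.ext
        simp
      rw [h, T.tprod_cons_smul, T.tprod_cons_smul, map_smul]
      simp only [LinearMap.smul_apply, smul_add, DGQuiver.dArr]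
      rw [smul_comm]
    | cons a s ih =>
      simp only [Str.append, dStr, ih]
      rw [show ∀ z : Q.gr _ _ d, Str.cons (Q.dArr a) (s.append (.cons ⟨d, z⟩ t)) =
        (Str.cons (Q.dArr a) s).append (.cons ⟨d, z⟩ t) from fun _ => rfl,
        (T.tprod_multilinear _ _).smul]
      simp only [Str.deg_append, Str.deg, smul_add, map_smul]
      simp only [Str.append]
      rw [smul_comm]

/-- The differential `∑ 1^{⊗i} ⊗ d ⊗ 1^{⊗j}` of `T s𝒬(X,Y)`. -/
def T.diff {S : Type u} (Q : DGQuiver.{uk, u, v} k S) (X Y : S) :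
    T Q.toGrQuiver X Y →ₗ[k] T Q.toGrQuiver X Y :=
  T.lift (dStr Q) (dStr_multilinear Q X Y)

theorem dStr_mem {S : Type u} (Q : DGQuiver.{uk, u, v} k S) : ∀ {X Y : S} (s : Str Q.toGrQuiver X Y),
    dStr Q s ∈ T.part X Y s.length (s.deg + 1)
  | _, _, .nil _ => Submodule.zero_mem _
  | _, _, .cons x s => by
      refine Submodule.add_mem _ (Submodule.smul_mem _ _ (Submodule.subset_span
        ⟨.cons (Q.dArr x) s, rfl, ?_, rfl⟩)) ?_
      · simp only [Str.deg, DGQuiver.dArr]; ring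
      · have h1 : T.tprod (Str.single x) ∈ T.part _ _ 1 x.1 :=
          Submodule.subset_span ⟨_, rfl, by simp [Str.single, Str.deg], rfl⟩
        have := T.mul_mem_part h1 (dStr_mem Q s)
        rwa [add_comm 1, ← add_assoc] at this

theorem T.diff_mem {S : Type u} (Q : DGQuiver.{uk, u, v} k S) {X Y : S} {n : ℕ} {e : ℤ}
    {x : T Q.toGrQuiver X Y} (hx : x ∈ T.part X Y n e) : T.diff Q X Y x ∈ T.part X Y n (e + 1) := by
  unfold T.part at hx
  induction hx using Submodule.span_induction with
  | mem x hx =>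
    obtain ⟨s, rfl, rfl, rfl⟩ := hx
    rw [T.diff, T.lift_tprod]
    exact dStr_mem Q s
  | zero => simp
  | add a b _ _ ha hb => rw [map_add]; exact Submodule.add_mem _ ha hb
  | smul c a _ ha => rw [map_smul]; exact Submodule.smul_mem _ _ ha

/-! ### Plane rooted trees -/

/-- Plane rooted trees in which every internal vertex has at least two incoming edges:
`leaf` is the tree without internal vertices, and `node t₁ t₂ [t₃, …, tₙ]` is
`(t₁ ⊔ ⋯ ⊔ tₙ) · 𝔱ₙ`. -/
inductive PTree
  | leaf : PTree
  | node (t₁ t₂ : PTree) (ts : List PTree) : PTree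

namespace PTree

mutual

/-- The number of input vertices. -/
def leaves : PTree → ℕ
  | leaf => 1
  | node t₁ t₂ ts => leaves t₁ + (leaves t₂ + leavesL ts)

def leavesL : List PTree → ℕ
  | [] => 0
  | t :: ts => leaves t + leavesL ts

end

mutual

/-- The number `|t|` of internal vertices. -/
def verts : PTree → ℕ
  | leaf => 0
  | node t₁ t₂ ts => verts t₁ + (verts t₂ + vertsL ts) + 1

def vertsL : List PTree → ℕ
  | [] => 0
  | t :: ts => verts t + vertsL ts

end

/-- `(t₁ ⊔ ⋯ ⊔ tₙ) · 𝔱ₙ` for `n ≥ 2` (and, by convention, `t₁` for `n = 1`). -/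
def graft : List PTree → PTree
  | [] => leaf
  | [t] => t
  | t₁ :: t₂ :: ts => node t₁ t₂ ts

/-- For a forest `F = α ⊔ σ ⊔ β` with `σ` consisting of at least two but not of all trees of `F`:
the forest `α ⊔ (σ · 𝔱) ⊔ β`, together with the number `|α|`. -/
def groupings (F : List PTree) : List (List PTree × ℕ) :=
  (List.range (F.length + 1)).flatMap fun i =>
    ((List.range (F.length + 1)).filter fun j => i + 2 ≤ j ∧ j - i < F.length).map fun j =>
      (F.take i ++ graft ((F.take j).drop i) :: F.drop j, vertsL (F.take i))

mutual

/-- All pairs `(t', e)` of a tree `t'` with an edge `e` between two internal vertices, such that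
contracting `e` yields `t`. The pair is recorded as `(t', h)`, where `h` is the height of the upper
vertex of `e`: its number, counted from `1`, in the linear order on the internal vertices of `t'` in
which the root vertex comes first, followed by the vertices of the first subtree, then
by those of the second one, and so on. The new edge is either adjacent to
the root vertex of `t` or obtained by expanding a vertex in one of the subtrees. -/
def expansions : PTree → List (PTree × ℕ)
  | leaf => []
  | node t₁ t₂ ts =>
      ((groupings (t₁ :: t₂ :: ts)).map fun p => (graft p.1, p.2 + 2)) ++
      ((expansions t₁).map fun p => (node p.1 t₂ ts, 1 + p.2)) ++
      ((expansions t₂).map fun p => (node t₁ p.1 ts, 1 + verts t₁ + p.2)) ++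
      ((expansionsL ts).map fun p => (node t₁ t₂ p.1, 1 + verts t₁ + verts t₂ + p.2))

/-- The same for forests. -/
def expansionsL : List PTree → List (List PTree × ℕ)
  | [] => []
  | t :: ts =>
      ((expansions t).map fun p => (p.1 :: ts, p.2)) ++
      ((expansionsL ts).map fun p => (t :: p.1, verts t + p.2))

end

theorem leavesL_append (F G : List PTree) : leavesL (F ++ G) = leavesL F + leavesL G := by
  induction F with
  | nil => simp [leavesL]
  | cons t F ih => simp [leavesL, ih, add_assoc]

theorem vertsL_append (F G : List PTree) : vertsL (F ++ G) = vertsL F + vertsL G := by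
  induction F with
  | nil => simp [vertsL]
  | cons t F ih => simp [vertsL, ih, add_assoc]

theorem leaves_graft : ∀ F : List PTree, F ≠ [] → leaves (graft F) = leavesL F
  | [], h => absurd rfl h
  | [t], _ => by simp [graft, leavesL]
  | _ :: _ :: _, _ => by simp [graft, leavesL, leaves]

theorem verts_graft : ∀ F : List PTree, 2 ≤ F.length → verts (graft F) = vertsL F + 1
  | [], h => by simp at h
  | [t], h => by simp at h
  | _ :: _ :: _, _ => by simp [graft, vertsL, verts]

theorem groupings_spec (F : List PTree) : ∀ p ∈ groupings F,
    leavesL p.1 = leavesL F ∧ vertsL p.1 = vertsL F + 1 ∧ 2 ≤ p.1.length := by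
  intro p hp
  simp only [groupings, List.mem_flatMap, List.mem_range, List.mem_map, List.mem_filter,
    decide_eq_true_eq] at hp
  obtain ⟨i, hi, j, ⟨hj, hij, hlt⟩, rfl⟩ := hp
  have hseg : ((F.take j).drop i).length = j - i := by
    rw [List.length_drop, List.length_take]; omega
  have hF : F = F.take i ++ ((F.take j).drop i ++ F.drop j) := by
    rw [← List.append_assoc]
    conv_lhs => rw [← List.take_append_drop j F]
    congr 1
    conv_lhs => rw [← List.take_append_drop i (F.take j)]
    rw [List.take_take, min_eq_left (by omega)]
  have hne : (F.take j).drop i ≠ [] := by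
    intro h; rw [h] at hseg; simp at hseg; omega
  refine ⟨?_, ?_, ?_⟩
  · conv_rhs => rw [hF]
    simp only [leavesL_append, leavesL, leaves_graft _ hne]
  · conv_rhs => rw [hF]
    simp only [vertsL_append, vertsL, verts_graft _ (by rw [hseg]; omega)]
    omega
  · simp only [List.length_append, List.length_cons, List.length_take, List.length_drop]
    omega

mutual

theorem expansions_spec : ∀ t : PTree, ∀ p ∈ expansions t,
    leaves p.1 = leaves t ∧ verts p.1 = verts t + 1
  | leaf, p, hp => by simp [expansions] at hp
  | node t₁ t₂ ts, p, hp => by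
      simp only [expansions, List.mem_append, List.mem_map] at hp
      rcases hp with ((⟨q, hq, rfl⟩ | ⟨q, hq, rfl⟩) | ⟨q, hq, rfl⟩) | ⟨q, hq, rfl⟩
      · have h := groupings_spec _ q hq
        have hne : q.1 ≠ [] := by intro h0; rw [h0] at h; simp at h
        simp only [leaves_graft _ hne, verts_graft _ h.2.2, h.1, h.2.1]
        simp [leavesL, vertsL, leaves, verts]
      · have h := expansions_spec t₁ q hq
        exact ⟨by simp only [leaves, h.1]; try omega, by simp only [verts, h.2]; omega⟩
      · have h := expansions_spec t₂ q hq
        exact ⟨by simp only [leaves, h.1]; try omega, by simp only [verts, h.2]; omega⟩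
      · have h := expansionsL_spec ts q hq
        exact ⟨by simp only [leaves, h.1]; try omega, by simp only [verts, h.2]; omega⟩

theorem expansionsL_spec : ∀ ts : List PTree, ∀ p ∈ expansionsL ts,
    leavesL p.1 = leavesL ts ∧ vertsL p.1 = vertsL ts + 1
  | [], p, hp => by simp [expansionsL] at hp
  | t :: ts, p, hp => by
      simp only [expansionsL, List.mem_append, List.mem_map] at hp
      rcases hp with ⟨q, hq, rfl⟩ | ⟨q, hq, rfl⟩
      · have h := expansions_spec t q hq
        exact ⟨by simp only [leavesL, h.1]; try omega, by simp only [vertsL, h.2]; omega⟩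
      · have h := expansionsL_spec ts q hq
        exact ⟨by simp only [leavesL, h.1]; try omega, by simp only [vertsL, h.2]; omega⟩

end

end PTree

/-! ### The free `A_∞`-category -/

namespace Free

section Gr

variable {S : Type u} (V : GrQuiver.{uk, u, v} k S)

/-- `⨁_t s𝓕_t𝒬(X,Y)` with `s𝓕_t𝒬(X,Y) = Tⁿs𝒬(X,Y)`, `n` the number of input vertices of `t`. -/
def Hom (X Y : S) : Submodule k (PTree →₀ T V X Y) where
  carrier := {f | ∀ t, f t ∈ T.len X Y t.leaves}
  add_mem' hf hg t := by rw [Finsupp.add_apply]; exact Submodule.add_mem _ (hf t) (hg t)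
  zero_mem' t := Submodule.zero_mem _
  smul_mem' c _ hf t := by rw [Finsupp.smul_apply]; exact Submodule.smul_mem _ _ (hf t)

/-- Families of elements of the `s𝓕_t𝒬(X,Y)^d = (Tⁿs𝒬(X,Y)[-|t|])^d = Tⁿs𝒬(X,Y)^{d-|t|}`. -/
def homDeg (X Y : S) (d : ℤ) : Submodule k (PTree →₀ T V X Y) where
  carrier := {f | ∀ t, f t ∈ T.part X Y t.leaves (d - t.verts)}
  add_mem' hf hg t := by rw [Finsupp.add_apply]; exact Submodule.add_mem _ (hf t) (hg t)
  zero_mem' t := Submodule.zero_mem _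
  smul_mem' c _ hf t := by rw [Finsupp.smul_apply]; exact Submodule.smul_mem _ _ (hf t)

theorem _root_.AInf.T.part_le_len (X Y : S) (n : ℕ) (e : ℤ) :
    T.part (V := V) X Y n e ≤ T.len X Y n :=
  Submodule.span_mono fun _ ⟨s, h1, _, h3⟩ => ⟨s, h1, h3⟩

theorem homDeg_le (X Y : S) (d : ℤ) : homDeg V X Y d ≤ Hom V X Y :=
  fun _ hf t => T.part_le_len V X Y _ _ (hf t)

theorem single_mem_homDeg {X Y : S} {t : PTree} {d : ℤ} {a : T V X Y}
    (ha : a ∈ T.part X Y t.leaves (d - t.verts)) : Finsupp.single t a ∈ homDeg V X Y d := by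
  classical
  intro t'
  rw [Finsupp.single_apply]
  split_ifs with h
  · subst h; exact ha
  · exact Submodule.zero_mem _

/-- The homogeneous components of `s𝓕𝒬(X,Y)`. -/
def gr (X Y : S) (d : ℤ) : Submodule k (Hom V X Y) := (homDeg V X Y d).comap (Hom V X Y).subtype

theorem Hom_le_iSup (X Y : S) : Hom V X Y ≤ ⨆ d, homDeg V X Y d := by
  classical
  intro f hf
  rw [← Finsupp.sum_single f]
  refine Submodule.sum_mem _ fun t _ => ?_
  have h := hf t
  generalize f t = a at h
  unfold T.len at h
  induction h using Submodule.span_induction with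
  | mem x hx =>
    obtain ⟨s, hs, rfl⟩ := hx
    refine Submodule.mem_iSup_of_mem (s.deg + t.verts) (single_mem_homDeg V ?_)
    exact Submodule.subset_span ⟨s, hs, by ring, rfl⟩
  | zero => simp
  | add a b _ _ ha hb => rw [Finsupp.single_add]; exact Submodule.add_mem _ ha hb
  | smul c a _ ha => rw [← Finsupp.smul_single]; exact Submodule.smul_mem _ _ ha

/-- The projection to the component of degree `d`, tree by tree. -/
def projDeg (X Y : S) (d : ℤ) : Hom V X Y →ₗ[k] (PTree → T V X Y) :=
  LinearMap.pi fun t => (T.proj X Y (d - t.verts)).comp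
    ((Finsupp.lapply t).comp (Hom V X Y).subtype)

theorem projDeg_of_mem {X Y : S} {d : ℤ} {f : Hom V X Y} (hf : f ∈ gr V X Y d) (e : ℤ) :
    projDeg V X Y e f = if d = e then (fun t => f.1 t) else 0 := by
  funext t
  have h : f.1 t ∈ T.part X Y t.leaves (d - t.verts) := hf t
  have h2 := T.proj_of_mem h (e - t.verts)
  change T.proj X Y (e - t.verts) (f.1 t) = _
  rw [h2]
  by_cases hde : d = e
  · simp [hde]
  · simp [hde]

theorem internal (X Y : S) : DirectSum.IsInternal (gr V X Y) := by
  rw [DirectSum.isInternal_submodule_iff_iSupIndep_and_iSup_eq_top]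
  constructor
  · intro d
    rw [Submodule.disjoint_def]
    intro f hf hf'
    have h1 := projDeg_of_mem V hf d
    have h2 : projDeg V X Y d f = 0 := by
      have : (⨆ j, ⨆ (_ : j ≠ d), gr V X Y j) ≤ LinearMap.ker (projDeg V X Y d) := by
        refine iSup_le fun j => iSup_le fun hj => fun g hg => ?_
        rw [LinearMap.mem_ker, projDeg_of_mem V hg d, if_neg hj]
      exact this hf'
    rw [h2, if_pos rfl] at h1
    apply Subtype.ext
    ext t
    exact (congrFun h1 t).symm
  · rw [eq_top_iff]
    rintro ⟨f, hf⟩ -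
    have h := Hom_le_iSup V X Y hf
    have hmap : (⨆ d, homDeg V X Y d) = (⨆ d, gr V X Y d).map (Hom V X Y).subtype := by
      rw [Submodule.map_iSup]
      congr 1
      funext d
      rw [gr, Submodule.map_comap_subtype, inf_eq_right.2 (homDeg_le V X Y d)]
    rw [hmap] at h
    obtain ⟨g, hg, hgf⟩ := h
    have : g = ⟨f, hf⟩ := Subtype.ext hgf
    rwa [← this]

/-- The graded quiver `s𝓕𝒬`. -/
def quiver : GrQuiver k S where
  Hom X Y := Hom V X Y
  gr := gr V
  internal := internal V

/-- The map `(f, g) ↦ (a ⊗ b)` on the summands indexed by a tree `t` and a forest `F`, with the sign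
`(-1)^{|t| n}`. -/
def consForest {X Y Z : S} (n : ℤ) :
    (PTree →₀ T V X Y) →ₗ[k] (List PTree →₀ T V Y Z) →ₗ[k] (List PTree →₀ T V X Z) :=
  Finsupp.lsum k fun t => LinearMap.flip (Finsupp.lsum k fun F =>
    LinearMap.flip (((sgn k (t.verts * n)) • T.mul).compr₂ (Finsupp.lsingle (t :: F))))

/-- The image of `f₁ ⊗ ⋯ ⊗ fₖ ∈ s𝓕_{t₁}𝒬 ⊗ ⋯ ⊗ s𝓕_{tₖ}𝒬` under
`s^{|t₁|} ⊗ ⋯ ⊗ s^{|tₖ|}`, in the summand with index `[t₁, …, tₖ]`. -/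
def forestProd : ∀ {X Y : S}, Str (quiver V) X Y → (List PTree →₀ T V X Y)
  | _, _, .nil X => Finsupp.single [] (T.tprod (.nil (V := V) X))
  | _, _, .cons x s => consForest V s.deg x.2.1.1 (forestProd s)

theorem consForest_single_single {X Y Z : S} (n : ℤ) (t : PTree) (a : T V X Y)
    (F : List PTree) (c : T V Y Z) :
    consForest V n (Finsupp.single t a) (Finsupp.single F c) =
      Finsupp.single (t :: F) (sgn k (t.verts * n) • T.mul a c) := by
  simp [consForest]

theorem forestProd_multilinear (X Y : S) :
    IsMultilinear (V := quiver V) (forestProd V (X := X) (Y := Y)) where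
  add {Z W} s t d x y := by
    induction s with
    | nil X =>
      simp only [Str.append, forestProd]
      exact LinearMap.map_add₂ _ _ _ _
    | cons a s ih =>
      simp only [Str.append, forestProd, ih, Str.deg_append, Str.deg, map_add]
  smul {Z W} s t d c x := by
    induction s with
    | nil X =>
      simp only [Str.append, forestProd]
      exact LinearMap.map_smul₂ _ _ _ _
    | cons a s ih =>
      simp only [Str.append, forestProd, ih, Str.deg_append, Str.deg, map_smul]

/-- Degree and length bounds for families indexed by forests. -/
def forestDeg (X Y : S) (n : ℕ) (d : ℤ) : Submodule k (List PTree →₀ T V X Y) where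
  carrier := {g | ∀ F, g F ∈ T.part X Y (PTree.leavesL F) (d - PTree.vertsL F) ∧
    (F.length ≠ n → g F = 0)}
  add_mem' hf hg F := by
    rw [Finsupp.add_apply]
    exact ⟨Submodule.add_mem _ (hf F).1 (hg F).1, fun h => by rw [(hf F).2 h, (hg F).2 h, add_zero]⟩
  zero_mem' F := ⟨Submodule.zero_mem _, fun _ => rfl⟩
  smul_mem' c _ hf F := by
    rw [Finsupp.smul_apply]
    exact ⟨Submodule.smul_mem _ _ (hf F).1, fun h => by rw [(hf F).2 h, smul_zero]⟩

theorem consForest_mem {X Y Z : S} (m : ℤ) {n : ℕ} {d e : ℤ} {f : PTree →₀ T V X Y}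
    {g : List PTree →₀ T V Y Z} (hf : f ∈ homDeg V X Y d) (hg : g ∈ forestDeg V Y Z n e) :
    consForest V m f g ∈ forestDeg V X Z (n + 1) (d + e) := by
  classical
  have hfg : consForest V m f g = ∑ t ∈ f.support, ∑ F ∈ g.support,
      consForest V m (Finsupp.single t (f t)) (Finsupp.single F (g F)) := by
    conv_lhs => rw [← Finsupp.sum_single f, ← Finsupp.sum_single g, Finsupp.sum, Finsupp.sum]
    simp only [map_sum, LinearMap.sum_apply]
    exact Finset.sum_comm
  rw [hfg]
  refine Submodule.sum_mem _ fun t _ => Submodule.sum_mem _ fun F hF => ?_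
  rw [consForest_single_single]
  have hlen : F.length = n := by
    by_contra h
    exact (Finsupp.mem_support_iff.1 hF) ((hg F).2 h)
  intro F'
  rw [Finsupp.single_apply]
  split_ifs with h
  · subst h
    refine ⟨Submodule.smul_mem _ _ ?_, fun h => absurd (by simp [hlen]) h⟩
    have := T.mul_mem_part (hf t) (hg F).1
    simp only [PTree.leavesL, PTree.vertsL]
    convert this using 2
    push_cast
    ring
  · exact ⟨Submodule.zero_mem _, fun _ => rfl⟩

theorem forestProd_mem : ∀ {X Y : S} (s : Str (quiver V) X Y),
    forestProd V s ∈ forestDeg V X Y s.length s.deg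
  | _, _, .nil X => by
      classical
      intro F
      simp only [forestProd]
      rw [Finsupp.single_apply]
      split_ifs with h
      · subst h
        exact ⟨Submodule.subset_span ⟨_, rfl, rfl, rfl⟩, fun h => absurd rfl h⟩
      · exact ⟨Submodule.zero_mem _, fun _ => rfl⟩
  | _, _, .cons x s => consForest_mem V s.deg x.2.2 (forestProd_mem s)

theorem graft_mem {X Y : S} {n : ℕ} {d : ℤ} {g : List PTree →₀ T V X Y} (hn : 2 ≤ n)
    (hg : g ∈ forestDeg V X Y n d) :
    Finsupp.lmapDomain (T V X Y) k PTree.graft g ∈ homDeg V X Y (d + 1) := by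
  rw [Finsupp.lmapDomain_apply, Finsupp.mapDomain, Finsupp.sum]
  refine Submodule.sum_mem _ fun F hF => ?_
  have hlen : F.length = n := by
    by_contra h
    exact (Finsupp.mem_support_iff.1 hF) ((hg F).2 h)
  refine single_mem_homDeg V ?_
  rw [PTree.leaves_graft F (by rintro rfl; simp at hlen; omega), PTree.verts_graft F (by omega)]
  convert (hg F).1 using 2
  push_cast
  ring

end Gr

variable {S : Type u} (Q : DGQuiver.{uk, u, v} k S)

/-- The operation `b₁ = d ⊕ (-1)^{β} s^{-1}`. The first term is the differential of
`Tⁿs𝒬[-|t|]`, and in the second one `β = 1 + h` for a tree `t'` with an edge `e`, contracting which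
gives `t`, and with `h` the height of the upper vertex of `e`. -/
def b₁ (X Y : S) :
    (PTree →₀ T Q.toGrQuiver X Y) →ₗ[k] (PTree →₀ T Q.toGrQuiver X Y) :=
  Finsupp.lsum k fun t =>
    sgn k t.verts • (Finsupp.lsingle t).comp (T.diff Q X Y) +
    (t.expansions.map fun p => sgn k (1 + p.2) • Finsupp.lsingle p.1).sum

theorem b₁_mem {X Y : S} {d : ℤ} {f : PTree →₀ T Q.toGrQuiver X Y}
    (hf : f ∈ homDeg Q.toGrQuiver X Y d) : b₁ Q X Y f ∈ homDeg Q.toGrQuiver X Y (d + 1) := by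
  rw [b₁, Finsupp.lsum_apply]
  refine Submodule.sum_mem _ fun t _ => ?_
  beta_reduce
  rw [LinearMap.add_apply]
  refine Submodule.add_mem _ (Submodule.smul_mem _ _ (single_mem_homDeg _ ?_)) ?_
  · have := T.diff_mem Q (hf t)
    rwa [sub_add_eq_add_sub] at this
  · have h : ∀ l : List (PTree × ℕ), (∀ p ∈ l, p.1.leaves = t.leaves ∧ p.1.verts = t.verts + 1) →
        (l.map fun p => sgn k (1 + p.2) •
          (Finsupp.lsingle p.1 : T Q.toGrQuiver X Y →ₗ[k] _)).sum (f t) ∈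
          homDeg Q.toGrQuiver X Y (d + 1) := by
      intro l
      induction l with
      | nil => intro _; simp
      | cons p l ih =>
        intro hl
        rw [List.map_cons, List.sum_cons, LinearMap.add_apply]
        refine Submodule.add_mem _ (Submodule.smul_mem _ _ (single_mem_homDeg _ ?_))
          (ih fun q hq => hl q (List.mem_cons_of_mem _ hq))
        obtain ⟨h1, h2⟩ := hl p List.mem_cons_self
        rw [h1, h2]
        have := hf t
        convert this using 2
        push_cast
        ring
    exact h _ (PTree.expansions_spec t)

/-- The operations of `s𝓕𝒬`: `b₁` as above, and `b_k = s^{|t₁|} ⊗ ⋯ ⊗ s^{|tₖ|-|t|}` with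
`t = (t₁ ⊔ ⋯ ⊔ tₖ) · 𝔱ₖ` for `k ≥ 2`. -/
def preB : ∀ {X Y : S}, Str (quiver Q.toGrQuiver) X Y → (PTree →₀ T Q.toGrQuiver X Y)
  | _, _, .nil _ => 0
  | X, Y, .cons x (.nil _) => b₁ Q X Y x.2.1.1
  | X, Y, .cons x (.cons y s) =>
      Finsupp.lmapDomain (T Q.toGrQuiver X Y) k PTree.graft
        (forestProd Q.toGrQuiver (.cons x (.cons y s)))

theorem preB_eq {X Y : S} (s : Str (quiver Q.toGrQuiver) X Y) (h : 2 ≤ s.length) :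
    preB Q s = Finsupp.lmapDomain (T Q.toGrQuiver X Y) k PTree.graft
      (forestProd Q.toGrQuiver s) := by
  match s, h with
  | .nil _, h => simp [Str.length] at h
  | .cons _ (.nil _), h => simp [Str.length] at h
  | .cons x (.cons y s), _ => rfl

theorem preB_mem {X Y : S} (s : Str (quiver Q.toGrQuiver) X Y) :
    preB Q s ∈ homDeg Q.toGrQuiver X Y (s.deg + 1) := by
  match s with
  | .nil _ => exact Submodule.zero_mem _
  | .cons x (.nil _) =>
    have := b₁_mem Q x.2.2
    simpa [Str.deg, preB] using this
  | .cons x (.cons y s) =>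
    exact graft_mem _ (by simp [Str.length]) (forestProd_mem _ _)

theorem preB_multilinear (X Y : S) :
    IsMultilinear (V := quiver Q.toGrQuiver) (preB Q (X := X) (Y := Y)) where
  add {Z W} s t d x y := by
    by_cases h : s.length + t.length = 0
    · cases s with
      | cons a s => simp [Str.length] at h
      | nil =>
        cases t with
        | cons a t => simp [Str.length] at h
        | nil => exact map_add (b₁ Q _ _) _ _
    · have hl : ∀ z : (quiver Q.toGrQuiver).gr Z W d, 2 ≤ (s.append (.cons ⟨d, z⟩ t)).length := by
        intro z; rw [Str.length_append, Str.length]; omega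
      rw [preB_eq Q _ (hl _), preB_eq Q _ (hl _), preB_eq Q _ (hl _),
        (forestProd_multilinear _ _ _).add, map_add]
  smul {Z W} s t d c x := by
    by_cases h : s.length + t.length = 0
    · cases s with
      | cons a s => simp [Str.length] at h
      | nil =>
        cases t with
        | cons a t => simp [Str.length] at h
        | nil => exact map_smul (b₁ Q _ _) _ _
    · have hl : ∀ z : (quiver Q.toGrQuiver).gr Z W d, 2 ≤ (s.append (.cons ⟨d, z⟩ t)).length := by
        intro z; rw [Str.length_append, Str.length]; omega
      rw [preB_eq Q _ (hl _), preB_eq Q _ (hl _),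
        (forestProd_multilinear _ _ _).smul, map_smul]

end Free

/-- The free `A_∞`-category `𝓕𝒬` generated by the differential graded quiver `𝒬`: the graded
quiver `s𝓕𝒬` with its operations. -/
def free {S : Type u} (Q : DGQuiver.{uk, u, v} k S) : OpQuiver k S where
  toGrQuiver := Free.quiver Q.toGrQuiver
  b s := ⟨Free.preB Q s, Free.homDeg_le _ _ _ _ (Free.preB_mem Q s)⟩
  b_nil _ := rfl
  b_multilinear X Y :=
    ⟨fun s t d x y => Subtype.ext ((Free.preB_multilinear Q X Y).add s t d x y),
      fun s t d c x => Subtype.ext ((Free.preB_multilinear Q X Y).smul s t d c x)⟩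
  b_mem s := Free.preB_mem Q s

/-- The embedding `s𝒬 = s𝓕_|𝒬 ⊂ s𝓕𝒬` onto the summand of the trivial tree, in degree `d`. -/
def inclVal {S : Type u} (Q : DGQuiver.{uk, u, v} k S) {X Y : S} {d : ℤ} (x : Q.gr X Y d) :
    (free Q).gr X Y d :=
  have h : Finsupp.single PTree.leaf (T.tprod (.single ⟨d, x⟩)) ∈
      Free.homDeg Q.toGrQuiver X Y d :=
    Free.single_mem_homDeg _ (Submodule.subset_span
      ⟨_, by simp [Str.single, Str.length, PTree.leaves],
        by simp [Str.single, Str.deg, PTree.verts], rfl⟩)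
  ⟨⟨Finsupp.single PTree.leaf (T.tprod (.single ⟨d, x⟩)), Free.homDeg_le _ _ _ _ h⟩, h⟩

/-- The embedding `s𝒬 ⊂ s𝓕𝒬` on homogeneous elements. -/
def incl {S : Type u} (Q : DGQuiver.{uk, u, v} k S) {X Y : S} (x : Arrow Q.toGrQuiver X Y) :
    Arrow (free Q).toGrQuiver X Y :=
  ⟨x.1, inclVal Q x.2⟩

/-! ### Restriction to the generating quiver -/

section Restriction

variable {S : Type u} {S' : Type u'} {Q : DGQuiver.{uk, u, v} k S} {A : OpQuiver.{uk, u', v'} k S'}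

theorem inclVal_add {X Y : S} (d : ℤ) (x y : Q.gr X Y d) :
    inclVal Q (x + y) = inclVal Q x + inclVal Q y := by
  apply Subtype.ext; apply Subtype.ext
  change Finsupp.single _ _ = Finsupp.single _ _ + Finsupp.single _ _
  rw [← Finsupp.single_add, Str.single, T.tprod_cons_add]; rfl

theorem inclVal_smul {X Y : S} (d : ℤ) (c : k) (x : Q.gr X Y d) :
    inclVal Q (c • x) = c • inclVal Q x := by
  apply Subtype.ext; apply Subtype.ext
  change Finsupp.single _ _ = c • Finsupp.single _ _
  rw [Finsupp.smul_single, Str.single, T.tprod_cons_smul]; rfl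

/-- The embedding `s𝒬 ⊂ s𝓕𝒬` is a chain map. -/
theorem bArr_incl {X Y : S} (x : Arrow Q.toGrQuiver X Y) :
    (free Q).bArr (.single (incl Q x)) = incl Q (Q.dArr x) := by
  apply Arrow.ext
  · simp [OpQuiver.bArr, Str.single, Str.deg, incl, DGQuiver.dArr]
  · apply Subtype.ext
    change Free.b₁ Q X Y (Finsupp.single PTree.leaf (T.tprod (.single x))) =
      Finsupp.single PTree.leaf (T.tprod (.single (Q.dArr x)))
    simp [Free.b₁, PTree.verts, PTree.expansions, sgn, T.diff, Str.single, dStr, Str.deg]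

theorem comp_incl_add {M : Type w} [AddCommGroup M] [Module k M] {X Y : S}
    {r : Str (free Q).toGrQuiver X Y → M} (hr : IsMultilinear r) (d : ℤ) (x y : Q.gr X Y d) :
    r (.single (incl Q ⟨d, x + y⟩)) =
      r (.single (incl Q ⟨d, x⟩)) + r (.single (incl Q ⟨d, y⟩)) := by
  have h := hr.add (.nil X) (.nil Y) d (inclVal Q x) (inclVal Q y)
  rw [← inclVal_add] at h
  exact h

theorem comp_incl_smul {M : Type w} [AddCommGroup M] [Module k M] {X Y : S}
    {r : Str (free Q).toGrQuiver X Y → M} (hr : IsMultilinear r) (d : ℤ) (c : k)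
    (x : Q.gr X Y d) :
    r (.single (incl Q ⟨d, c • x⟩)) = c • r (.single (incl Q ⟨d, x⟩)) := by
  have h := hr.smul (.nil X) (.nil Y) d c (inclVal Q x)
  rw [← inclVal_smul] at h
  exact h

/-- The restriction of an `A_∞`-functor `φ : 𝓕𝒬 → 𝒜` to `𝒬`: the chain morphism with the same map
on objects, and with the restriction of `φ₁` to `s𝒬 ⊂ s𝓕𝒬`. -/
def restrFunctor (φ : AInfFunctor (free Q) A) : A1Functor Q A where
  obj := φ.obj
  map x := φ.map (.single (incl Q x))
  map_add d x y := comp_incl_add (φ.map_multilinear _ _) d x y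
  map_smul d c x := comp_incl_smul (φ.map_multilinear _ _) d c x
  map_mem x := by simpa [Str.single, Str.deg, incl] using φ.map_mem (.single (incl Q x))
  chain {X Y} x := by
    have h := φ.comm (.single (incl Q x))
    have hz : ∀ {Z : S} (s : Str (free Q).toGrQuiver X Z) (t : Str (free Q).toGrQuiver Z Y),
        φ.map (s.append (.cons ((free Q).bArr (.nil Z)) t)) = 0 :=
      fun s t => (φ.map_multilinear X Y).zero s t _
    have h1 : (⟨x.1, φ.map (.single (incl Q x)), by
        simpa [Str.single, Str.deg, incl] using φ.map_mem (.single (incl Q x))⟩ :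
        Arrow A.toGrQuiver (φ.obj X) (φ.obj Y)) = φ.arr (.single (incl Q x)) :=
      Arrow.ext (by simp [CocatHom.arr, Str.single, Str.deg, incl]) rfl
    have h2 : φ.comps (.single (incl Q x)) = [.single (φ.arr (.single (incl Q x)))] := rfl
    have h3 : (Str.single (incl Q x)).splits3 =
      [⟨.nil X, .nil X, .single (incl Q x)⟩, ⟨.nil X, .single (incl Q x), .nil Y⟩,
        ⟨.single (incl Q x), .nil Y, .nil Y⟩] := rfl
    rw [h2, h3] at h
    simp only [List.map_cons, List.map_nil, List.sum_cons, List.sum_nil, hz, smul_zero, zero_add,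
      add_zero, bArr_incl] at h
    simp only [h1, h, Str.append, Str.deg]
    simp [sgn, Str.single]

/-- The restriction map `sA_∞(𝓕𝒬,𝒜)(φ,ψ) → sA₁(𝒬,𝒜)(φ,ψ)`, `r ↦ (r₀, r₁|_{s𝒬})`. -/
def restr (φ ψ : AInfFunctor (free Q) A) :
    (sAInf φ ψ).carrier →ₗ[k] (sA1 (restrFunctor φ) (restrFunctor ψ)).carrier where
  toFun r := (fun X => r X X (.nil X), fun X Y x => r X Y (.single (incl Q x)))
  map_add' _ _ := rfl
  map_smul' _ _ := rfl

theorem restr_mem (φ ψ : AInfFunctor (free Q) A) (e : ℤ) (r : (sAInf φ ψ).carrier)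
    (hr : r ∈ (sAInf φ ψ).gr e) :
    restr φ ψ r ∈ (sA1 (restrFunctor φ) (restrFunctor ψ)).gr e :=
  ⟨fun X => by
      have h := (hr X X).2 (.nil X)
      rw [Str.deg, zero_add] at h
      exact h, fun X Y =>
    ⟨fun d x y => comp_incl_add (hr X Y).1 d x y, fun d c x => comp_incl_smul (hr X Y).1 d c x,
      fun x => by
        have h := (hr X Y).2 (.single (incl Q x))
        rw [Str.single, Str.deg, Str.deg, add_zero] at h
        exact h⟩⟩

variable {P : Cx.{uk, w} k} {φ ψ : AInfFunctor (free Q) A} {m : ℤ}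

/-- The composition `f' : P → sA_∞(𝓕𝒬,𝒜)(φ,ψ) → sA₁(𝒬,𝒜)(φ,ψ)` of `f` with the restriction map. -/
def restrMap (f : GrMap P (sAInf φ ψ).gr m) :
    GrMap P (sA1 (restrFunctor φ) (restrFunctor ψ)).gr m :=
  GrMap.comp f (restr φ ψ) (restr_mem φ ψ)

/-- The composition `f_n = f · pr_n`. -/
def compMap (f : GrMap P (sAInf φ ψ).gr m) (n : ℕ) :
    GrMap P (Comp φ.toCocatHom ψ.toCocatHom n) m :=
  GrMap.comp f (prComp φ.toCocatHom ψ.toCocatHom n) (prComp_mem φ.toCocatHom ψ.toCocatHom n)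

end Restriction

end AInf

end

open AInf

set_option linter.checkUnivs false

noncomputable section

namespace AInf

variable {k : Type uk} [CommRing k]

/-! ### Signs -/

-- For a map `h` of degree `-1` let δ(p) = pu - (pd)h - (ph)B₁ be its `defect`, so that `h` is a
-- homotopy exactly when δ = 0. Two facts about 𝓕𝒬 carry the proof.
--
-- Firstly, 𝓕𝒬 satisfies the `A_∞`-relations (`pre_free_b`), hence B₁² = 0 (`preTransB_sub_pre`,
-- `transD_transD`). Since u is a chain map, it follows that δ(p)B₁ = δ(pd) (`transD_defect`).
--
-- Secondly, s𝓕𝒬 is freely generated by s𝒬 under the operations bₙ with n ≥ 2. Every arrow is built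
-- from generators (`free_induction`), and a linear map out of s𝓕𝒬(X,Y) can be prescribed
-- arbitrarily on s𝒬 and, by a multilinear function, on the values of the bₙ
-- (`exists_linearMap_free`).
--
-- Let r be a transformation whose only component is r₁. On a string s of length k ≥ 2, rB₁ is the
-- sum of the terms (φ ⊗ r₁ ⊗ ψ)b and of ∓ bₖr₁, and the former involve r₁ only on the letters of s.
-- An equation rB₁ = R in lengths ≥ 2 therefore computes r₁ on (s)bₖ from r₁ on the letters of s.
-- Given r₁ on s𝒬, the solution is unique because s𝒬 generates (`eq_zero_of_transD`), and it exists
-- for every R of the right degree because the generation is free (`exists_singlePart`).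
--
-- Suppose now that h' is a homotopy and that δ vanishes in lengths ≥ 2. Then δ(p) has only a
-- component in length one, this component vanishes on s𝒬, and δ(p)B₁ = δ(pd) vanishes in lengths ≥
-- 2; so δ = 0 (`isHomotopy_iff_of_restrMap`). Thus only the equations in lengths k > 1 matter, and
-- they are the recurrent formula (`defect_eq_zero_iff`). In these equations pd enters only through
-- the prescribed (pd)hₖ with k > 1, so every p can be treated by itself. Moving all known
-- components into R leaves exactly one possible ph₁ (`IsSolution`), and uniqueness makes it linear
-- in p.

theorem sgn_add (m n : ℤ) : sgn k (m + n) = sgn k m * sgn k n := by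
  simp [sgn, Int.negOnePow_add]

theorem sgn_mul_self (n : ℤ) : sgn k n * sgn k n = 1 := by
  rw [← sgn_add, sgn, Int.negOnePow_even _ ⟨n, rfl⟩]; simp

/-- Comparison of signs is reduced to naming half the difference of the exponents; `ring` then does
the rest. -/
theorem sgn_eq_of_eq_add_two_mul {m n : ℤ} (c : ℤ) (h : m = n + 2 * c) : sgn k m = sgn k n := by
  rw [h, sgn_add, two_mul, sgn_add, sgn_mul_self, mul_one]

@[simp] theorem sgn_zero : sgn k 0 = 1 := by simp [sgn]

theorem sgn_smul_sgn_smul {M : Type w} [AddCommGroup M] [Module k M] (n : ℤ) (x : M) :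
    sgn k n • sgn k n • x = x := by
  rw [smul_smul, sgn_mul_self, one_smul]

/-! ### Sums over decompositions of a string -/

namespace Str

variable {S : Type u} {V : GrQuiver.{uk, u, v} k S}

@[simp] theorem append_nil : ∀ {X Y : S} (s : Str V X Y), s.append (.nil Y) = s
  | _, _, .nil _ => rfl
  | _, _, .cons x s => by rw [append, append_nil s]

@[simp] theorem nil_append {X Y : S} (s : Str V X Y) : (Str.nil X).append s = s := rfl

theorem cons_append {X Y Z W : S} (x : Arrow V X Y) (s : Str V Y Z) (t : Str V Z W) :
    (cons x s).append t = cons x (s.append t) := rfl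

/-- A property of all letters of a string. -/
def All (P : ∀ {X Y : S}, Arrow V X Y → Prop) : ∀ {X Y : S}, Str V X Y → Prop
  | _, _, .nil _ => True
  | _, _, .cons x s => P x ∧ All P s

theorem all_append {P : ∀ {X Y : S}, Arrow V X Y → Prop} : ∀ {X Y Z : S} (s : Str V X Y)
    (t : Str V Y Z), (s.append t).All P ↔ s.All P ∧ t.All P
  | _, _, _, .nil _, t => by simp [All]
  | _, _, _, .cons x s, t => by simp [append, All, all_append s t, and_assoc]

variable {M : Type w} [AddCommGroup M]

/-- The sum of `F l r` over all decompositions `s = l · r`. -/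
def sum2 {X Y : S} (s : Str V X Y) (F : ∀ Z, Str V X Z → Str V Z Y → M) : M :=
  (s.splits.map fun p => F p.Z p.left p.right).sum

/-- The sum of `F l m r` over all decompositions `s = l · m · r`. -/
def sum3 {X Y : S} (s : Str V X Y) (F : ∀ Z W, Str V X Z → Str V Z W → Str V W Y → M) : M :=
  s.sum2 fun Z l t => t.sum2 fun W m r => F Z W l m r

@[simp] theorem sum2_nil {X : S} (F : ∀ Z, Str V X Z → Str V Z X → M) :
    (Str.nil X).sum2 F = F X (.nil X) (.nil X) := by
  simp [sum2, splits]

theorem sum2_cons {X Y Z : S} (x : Arrow V X Y) (s : Str V Y Z)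
    (F : ∀ W, Str V X W → Str V W Z → M) :
    (Str.cons x s).sum2 F =
      F X (.nil X) (.cons x s) + s.sum2 fun W l r => F W (.cons x l) r := by
  simp [sum2, splits, Function.comp_def]

theorem sum2_add {X Y : S} (s : Str V X Y) (F G : ∀ Z, Str V X Z → Str V Z Y → M) :
    (s.sum2 fun Z l r => F Z l r + G Z l r) = s.sum2 F + s.sum2 G := by
  simp [sum2, List.sum_map_add]

theorem map_sum2 {N : Type*} [AddCommGroup N] (f : M →+ N) {X Y : S} (s : Str V X Y)
    (F : ∀ Z, Str V X Z → Str V Z Y → M) :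
    f (s.sum2 F) = s.sum2 fun Z l r => f (F Z l r) := by
  simp [sum2, map_list_sum, Function.comp_def]

theorem neg_sum2 {X Y : S} (s : Str V X Y) (F : ∀ Z, Str V X Z → Str V Z Y → M) :
    -s.sum2 F = s.sum2 fun Z l r => -F Z l r :=
  map_sum2 (-AddMonoidHom.id M) s F

theorem append_of_mem_splits : ∀ {X Y : S} {s : Str V X Y} {p : Split2 V X Y}, p ∈ s.splits →
    p.left.append p.right = s
  | _, _, .nil X, p, h => by
      simp only [splits, List.mem_singleton] at h
      subst h; rfl
  | _, _, .cons x s, p, h => by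
      simp only [splits, List.mem_cons, List.mem_map] at h
      rcases h with rfl | ⟨q, hq, rfl⟩
      · rfl
      · rw [append, append_of_mem_splits hq]

theorem sum2_congr {X Y : S} {s : Str V X Y} {F G : ∀ Z, Str V X Z → Str V Z Y → M}
    (h : ∀ Z l r, l.append r = s → F Z l r = G Z l r) : s.sum2 F = s.sum2 G := by
  unfold sum2
  congr 1
  exact List.map_congr_left fun p hp => h _ _ _ (append_of_mem_splits hp)

theorem sum2_eq_zero {X Y : S} {s : Str V X Y} {F : ∀ Z, Str V X Z → Str V Z Y → M}
    (h : ∀ Z l r, l.append r = s → F Z l r = 0) : s.sum2 F = 0 := by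
  rw [sum2_congr h]
  simp [sum2]

/-- A cut falls either to the left or to the right of the marked letter `x`. This is the source of
every argument below that follows one letter through a sum over decompositions. -/
theorem sum2_append_cons {X Y Z W : S} (l : Str V X Y) (x : Arrow V Y Z) (r : Str V Z W)
    (F : ∀ Z, Str V X Z → Str V Z W → M) :
    (l.append (.cons x r)).sum2 F =
      (l.sum2 fun U a b => F U a (b.append (.cons x r))) +
        r.sum2 fun U a b => F U (l.append (.cons x a)) b := by
  induction l with
  | nil => simp [append, sum2_cons]
  | cons y l ih => simp only [append, sum2_cons, ih, add_assoc]

/-- Coassociativity of the cut comultiplication. `sum3` nests its cuts on the right, so nestings on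
the left are brought to normal form by this rule. -/
theorem sum2_assoc {X Y : S} (s : Str V X Y)
    (F : ∀ Z W, Str V X Z → Str V Z W → Str V W Y → M) :
    (s.sum2 fun W l r => l.sum2 fun Z a b => F Z W a b r) = s.sum3 F := by
  unfold sum3
  induction s with
  | nil => simp
  | cons x s ih =>
    simp only [sum2_cons, sum2_nil, sum2_add, ih]
    abel

theorem sum2_list_sum {ι : Type*} {X Y : S} (s : Str V X Y) (l : List ι)
    (F : ι → ∀ Z, Str V X Z → Str V Z Y → M) :
    (l.map fun i => s.sum2 (F i)).sum = s.sum2 fun Z a b => (l.map fun i => F i Z a b).sum := by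
  induction l with
  | nil => simp [sum2]
  | cons i l ih => simp [ih, sum2_add]

theorem sum2_comm {S₂ : Type u'} {V₂ : GrQuiver.{uk, u', v'} k S₂} {X Y : S} {X₂ Y₂ : S₂}
    (s : Str V X Y) (t : Str V₂ X₂ Y₂)
    (F : ∀ Z Z₂, Str V X Z → Str V Z Y → Str V₂ X₂ Z₂ → Str V₂ Z₂ Y₂ → M) :
    (s.sum2 fun Z l r => t.sum2 fun Z₂ l₂ r₂ => F Z Z₂ l r l₂ r₂) =
      t.sum2 fun Z₂ l₂ r₂ => s.sum2 fun Z l r => F Z Z₂ l r l₂ r₂ :=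
  sum2_list_sum t s.splits fun p Z₂ l₂ r₂ => F p.Z Z₂ p.left p.right l₂ r₂

theorem sum2_zero {X Y : S} (s : Str V X Y) : (s.sum2 fun _ _ _ => (0 : M)) = 0 :=
  sum2_eq_zero fun _ _ _ _ => rfl

theorem sum3_congr {X Y : S} {s : Str V X Y} {F G : ∀ Z W, Str V X Z → Str V Z W → Str V W Y → M}
    (h : ∀ Z W l m r, l.append (m.append r) = s → F Z W l m r = G Z W l m r) :
    s.sum3 F = s.sum3 G :=
  sum2_congr fun _ _ _ h₁ => sum2_congr fun _ _ _ h₂ => h _ _ _ _ _ (by rw [h₂, h₁])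

theorem sum3_eq_zero {X Y : S} {s : Str V X Y} {F : ∀ Z W, Str V X Z → Str V Z W → Str V W Y → M}
    (h : ∀ Z W l m r, l.append (m.append r) = s → F Z W l m r = 0) : s.sum3 F = 0 :=
  sum2_eq_zero fun _ _ _ h₁ => sum2_eq_zero fun _ _ _ h₂ => h _ _ _ _ _ (by rw [h₂, h₁])

theorem sum3_add {X Y : S} (s : Str V X Y)
    (F G : ∀ Z W, Str V X Z → Str V Z W → Str V W Y → M) :
    (s.sum3 fun Z W l m r => F Z W l m r + G Z W l m r) = s.sum3 F + s.sum3 G := by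
  simp only [sum3, sum2_add]

/-- Bridge from the lists of records in the definitions to `sum3`, whose summand is a plain function
of the pieces. -/
theorem sum_map_splits3 {X Y : S} (s : Str V X Y)
    (F : ∀ Z W, Str V X Z → Str V Z W → Str V W Y → M) :
    (s.splits3.map fun p => F p.Z p.W p.left p.mid p.right).sum = s.sum3 F := by
  unfold splits3 sum3 sum2
  induction s.splits with
  | nil => simp
  | cons p l ih => simp [ih, Function.comp_def]

variable [Module k M]

theorem _root_.LinearMap.map_strSum2 {N : Type*} [AddCommGroup N] [Module k N] (f : M →ₗ[k] N)
    {X Y : S} (s : Str V X Y) (F : ∀ Z, Str V X Z → Str V Z Y → M) :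
    f (s.sum2 F) = s.sum2 fun Z l r => f (F Z l r) :=
  map_sum2 f.toAddMonoidHom s F

theorem smul_sum2 (c : k) {X Y : S} (s : Str V X Y) (F : ∀ Z, Str V X Z → Str V Z Y → M) :
    c • s.sum2 F = s.sum2 fun Z l r => c • F Z l r :=
  (LinearMap.lsmul k M c).map_strSum2 s F

theorem sum2_mem {N : Submodule k M} {X Y : S} {s : Str V X Y}
    {F : ∀ Z, Str V X Z → Str V Z Y → M}
    (h : ∀ Z l r, l.append r = s → F Z l r ∈ N) : s.sum2 F ∈ N := by
  refine list_sum_mem fun x hx => ?_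
  obtain ⟨p, hp, rfl⟩ := List.mem_map.1 hx
  exact h _ _ _ (append_of_mem_splits hp)

theorem sum3_mem {N : Submodule k M} {X Y : S} {s : Str V X Y}
    {F : ∀ Z W, Str V X Z → Str V Z W → Str V W Y → M}
    (h : ∀ Z W l m r, l.append (m.append r) = s → F Z W l m r ∈ N) : s.sum3 F ∈ N :=
  sum2_mem fun _ _ _ h₁ => sum2_mem fun _ _ _ h₂ => h _ _ _ _ _ (by rw [h₂, h₁])

theorem _root_.LinearMap.map_strSum3 {N : Type*} [AddCommGroup N] [Module k N] (f : M →ₗ[k] N)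
    {X Y : S} (s : Str V X Y) (F : ∀ Z W, Str V X Z → Str V Z W → Str V W Y → M) :
    f (s.sum3 F) = s.sum3 fun Z W l m r => f (F Z W l m r) := by
  simp only [sum3, f.map_strSum2]

theorem smul_sum3 (c : k) {X Y : S} (s : Str V X Y)
    (F : ∀ Z W, Str V X Z → Str V Z W → Str V W Y → M) :
    c • s.sum3 F = s.sum3 fun Z W l m r => c • F Z W l m r :=
  (LinearMap.lsmul k M c).map_strSum3 s F

end Str

/-! ### Multilinear functions -/

namespace IsMultilinear

variable {S : Type u} {V : GrQuiver.{uk, u, v} k S} {X Y : S} {M : Type w} [AddCommGroup M]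
  [Module k M]

theorem fun_add {f g : Str V X Y → M} (hf : IsMultilinear f) (hg : IsMultilinear g) :
    IsMultilinear fun s => f s + g s where
  add s t d x y := by simp only [hf.add, hg.add]; abel
  smul s t d c x := by simp only [hf.smul, hg.smul, smul_add]

theorem map_linear {N : Type*} [AddCommGroup N] [Module k N] {f : Str V X Y → M}
    (hf : IsMultilinear f) (φ : M →ₗ[k] N) : IsMultilinear fun s => φ (f s) where
  add s t d x y := by simp only [hf.add, map_add]
  smul s t d c x := by simp only [hf.smul, map_smul]

theorem const_smul {f : Str V X Y → M} (hf : IsMultilinear f) (c : k) :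
    IsMultilinear fun s => c • f s :=
  hf.map_linear (LinearMap.lsmul k M c)

theorem deg_smul {f : Str V X Y → M} (hf : IsMultilinear f) (c : ℤ → k) :
    IsMultilinear fun s => c s.deg • f s where
  add s t d x y := by simp only [hf.add, Str.deg_append, Str.deg, smul_add]
  smul s t d a x := by simp only [hf.smul, Str.deg_append, Str.deg, smul_comm a]

theorem fun_sub {f g : Str V X Y → M} (hf : IsMultilinear f) (hg : IsMultilinear g) :
    IsMultilinear fun s => f s - g s := by
  simpa [sub_eq_add_neg] using hf.fun_add (hg.map_linear (-LinearMap.id))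

theorem comp_append_left {Z : S} {f : Str V X Y → M} (hf : IsMultilinear f) (a : Str V X Z) :
    IsMultilinear fun s : Str V Z Y => f (a.append s) where
  add s t d x y := by simp only [← Str.append_assoc, hf.add]
  smul s t d c x := by simp only [← Str.append_assoc, hf.smul]

theorem comp_append_right {Z : S} {f : Str V X Y → M} (hf : IsMultilinear f) (a : Str V Z Y) :
    IsMultilinear fun s : Str V X Z => f (s.append a) where
  add s t d x y := by simp only [Str.append_assoc, Str.append, hf.add]
  smul s t d c x := by simp only [Str.append_assoc, Str.append, hf.smul]

/-- By `sum2_append_cons` the varied letter lies in exactly one of the two pieces, so linearity in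
each piece separately suffices. -/
theorem sum2 {F : ∀ Z, Str V X Z → Str V Z Y → M}
    (hl : ∀ Z r, IsMultilinear fun l => F Z l r) (hr : ∀ Z l, IsMultilinear fun r => F Z l r) :
    IsMultilinear fun s => s.sum2 F where
  add s t d x y := by
    simp only [Str.sum2_append_cons, (hl _ _).add, (hr _ _).add, Str.sum2_add]
    abel
  smul s t d c x := by
    simp only [Str.sum2_append_cons, (hl _ _).smul, (hr _ _).smul, smul_add, Str.smul_sum2]

theorem sum3 {F : ∀ Z W, Str V X Z → Str V Z W → Str V W Y → M}
    (hl : ∀ Z W m r, IsMultilinear fun l => F Z W l m r)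
    (hm : ∀ Z W l r, IsMultilinear fun m => F Z W l m r)
    (hr : ∀ Z W l m, IsMultilinear fun r => F Z W l m r) :
    IsMultilinear fun s => s.sum3 F := by
  refine sum2 (fun Z r => ?_) fun Z l => sum2 (fun W m => hm _ _ _ _) fun W l => hr _ _ _ _
  refine ⟨fun s t d x y => ?_, fun s t d c x => ?_⟩
  · simp only [(hl _ _ _ _).add, Str.sum2_add]
  · simp only [(hl _ _ _ _).smul, Str.smul_sum2]

end IsMultilinear

/-! ### Letters in the tensor module -/

/-- Linear maps on the homogeneous components define a linear map on the whole module. -/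
theorem exists_linearMap_of_isInternal {M : Type v} [AddCommGroup M] [Module k M]
    {C : ℤ → Submodule k M} (hC : DirectSum.IsInternal C) {N : Type w} [AddCommGroup N]
    [Module k N] (f : ∀ i, C i →ₗ[k] N) : ∃ g : M →ₗ[k] N, ∀ i (x : C i), g x = f i x := by
  classical
  let e := LinearEquiv.ofBijective (DirectSum.coeLinearMap C) hC
  refine ⟨(DirectSum.toModule k ℤ N f).comp e.symm.toLinearMap, fun i x => ?_⟩
  have h : e.symm (x : M) = DirectSum.lof k ℤ (fun i => C i) i x := by
    rw [LinearEquiv.symm_apply_eq]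
    exact (DirectSum.coeLinearMap_lof C i x).symm
  simp [h]

theorem linearMap_ext_of_isInternal {M : Type v} [AddCommGroup M] [Module k M]
    {C : ℤ → Submodule k M} (hC : DirectSum.IsInternal C) {N : Type w} [AddCommGroup N]
    [Module k N] {f g : M →ₗ[k] N} (h : ∀ i, ∀ x ∈ C i, f x = g x) : f = g := by
  have hle : (⊤ : Submodule k M) ≤ LinearMap.eqLocus f g := by
    rw [← hC.submodule_iSup_eq_top]
    exact iSup_le fun i x hx => h i x hx
  exact LinearMap.ext fun x => hle (Submodule.mem_top (x := x))

namespace T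

variable {S : Type u} {V : GrQuiver.{uk, u, v} k S}

/-- Strings carry homogeneous letters only, whereas values of operations are elements of `Hom`.
Extending by linearity over the homogeneous components allows any element of `Hom` to serve as a
letter in the tensor module. -/
theorem exists_letter (X Y : S) : ∃ g : V.Hom X Y →ₗ[k] T V X Y, ∀ i (x : V.gr X Y i),
    g x = tprod (.single ⟨i, x⟩) :=
  exists_linearMap_of_isInternal (V.internal X Y) fun i =>
    { toFun := fun x => tprod (.single ⟨i, x⟩)
      map_add' := fun x y => (tprod_multilinear X Y).add (.nil X) (.nil Y) i x y
      map_smul' := fun c x => (tprod_multilinear X Y).smul (.nil X) (.nil Y) i c x }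

/-- The embedding `V(X,Y) = T¹V(X,Y) ⊂ TV(X,Y)`. -/
def letter {X Y : S} : V.Hom X Y →ₗ[k] T V X Y := (exists_letter X Y).choose

theorem letter_apply {X Y : S} (x : Arrow V X Y) : letter (x.2 : V.Hom X Y) = tprod (.single x) :=
  (exists_letter X Y).choose_spec x.1 x.2

/-- Makes the dependence on one inserted letter a composition of linear maps; sums over values of
that letter can then be moved inside. -/
theorem tprod_append_cons {X Y Z W : S} (l : Str V X Y) (x : Arrow V Y Z) (r : Str V Z W) :
    tprod (l.append (.cons x r)) =
      mul (tprod l) (mul (letter (x.2 : V.Hom Y Z)) (tprod r)) := by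
  rw [letter_apply, mul_tprod, mul_tprod]; rfl

theorem induction {X Y : S} {P : T V X Y → Prop} (tprod : ∀ s, P (tprod s)) (zero : P 0)
    (add : ∀ a b, P a → P b → P (a + b)) (smul : ∀ (c : k) a, P a → P (c • a)) (a : T V X Y) :
    P a := by
  have h : a ∈ Submodule.span k (Set.range (T.tprod (V := V) (X := X) (Y := Y))) := by
    rw [span_tprod]; trivial
  induction h using Submodule.span_induction with
  | mem x hx => obtain ⟨s, rfl⟩ := hx; exact tprod s
  | zero => exact zero
  | add a b _ _ ha hb => exact add a b ha hb
  | smul c a _ ha => exact smul c a ha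

theorem mul_assoc {X Y Z W : S} (a : T V X Y) (b : T V Y Z) (c : T V Z W) :
    mul (mul a b) c = mul a (mul b c) := by
  induction a using T.induction with
  | tprod s =>
    induction b using T.induction with
    | tprod t =>
      induction c using T.induction with
      | tprod r => simp only [mul_tprod, Str.append_assoc]
      | zero => simp
      | add a b ha hb => simp only [map_add, ha, hb]
      | smul c a ha => simp only [map_smul, ha]
    | zero => simp
    | add a b ha hb => simp only [map_add, LinearMap.add_apply, ha, hb]
    | smul c a ha => simp only [map_smul, LinearMap.smul_apply, ha]
  | zero => simp
  | add a b ha hb => simp only [map_add, LinearMap.add_apply, ha, hb]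
  | smul c a ha => simp only [map_smul, LinearMap.smul_apply, ha]

theorem nil_mul {X Y : S} (a : T V X Y) : mul (tprod (.nil X)) a = a := by
  have h : mul (tprod (.nil X)) = (LinearMap.id : T V X Y →ₗ[k] T V X Y) :=
    hom_ext fun s => by rw [mul_tprod]; rfl
  rw [h]; rfl

end T

/-! ### The matrix elements of a cocategory homomorphism -/

namespace CocatHom

variable {S : Type u} {V : GrQuiver.{uk, u, v} k S} {S' : Type u'} {W : GrQuiver.{uk, u', v'} k S'}
  (φ : CocatHom V W)

theorem deg_of_mem_compsAux : ∀ {X Y Z : S} (a : Str V X Y) (s : Str V Y Z),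
    ∀ c ∈ φ.compsAux a s, c.deg = a.deg + s.deg
  | _, _, _, a, .nil _, c, h => by
      simp only [compsAux, List.mem_singleton] at h
      subst h
      simp [Str.single, Str.deg, arr]
  | _, _, _, a, .cons x s, c, h => by
      simp only [compsAux, List.mem_append, List.mem_map] at h
      rcases h with h | ⟨q, hq, rfl⟩
      · rw [deg_of_mem_compsAux _ _ _ h, Str.deg_append]
        simp only [Str.single, Str.deg]; ring
      · rw [Str.deg, deg_of_mem_compsAux _ _ _ hq]
        simp [Str.single, Str.deg, arr]

theorem deg_of_mem_comps {X Y : S} (s : Str V X Y) : ∀ c ∈ φ.comps s, c.deg = s.deg := by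
  cases s with
  | nil => simp [comps, Str.deg]
  | cons x s =>
    intro c h
    rw [deg_of_mem_compsAux φ _ _ c h]
    simp [Str.single, Str.deg]

variable {M : Type w} [AddCommGroup M]

/-- The sum of the values of `F` on the strings whose sum is the image of `s`. -/
def csum {X Y : S} (s : Str V X Y) (F : Str W (φ.obj X) (φ.obj Y) → M) : M :=
  ((φ.comps s).map F).sum

@[simp] theorem csum_nil {X : S} (F : Str W (φ.obj X) (φ.obj X) → M) :
    φ.csum (.nil X) F = F (.nil _) := by
  simp [csum, comps]

theorem csum_congr {X Y : S} {s : Str V X Y} {F G : Str W (φ.obj X) (φ.obj Y) → M}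
    (h : ∀ c, c.deg = s.deg → F c = G c) : φ.csum s F = φ.csum s G := by
  unfold csum
  congr 1
  exact List.map_congr_left fun c hc => h c (φ.deg_of_mem_comps s c hc)

theorem csum_zero {X Y : S} (s : Str V X Y) :
    (φ.csum s fun _ => (0 : M)) = 0 := by
  simp [csum]

theorem csum_add {X Y : S} (s : Str V X Y) (F G : Str W (φ.obj X) (φ.obj Y) → M) :
    (φ.csum s fun c => F c + G c) = φ.csum s F + φ.csum s G := by
  simp [csum, List.sum_map_add]

theorem _root_.LinearMap.map_csum [Module k M] {N : Type*} [AddCommGroup N] [Module k N]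
    (f : M →ₗ[k] N) {X Y : S} (s : Str V X Y) (F : Str W (φ.obj X) (φ.obj Y) → M) :
    f (φ.csum s F) = φ.csum s fun c => f (F c) := by
  simp [csum, map_list_sum, Function.comp_def]

theorem smul_csum [Module k M] (c : k) {X Y : S} (s : Str V X Y)
    (F : Str W (φ.obj X) (φ.obj Y) → M) : c • φ.csum s F = φ.csum s fun x => c • F x :=
  (LinearMap.lsmul k M c).map_csum φ s F

theorem csum_map₂ [Module k M] {T' : Type*} {U : GrQuiver k T'} {T'' : Type*} {U' : GrQuiver k T''}
    (ψ : CocatHom U U') {N₁ N₂ : Type*} [AddCommGroup N₁] [Module k N₁] [AddCommGroup N₂]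
    [Module k N₂] (L : N₁ →ₗ[k] N₂ →ₗ[k] M) {X Y : S} {X' Y' : T'} (s : Str V X Y)
    (t : Str U X' Y') (F : Str W (φ.obj X) (φ.obj Y) → N₁)
    (G : Str U' (ψ.obj X') (ψ.obj Y') → N₂) :
    (φ.csum s fun c => ψ.csum t fun c' => L (F c) (G c')) = L (φ.csum s F) (ψ.csum t G) := by
  have h : ∀ c, (ψ.csum t fun c' => L (F c) (G c')) = L.flip (ψ.csum t G) (F c) :=
    fun c => ((L (F c)).map_csum ψ t G).symm
  simp only [h]
  exact ((L.flip (ψ.csum t G)).map_csum φ s F).symm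

theorem csum_mem [Module k M] {N : Submodule k M} {X Y : S} {s : Str V X Y}
    {F : Str W (φ.obj X) (φ.obj Y) → M} (h : ∀ c, c.deg = s.deg → F c ∈ N) : φ.csum s F ∈ N := by
  refine list_sum_mem fun x hx => ?_
  obtain ⟨c, hc, rfl⟩ := List.mem_map.1 hx
  exact h c (φ.deg_of_mem_comps s c hc)

theorem csum_comm {T : Type*} {U : GrQuiver k T} {T' : Type*} {U' : GrQuiver k T'}
    (ψ : CocatHom U U') {X Y : S} {X' Y' : T} (s : Str V X Y) (t : Str U X' Y')
    (F : Str W (φ.obj X) (φ.obj Y) → Str U' (ψ.obj X') (ψ.obj Y') → M) :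
    (φ.csum s fun c => ψ.csum t fun c' => F c c') =
      ψ.csum t fun c' => φ.csum s fun c => F c c' := by
  unfold csum
  induction φ.comps s with
  | nil => simp
  | cons a l ih => simp [ih, List.sum_map_add]

theorem csum_sum2_comm {T : Type*} {U : GrQuiver k T} {X Y : S} {X' Y' : T}
    (s : Str V X Y) (t : Str U X' Y')
    (F : Str W (φ.obj X) (φ.obj Y) → ∀ Z, Str U X' Z → Str U Z Y' → M) :
    (φ.csum s fun c => t.sum2 (F c)) = t.sum2 fun Z a b => φ.csum s fun c => F c Z a b :=
  Str.sum2_list_sum t (φ.comps s) F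

theorem sum_map_compsAux : ∀ {X Y Z : S} (a : Str V X Y) (s : Str V Y Z)
    (F : Str W (φ.obj X) (φ.obj Z) → M),
    ((φ.compsAux a s).map F).sum =
      s.sum2 fun _ b r => φ.csum r fun c => F (.cons (φ.arr (a.append b)) c)
  | _, _, _, a, .nil _, F => by simp [compsAux, Str.single]
  | _, _, _, a, .cons x s, F => by
      rw [compsAux, List.map_append, List.sum_append, sum_map_compsAux, Str.sum2_cons, add_comm]
      congr 1
      · simp [csum, comps, Function.comp_def]
      · simp only [Str.append_assoc]; rfl

theorem csum_cons {X Y Z : S} (x : Arrow V X Y) (s : Str V Y Z)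
    (F : Str W (φ.obj X) (φ.obj Z) → M) :
    φ.csum (.cons x s) F =
      s.sum2 fun _ b r => φ.csum r fun c => F (.cons (φ.arr (.cons x b)) c) :=
  φ.sum_map_compsAux (.single x) s F

/-- The cocategory homomorphism is compatible with the cut comultiplication. -/
theorem csum_sum2 {X Y : S} (s : Str V X Y)
    (F : ∀ Z, Str W (φ.obj X) Z → Str W Z (φ.obj Y) → M) :
    (φ.csum s fun c => c.sum2 F) =
      s.sum2 fun _ l r => φ.csum l fun c => φ.csum r fun c' => F _ c c' := by
  -- `csum_cons` splits off the first block, which is non-empty, so the induction hypothesis applies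
  -- to the remaining string.
  generalize hn : s.length = n
  induction n using Nat.strong_induction_on generalizing X s F with
  | _ n ih =>
    cases s with
    | nil => simp
    | cons x s =>
      have h : ∀ (Z : S) (l : Str V _ Z) (r : Str V Z Y), l.append r = s →
          (φ.csum r fun c => c.sum2 fun U a b => F U (.cons (φ.arr (.cons x l)) a) b) =
          r.sum2 fun _ a b => φ.csum a fun c => φ.csum b fun c' =>
            F _ (.cons (φ.arr (.cons x l)) c) c' := by
        intro Z l r hlr
        refine ih r.length ?_ r _ rfl
        rw [← hn, Str.length, ← hlr, Str.length_append]; omega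
      simp only [csum_cons, Str.sum2_cons, csum_add, Str.sum2_add, csum_nil]
      congr 1
      rw [Str.sum2_congr h]
      change s.sum3 _ = _
      rw [← Str.sum2_assoc]

theorem csum_sum3 {X Y : S} (s : Str V X Y)
    (F : ∀ Z Z', Str W (φ.obj X) Z → Str W Z Z' → Str W Z' (φ.obj Y) → M) :
    (φ.csum s fun c => c.sum3 F) =
      s.sum3 fun _ _ l m r => φ.csum l fun c₁ => φ.csum m fun c₂ => φ.csum r fun c₃ =>
        F _ _ c₁ c₂ c₃ := by
  unfold Str.sum3
  rw [csum_sum2]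
  refine Str.sum2_congr fun Z l t _ => ?_
  simp only [csum_sum2, csum_sum2_comm]

/-- The image of a string in the tensor module of the target. -/
def hat {X Y : S} (s : Str V X Y) : T W (φ.obj X) (φ.obj Y) := φ.csum s T.tprod

@[simp] theorem hat_nil (X : S) : φ.hat (.nil X) = T.tprod (.nil _) := by simp [hat]

/-- Recursion on the first block. Since `map_nil` kills the empty block, the sum may run over all
cuts of the string, which is the form to which `sum2_append_cons` and the coderivation rules apply.
-/
theorem hat_cons {X Y Z : S} (x : Arrow V X Y) (s : Str V Y Z) :
    φ.hat (.cons x s) =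
      (Str.cons x s).sum2 fun _ l r => T.mul (T.letter (φ.map l)) (φ.hat r) := by
  rw [hat, csum_cons, Str.sum2_cons, map_nil, map_zero, LinearMap.map_zero₂, zero_add]
  refine Str.sum2_congr fun Z' l r _ => ?_
  rw [hat, LinearMap.map_csum]
  refine φ.csum_congr fun c _ => ?_
  have h := T.letter_apply (φ.arr (.cons x l))
  rw [show φ.map (.cons x l) = ((φ.arr (.cons x l)).2 : W.Hom _ _) from rfl, h, T.mul_tprod]
  rfl

/-- Multilinearity is not visible from the list `comps`. In the recursion on the first block the
varied letter lies either in that block, where `map` is linear, or in a remainder, which is shorter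
unless the block is empty, and then its coefficient is zero. -/
theorem hat_multilinear (X Y : S) : IsMultilinear (φ.hat (X := X) (Y := Y)) := by
  -- The bound on the length precedes the starting object `X`, because `X` changes when a first
  -- block is removed.
  suffices h : ∀ (n : ℕ) {X : S}, (∀ {Z W' : S} (s : Str V X Z) (t : Str V W' Y) (d : ℤ)
      (x y : V.gr Z W' d), s.length + t.length < n → φ.hat (s.append (.cons ⟨d, x + y⟩ t)) =
        φ.hat (s.append (.cons ⟨d, x⟩ t)) + φ.hat (s.append (.cons ⟨d, y⟩ t))) ∧
      (∀ {Z W' : S} (s : Str V X Z) (t : Str V W' Y) (d : ℤ) (c : k)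
      (x : V.gr Z W' d), s.length + t.length < n → φ.hat (s.append (.cons ⟨d, c • x⟩ t)) =
        c • φ.hat (s.append (.cons ⟨d, x⟩ t))) from
    ⟨fun s t d x y => (h (s.length + t.length + 1)).1 s t d x y (Nat.lt_succ_self _),
      fun s t d c x => (h (s.length + t.length + 1)).2 s t d c x (Nat.lt_succ_self _)⟩
  have key : ∀ {X Z W' : S} (s : Str V X Z) (t : Str V W' Y) (x : Arrow V Z W'),
      φ.hat (s.append (.cons x t)) =
        (s.sum2 fun U a b => T.mul (T.letter (φ.map a)) (φ.hat (b.append (.cons x t)))) +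
          t.sum2 fun U a b => T.mul (T.letter (φ.map (s.append (.cons x a)))) (φ.hat b) := by
    intro X Z W' s t x
    refine Eq.trans ?_ (Str.sum2_append_cons s x t fun U a b =>
      T.mul (T.letter (φ.map a)) (φ.hat b))
    cases s with
    | nil => exact φ.hat_cons x t
    | cons y s => exact φ.hat_cons y _
  intro n
  induction n with
  | zero => exact ⟨fun s t d x y h => absurd h (Nat.not_lt_zero _),
      fun s t d c x h => absurd h (Nat.not_lt_zero _)⟩
  | succ n ih =>
    intro X
    have hb : ∀ {Z U W' : S} (s : Str V X Z) (t : Str V W' Y) (a : Str V X U) (b : Str V U Z),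
        a.append b = s → s.length + t.length < n + 1 → a.length ≠ 0 → b.length + t.length < n := by
      intro Z U W' s t a b h hn ha
      rw [← h, Str.length_append] at hn
      omega
    have h0 : ∀ {U : S} (a : Str V X U), a.length = 0 → φ.map a = 0 := by
      intro U a ha
      cases a with
      | nil => exact φ.map_nil _
      | cons => simp [Str.length] at ha
    constructor
    · intro Z W' s t d x y hn
      rw [key, key, key, add_add_add_comm, ← Str.sum2_add, ← Str.sum2_add]
      congr 1
      · refine Str.sum2_congr fun U a b hab => ?_
        by_cases ha : a.length = 0
        · simp [h0 a ha]
        · rw [ih.1 b t d x y (hb s t a b hab hn ha), map_add]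
      · refine Str.sum2_congr fun U a b hab => ?_
        rw [(φ.map_multilinear _ _).add, map_add, LinearMap.map_add₂]
    · intro Z W' s t d c x hn
      rw [key, key, smul_add, Str.smul_sum2, Str.smul_sum2]
      congr 1
      · refine Str.sum2_congr fun U a b hab => ?_
        by_cases ha : a.length = 0
        · simp [h0 a ha]
        · rw [ih.2 b t d c x (hb s t a b hab hn ha), map_smul]
      · refine Str.sum2_congr fun U a b hab => ?_
        rw [(φ.map_multilinear _ _).smul, map_smul, LinearMap.map_smul₂]

end CocatHom

/-! ### Composition with the codifferential -/

namespace OpQuiver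

variable {S : Type u} (A : OpQuiver.{uk, u, v} k S) {M : Type w} [AddCommGroup M] [Module k M]

/-- The composition of a function on strings with the codifferential
`∑ 1^{⊗a} ⊗ b_q ⊗ 1^{⊗c}`. -/
def pre {X Y : S} (F : Str A.toGrQuiver X Y → M) (s : Str A.toGrQuiver X Y) : M :=
  s.sum3 fun _ _ l m r => sgn k r.deg • F (l.append (.cons (A.bArr m) r))

variable {A}

theorem pre_add {X Y : S} (F G : Str A.toGrQuiver X Y → M) (s : Str A.toGrQuiver X Y) :
    A.pre (fun t => F t + G t) s = A.pre F s + A.pre G s := by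
  simp only [pre, smul_add, Str.sum3_add]

theorem _root_.LinearMap.map_pre {N : Type*} [AddCommGroup N] [Module k N] (f : M →ₗ[k] N)
    {X Y : S} (F : Str A.toGrQuiver X Y → M) (s : Str A.toGrQuiver X Y) :
    f (A.pre F s) = A.pre (fun t => f (F t)) s := by
  simp only [pre, f.map_strSum3, map_smul]

theorem pre_smul {X Y : S} (c : k) (F : Str A.toGrQuiver X Y → M) (s : Str A.toGrQuiver X Y) :
    A.pre (fun t => c • F t) s = c • A.pre F s :=
  ((LinearMap.lsmul k M c).map_pre F s).symm

theorem pre_sub {X Y : S} (F G : Str A.toGrQuiver X Y → M) (s : Str A.toGrQuiver X Y) :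
    A.pre (fun t => F t - G t) s = A.pre F s - A.pre G s := by
  simp only [sub_eq_add_neg, pre_add]
  congr 1
  exact ((-LinearMap.id : M →ₗ[k] M).map_pre G s).symm

theorem pre_sum2 {T : Type*} {U : GrQuiver k T} {X' Y' : T} {X Y : S}
    (t : Str U X' Y') (F : Str A.toGrQuiver X Y → ∀ Z, Str U X' Z → Str U Z Y' → M)
    (s : Str A.toGrQuiver X Y) :
    A.pre (fun s => t.sum2 (F s)) s = t.sum2 fun Z a b => A.pre (fun s => F s Z a b) s := by
  simp only [pre, Str.sum3, Str.smul_sum2]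
  simp only [Str.sum2_comm (t := t)]

theorem pre_zero {X Y : S} (s : Str A.toGrQuiver X Y) :
    A.pre (fun _ => (0 : M)) s = 0 :=
  Str.sum3_eq_zero fun _ _ _ _ _ _ => smul_zero _

theorem pre_congr {X Y : S} {F G : Str A.toGrQuiver X Y → M} {s : Str A.toGrQuiver X Y}
    (h : ∀ t : Str A.toGrQuiver X Y, t.deg = s.deg + 1 → F t = G t) : A.pre F s = A.pre G s := by
  refine Str.sum3_congr fun Z W l m r hs => ?_
  rw [h]
  rw [← hs]
  simp only [Str.deg_append, Str.deg, bArr]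
  ring

/-- `splits3` also produces empty middle pieces; there is no `b₀`, and this lemma discards those
terms. -/
theorem bArr_nil_append {X Y Z : S} {F : Str A.toGrQuiver X Y → M} (hF : IsMultilinear F)
    (l : Str A.toGrQuiver X Z) (r : Str A.toGrQuiver Z Y) :
    F (l.append (.cons (A.bArr (.nil Z)) r)) = 0 := by
  have h : A.bArr (.nil Z) = ⟨(Str.nil Z : Str A.toGrQuiver Z Z).deg + 1, 0⟩ :=
    Arrow.ext rfl (A.b_nil Z)
  rw [h, hF.zero]

/-- The codifferential is a coderivation: the case of sums over two pieces. -/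
theorem pre_sum2_split {X Y : S} (s : Str A.toGrQuiver X Y)
    (F : ∀ Z, Str A.toGrQuiver X Z → Str A.toGrQuiver Z Y → M) :
    A.pre (fun s => s.sum2 F) s =
      (s.sum2 fun Z a t => A.pre (F Z a) t) +
        s.sum2 fun Z t c => sgn k c.deg • A.pre (fun u => F Z u c) t := by
  unfold pre
  simp only [Str.sum2_append_cons, smul_add, Str.sum3_add]
  congr 1
  · simp only [Str.smul_sum2, Str.sum3]
    refine Eq.trans ?_ (Str.sum2_assoc s fun Z W a b t => t.sum2 fun U m r => sgn k r.deg •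
      F Z a (b.append (.cons (A.bArr m) r)))
    exact Str.sum2_congr fun Z l t _ => Str.sum2_comm _ _ _
  · simp only [Str.smul_sum3, Str.smul_sum2]
    simp only [Str.sum3]
    rw [Str.sum2_assoc, Str.sum3]
    refine Str.sum2_congr fun Z l t _ => ?_
    rw [Str.sum2_assoc, Str.sum3]
    refine Str.sum2_congr fun Z' m r _ => Str.sum2_congr fun Z'' a c h => ?_
    rw [← h, Str.deg_append, smul_smul, ← sgn_add, add_comm]

/-- The codifferential is a coderivation: the case of sums over three pieces. -/
theorem pre_sum3_split {X Y : S} (s : Str A.toGrQuiver X Y)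
    (F : ∀ Z W, Str A.toGrQuiver X Z → Str A.toGrQuiver Z W → Str A.toGrQuiver W Y → M) :
    A.pre (fun s => s.sum3 F) s =
      (s.sum3 fun Z W a q t => A.pre (F Z W a q) t) +
      (s.sum3 fun Z W a q t => sgn k t.deg • A.pre (fun u => F Z W a u t) q) +
      s.sum3 fun Z W a q t => sgn k (q.deg + t.deg) • A.pre (fun u => F Z W u q t) a := by
  unfold Str.sum3
  rw [pre_sum2_split]
  simp only [pre_sum2_split, Str.sum2_add]
  congr 1
  refine Str.sum2_congr fun Z a t _ => ?_
  rw [pre_sum2, Str.smul_sum2]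
  refine Str.sum2_congr fun W q r h => ?_
  rw [← h, Str.deg_append]

/-- The codifferential applied to a string with a marked letter. -/
theorem pre_append_cons {X Y Z W : S} (F : Str A.toGrQuiver X W → M) (l : Str A.toGrQuiver X Y)
    (x : Arrow A.toGrQuiver Y Z) (r : Str A.toGrQuiver Z W) :
    A.pre F (l.append (.cons x r)) =
      sgn k (x.1 + r.deg) • A.pre (fun u => F (u.append (.cons x r))) l +
      (l.sum2 fun _ a b => r.sum2 fun _ c d => sgn k d.deg •
        F (a.append (.cons (A.bArr (b.append (.cons x c))) d))) +
      A.pre (fun u => F (l.append (.cons x u))) r := by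
  unfold pre
  simp only [Str.sum3, Str.sum2_append_cons, Str.sum2_add, Str.smul_sum2]
  congr 1
  · congr 1
    refine Str.sum2_congr fun Z l t _ => Str.sum2_congr fun Z' m r _ => ?_
    simp only [Str.deg_append, Str.deg, Str.append_assoc, Str.cons_append, smul_smul, ← sgn_add]
    congr 2
    ring
  · simp only [Str.append_assoc, Str.cons_append]

theorem pre_multilinear {X Y : S} {F : Str A.toGrQuiver X Y → M} (hF : IsMultilinear F) :
    IsMultilinear (A.pre F) := by
  refine IsMultilinear.sum3 (fun Z W m r => ?_) (fun Z W l r => ?_) fun Z W l m => ?_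
  · exact (hF.comp_append_right _).const_smul _
  -- In the middle slot `F` sees the letter `bArr m`, whose degree is tied to `m`. Passing through
  -- `T.letter` exhibits the expression as a linear map applied to `A.b m`.
  · have h : ∀ m : Str A.toGrQuiver Z W, F (l.append (.cons (A.bArr m) r)) =
        T.lift F hF (T.mul (T.tprod l) (T.mul (T.letter (A.b m)) (T.tprod r))) := fun m => by
      rw [show A.b m = ((A.bArr m).2 : A.Hom Z W) from rfl, ← T.tprod_append_cons, T.lift_tprod]
    simp only [h]
    refine IsMultilinear.const_smul ?_ _
    exact (A.b_multilinear Z W).map_linear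
      ((T.lift F hF).comp ((T.mul (T.tprod l)).comp ((T.mul.flip (T.tprod r)).comp T.letter)))
  · exact IsMultilinear.deg_smul
      ((hF.comp_append_left l).comp_append_left (.single (A.bArr m))) (sgn k)

/-- The square of the codifferential. -/
theorem pre_pre {X Y : S} {F : Str A.toGrQuiver X Y → M} (hF : IsMultilinear F)
    (s : Str A.toGrQuiver X Y) :
    A.pre (A.pre F) s = s.sum3 fun _ _ a q t =>
      T.lift F hF (T.mul (T.tprod a) (T.mul (T.letter (A.pre A.b q)) (T.tprod t))) := by
  have h := pre_sum3_split s fun Z W l m r => sgn k r.deg • F (l.append (.cons (A.bArr m) r))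
  change A.pre (A.pre F) s = _ at h
  -- The two insertions of `b` are either nested, which gives `b` composed with `b` in the middle
  -- piece, or disjoint. The disjoint ones form the two families whose sum is shown to vanish.
  rw [h, add_right_comm, add_eq_right.2]
  · refine Str.sum3_congr fun Z W a q t _ => ?_
    rw [pre_smul, sgn_smul_sgn_smul]
    have := ((T.lift F hF).comp ((T.mul (T.tprod a)).comp
      ((T.mul.flip (T.tprod t)).comp T.letter))).map_pre (A := A) A.b q
    refine Eq.trans ?_ this.symm
    refine Str.sum3_congr fun Z W l m r _ => ?_
    congr 1
    change _ = T.lift F hF (T.mul (T.tprod a) (T.mul (T.letter _) (T.tprod t)))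
    rw [show A.b (l.append (.cons (A.bArr m) r)) =
      ((A.bArr (l.append (.cons (A.bArr m) r))).2 : A.Hom _ _) from rfl, ← T.tprod_append_cons,
      T.lift_tprod]
  -- Both families are indexed by the cuts of `s` into five pieces `l, m, r, q, t` with `b` applied
  -- to `m` and `q`. Performing the insertions in the other order changes the sign, because `b` has
  -- odd degree.
  · rw [← eq_neg_iff_add_eq_zero]
    have hr : ∀ (Z W : S) (a : Str A.toGrQuiver X Z) (q : Str A.toGrQuiver Z W)
        (t : Str A.toGrQuiver W Y),
        sgn k (q.deg + t.deg) • A.pre (fun u => sgn k t.deg • F (u.append (.cons (A.bArr q) t))) a =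
        a.sum2 fun _ l v => v.sum2 fun _ m r => sgn k (q.deg + r.deg) •
          F (l.append (.cons (A.bArr m) (r.append (.cons (A.bArr q) t)))) := by
      intro Z W a q t
      rw [pre_smul, sgn_add, mul_smul, sgn_smul_sgn_smul]
      unfold pre
      rw [Str.smul_sum3]
      simp only [Str.append_assoc, Str.cons_append, smul_smul, ← sgn_add]
      rfl
    simp only [hr]
    unfold pre Str.sum3
    have h2 : ∀ (Z : S) (a : Str A.toGrQuiver X Z) (t : Str A.toGrQuiver Z Y),
        (t.sum2 fun _ q t => a.sum2 fun _ l v => v.sum2 fun _ m r => sgn k (q.deg + r.deg) •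
          F (l.append (.cons (A.bArr m) (r.append (.cons (A.bArr q) t))))) =
        a.sum2 fun _ l v => v.sum2 fun _ m r => t.sum2 fun _ q t => sgn k (q.deg + r.deg) •
          F (l.append (.cons (A.bArr m) (r.append (.cons (A.bArr q) t)))) := by
      intro Z a t
      rw [Str.sum2_comm]
      exact Str.sum2_congr fun _ _ _ _ => Str.sum2_comm _ _ _
    simp only [h2]
    rw [Str.sum2_assoc s fun _ _ l v t => v.sum2 fun _ m r => t.sum2 fun _ q t =>
      sgn k (q.deg + r.deg) •
        F (l.append (.cons (A.bArr m) (r.append (.cons (A.bArr q) t)))), Str.sum3, Str.neg_sum2]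
    refine Str.sum2_congr fun Z l w _ => ?_
    rw [Str.sum2_assoc w fun _ _ m r t => t.sum2 fun _ q t =>
      sgn k (q.deg + r.deg) •
        F (l.append (.cons (A.bArr m) (r.append (.cons (A.bArr q) t)))), Str.sum3, Str.neg_sum2]
    refine Str.sum2_congr fun _ m x _ => ?_
    simp only [Str.neg_sum2]
    refine Str.sum2_congr fun _ r y _ => Str.sum2_congr fun _ q t _ => ?_
    rw [smul_smul, ← sgn_add, ← neg_smul, ← sgn_succ]
    congr 1
    simp only [Str.deg_append, Str.deg, bArr]
    exact sgn_eq_of_eq_add_two_mul t.deg (by ring)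

end OpQuiver

/-- Both sides run over the cuts of `s` into five pieces. The regrouping is needed when an inner
application of `b` absorbs the end of the `φ`-part and the beginning of the `ψ`-part. -/
theorem Str.sum3_split_outer {S : Type u} {V : GrQuiver.{uk, u, v} k S} {M : Type w}
    [AddCommGroup M] {X Y : S} (s : Str V X Y)
    (H : ∀ Z₁ Z₂ Z₃ Z₄, Str V X Z₁ → Str V Z₁ Z₂ → Str V Z₂ Z₃ → Str V Z₃ Z₄ → Str V Z₄ Y → M) :
    (s.sum3 fun _ _ a q t => a.sum2 fun _ a₁ a₂ => t.sum2 fun _ t₁ t₂ =>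
      H _ _ _ _ a₁ a₂ q t₁ t₂) =
    s.sum3 fun _ _ a₁ m t₂ => m.sum3 fun _ _ a₂ q t₁ => H _ _ _ _ a₁ a₂ q t₁ t₂ := by
  unfold Str.sum3
  have h1 : ∀ (Z : S) (a : Str V X Z) (u : Str V Z Y),
      (u.sum2 fun _ q t => a.sum2 fun _ a₁ a₂ => t.sum2 fun _ t₁ t₂ =>
        H _ _ _ _ a₁ a₂ q t₁ t₂) =
      a.sum2 fun _ a₁ a₂ => u.sum2 fun _ q t => t.sum2 fun _ t₁ t₂ =>
        H _ _ _ _ a₁ a₂ q t₁ t₂ := fun _ _ _ => Str.sum2_comm _ _ _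
  simp only [h1]
  rw [Str.sum2_assoc s fun _ _ a₁ a₂ u => u.sum2 fun _ q t => t.sum2 fun _ t₁ t₂ =>
        H _ _ _ _ a₁ a₂ q t₁ t₂]
  refine Str.sum2_congr fun Z a₁ v _ => ?_
  rw [Str.sum2_assoc v fun _ _ a₂ w t₂ => w.sum2 fun _ q t₁ => H _ _ _ _ a₁ a₂ q t₁ t₂]
  refine Str.sum2_congr fun Z a₂ z _ => ?_
  rw [Str.sum2_assoc z fun _ _ q t₁ t₂ => H _ _ _ _ a₁ a₂ q t₁ t₂]
  rfl

/-! ### Functors commute with the codifferentials -/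

namespace CocatHom

variable {S : Type u} {A : OpQuiver.{uk, u, v} k S} {S' : Type u'} {W : GrQuiver.{uk, u', v'} k S'}
  (φ : CocatHom A.toGrQuiver W)

theorem hat_append_cons {X Y Z Z' : S} (l : Str A.toGrQuiver X Y) (x : Arrow A.toGrQuiver Y Z)
    (r : Str A.toGrQuiver Z Z') : φ.hat (l.append (.cons x r)) =
      (l.append (.cons x r)).sum2 fun _ a b => T.mul (T.letter (φ.map a)) (φ.hat b) := by
  cases l <;> exact φ.hat_cons _ _

/-- After `b` is inserted and the result is cut into blocks, exactly one block contains the inserted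
letter; the blocks on either side reassemble to `hat`. No functor equation is involved. The proof
asks whether `b` acts in the first block or later, by induction on the length. -/
theorem pre_hat_eq_sum3 {X Y : S} (s : Str A.toGrQuiver X Y) :
    A.pre φ.hat s = s.sum3 fun _ _ l m r => sgn k r.deg •
      T.mul (φ.hat l) (T.mul (T.letter (A.pre φ.map m)) (φ.hat r)) := by
  generalize hn : s.length = n
  induction n using Nat.strong_induction_on generalizing X s with
  | _ n ih =>
    cases s with
    | nil =>
      have h1 := OpQuiver.bArr_nil_append (φ.hat_multilinear Y Y) (.nil Y) (.nil Y)
      have h2 := OpQuiver.bArr_nil_append (φ.map_multilinear Y Y) (.nil Y) (.nil Y)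
      simp only [OpQuiver.pre, Str.sum3, Str.sum2_nil, h1, h2, smul_zero, map_zero,
        LinearMap.zero_apply]
    | cons x s =>
      -- `H t` collects the terms in which the very first block of `t` is the one touched by `b`.
      let H : ∀ {Z : S}, Str A.toGrQuiver Z Y → T W (φ.obj Z) (φ.obj Y) := fun t =>
        t.sum2 fun _ m r => sgn k r.deg • T.mul (T.letter (A.pre φ.map m)) (φ.hat r)
      have hL : A.pre φ.hat (.cons x s) = A.pre (fun t => t.sum2 fun _ a b =>
          T.mul (T.letter (φ.map a)) (φ.hat b)) (.cons x s) :=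
        Str.sum3_congr fun Z W l m r _ => by rw [hat_append_cons]
      have hR : ((Str.cons x s).sum3 fun _ _ l m r => sgn k r.deg •
          T.mul (φ.hat l) (T.mul (T.letter (A.pre φ.map m)) (φ.hat r))) =
          (Str.cons x s).sum2 fun _ l t => T.mul (φ.hat l) (H t) := by
        refine Str.sum2_congr fun Z l t _ => ?_
        simp only [H, LinearMap.map_strSum2, map_smul]
      -- The case of an empty `l` is separated; for non-empty `l` the factor `φ.hat l` is expanded
      -- by its own first block.
      have hR' : ((Str.cons x s).sum2 fun _ l t => T.mul (φ.hat l) (H t)) =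
          H (Str.cons x s) + (Str.cons x s).sum2 fun _ l t =>
            T.mul (l.sum2 fun _ a b => T.mul (T.letter (φ.map a)) (φ.hat b)) (H t) := by
        rw [Str.sum2_cons, Str.sum2_cons, hat_nil, T.nil_mul, Str.sum2_nil, map_nil, map_zero,
          LinearMap.map_zero₂, LinearMap.map_zero₂, zero_add]
        congr 1
        exact Str.sum2_congr fun Z l t _ => by rw [hat_cons]
      rw [hL, OpQuiver.pre_sum2_split, hR, hR', add_comm]
      congr 1
      · refine Str.sum2_congr fun Z t c _ => ?_
        have := ((T.mul.flip (φ.hat c)).comp T.letter).map_pre (A := A) φ.map t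
        rw [show T.mul (T.letter (A.pre φ.map t)) (φ.hat c) =
          ((T.mul.flip (φ.hat c)).comp T.letter) (A.pre φ.map t) from rfl, this]
        rfl
      · have h1 : ∀ (Z : S) (l : Str A.toGrQuiver X Z) (t : Str A.toGrQuiver Z Y),
            T.mul (l.sum2 fun _ a b => T.mul (T.letter (φ.map a)) (φ.hat b)) (H t) =
            l.sum2 fun _ a b => T.mul (T.letter (φ.map a)) (T.mul (φ.hat b) (H t)) := by
          intro Z l t
          simp only [← T.mul_assoc]
          exact (T.mul.flip (H t)).map_strSum2 _ _
        simp only [h1]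
        rw [Str.sum2_assoc _ fun _ _ a b t =>
          T.mul (T.letter (φ.map a)) (T.mul (φ.hat b) (H t))]
        refine Str.sum2_congr fun Z a t hat => ?_
        -- An empty first block contributes nothing on either side; a non-empty one leaves a shorter
        -- string.
        cases a with
        | nil => simp [map_nil, OpQuiver.pre_zero, Str.sum2_zero]
        | cons y a =>
          rw [← LinearMap.map_pre, ih t.length ?_ t rfl, ← LinearMap.map_strSum2]
          · congr 1
            refine Str.sum2_congr fun Z' l t' _ => ?_
            simp only [H, LinearMap.map_strSum2, map_smul]
          · rw [← hn, ← hat, Str.length_append, Str.length]; omega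

end CocatHom

namespace AInfFunctor

variable {S : Type u} {A : OpQuiver.{uk, u, v} k S} {S' : Type u'} {B : OpQuiver.{uk, u', v'} k S'}
  (φ : AInfFunctor A B)

theorem csum_b {X Y : S} (s : Str A.toGrQuiver X Y) : φ.csum s B.b = A.pre φ.map s :=
  (φ.comm s).trans (Str.sum_map_splits3 s fun _ _ l m r => sgn k r.deg •
    φ.map (l.append (.cons (A.bArr m) r)))

/-- The functor equation concerns only the component landing in single letters. It extends to all
tensor powers because both composites are coderivations along `φ`, determined by that component:
each equals the sum of the `hat l ⊗ pre map m ⊗ hat r`. -/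
theorem csum_pre_tprod {X Y : S} (s : Str A.toGrQuiver X Y) :
    φ.csum s (B.pre T.tprod) = A.pre φ.hat s := by
  rw [CocatHom.pre_hat_eq_sum3]
  unfold OpQuiver.pre
  rw [CocatHom.csum_sum3]
  refine Str.sum3_congr fun Z W l m r _ => ?_
  change _ = sgn k r.deg • T.mul (φ.hat l) (T.mul (T.letter (A.pre φ.map m)) (φ.hat r))
  rw [← csum_b]
  have h : ∀ (c₁ : Str B.toGrQuiver (φ.obj X) (φ.obj Z)) (c₂ : Str B.toGrQuiver (φ.obj Z) (φ.obj W)),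
      (φ.csum r fun c₃ => sgn k c₃.deg •
      T.tprod (c₁.append (.cons (B.bArr c₂) c₃))) =
      sgn k r.deg • T.mul (T.tprod c₁) (T.mul (T.letter (B.b c₂)) (φ.hat r)) := by
    intro c₁ c₂
    rw [CocatHom.hat, LinearMap.map_csum, LinearMap.map_csum,
      ← LinearMap.lsmul_apply, LinearMap.map_csum]
    refine φ.csum_congr fun c₃ hc => ?_
    rw [T.tprod_append_cons, hc]; rfl
  simp only [h]
  have h2 : ∀ c₁ : Str B.toGrQuiver (φ.obj X) (φ.obj Z), (φ.csum m fun c₂ => sgn k r.deg •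
      T.mul (T.tprod c₁) (T.mul (T.letter (B.b c₂)) (φ.hat r))) =
      sgn k r.deg • T.mul (T.tprod c₁) (T.mul (T.letter (φ.csum m B.b)) (φ.hat r)) := by
    intro c₁
    exact ((sgn k r.deg • (T.mul (T.tprod c₁)).comp
      ((T.mul.flip (φ.hat r)).comp T.letter)).map_csum φ.toCocatHom m B.b).symm
  simp only [h2]
  exact ((sgn k r.deg • T.mul.flip (T.mul (T.letter (φ.csum m B.b)) (φ.hat r))).map_csum
    φ.toCocatHom l T.tprod).symm

end AInfFunctor

/-! ### The differential of transformations -/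

namespace OpQuiver

variable {S : Type u} (B : OpQuiver.{uk, u, v} k S)

/-- The map `a ⊗ y ⊗ c ↦ (a ⊗ y ⊗ c) b`. -/
def bIns {X Y Z W : S} : T B.toGrQuiver X Y →ₗ[k] B.Hom Y Z →ₗ[k] T B.toGrQuiver Z W →ₗ[k] B.Hom X W :=
  LinearMap.mk₂ k (fun a y => (T.lift B.b (B.b_multilinear X W)).comp
      ((T.mul a).comp (T.mul (T.letter y))))
    (fun a a' y => by ext c; simp) (fun c a y => by ext c; simp)
    (fun a y y' => by ext c; simp) (fun c a y => by ext c; simp)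

theorem bIns_tprod {X Y Z W : S} (a : Str B.toGrQuiver X Y) (y : Arrow B.toGrQuiver Y Z)
    (c : Str B.toGrQuiver Z W) :
    B.bIns (T.tprod a) (y.2 : B.Hom Y Z) (T.tprod c) = B.b (a.append (.cons y c)) := by
  rw [← T.lift_tprod B.b (B.b_multilinear X W) (a.append (.cons y c)), T.tprod_append_cons]
  rfl

end OpQuiver

section Differential

variable {S : Type u} {V : GrQuiver.{uk, u, v} k S} {S' : Type u'} {B : OpQuiver.{uk, u', v'} k S'}

theorem CocatHom.csum_csum_bIns {T' : Type*} {U : GrQuiver k T'} (φ : CocatHom V B.toGrQuiver)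
    (ψ : CocatHom U B.toGrQuiver) {X Y : S} {Z W : T'} (a : Str V X Y) (c : Str U Z W)
    (y : B.Hom (φ.obj Y) (ψ.obj Z)) :
    (φ.csum a fun a' => ψ.csum c fun c' => B.bIns (T.tprod a') y (T.tprod c')) =
      B.bIns (φ.hat a) y (ψ.hat c) := by
  simp only [← LinearMap.map_csum]
  exact (((B.bIns.flip y).flip (ψ.hat c)).map_csum φ a T.tprod).symm


/-- The value at `s` of `∑ (φ_{aα} ⊗ r_q ⊗ ψ_{cβ}) b_{α+1+β}`, for a system of functions `r` regarded
as having degree `e`. -/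
def preTransB (φ ψ : CocatHom V B.toGrQuiver) (e : ℤ) (r : PreTrans φ ψ) {X Y : S} (s : Str V X Y) :
    B.Hom (φ.obj X) (ψ.obj Y) :=
  s.sum3 fun _ _ l m t => sgn k (e * t.deg) • B.bIns (φ.hat l) (r _ _ m) (ψ.hat t)

variable {φ ψ : CocatHom V B.toGrQuiver}

/-- `preTransB` takes an arbitrary system of functions and needs no proof of its degree. It is
therefore linear in `r` and usable before the degree of `r` is known. -/
theorem transB_eq_preTransB {e : ℤ} (r : Trans φ ψ e) {X Y : S} (s : Str V X Y) :
    transB r s = preTransB φ ψ e r.1 s := by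
  refine (Str.sum_map_splits3 s fun _ _ l m t => sgn k (e * t.deg) • (φ.csum l fun a =>
    ψ.csum t fun c => B.b (a.append (.cons (transArr r m) c)))).trans ?_
  refine Str.sum3_congr fun Z W l m t _ => ?_
  rw [← CocatHom.csum_csum_bIns]
  simp only [← B.bIns_tprod]
  rfl

theorem preTransB_multilinear (e : ℤ) {r : PreTrans φ ψ} (hr : ∀ X Y, IsMultilinear (r X Y))
    (X Y : S) : IsMultilinear (preTransB φ ψ e r (X := X) (Y := Y)) := by
  refine IsMultilinear.sum3 (fun Z W m t => ?_) (fun Z W l t => ?_) fun Z W l m => ?_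
  · exact IsMultilinear.const_smul ((φ.hat_multilinear _ _).map_linear
      ((B.bIns.flip (r Z W m)).flip (ψ.hat t))) _
  · exact IsMultilinear.const_smul ((hr Z W).map_linear
      ((B.bIns (φ.hat l)).flip (ψ.hat t))) _
  · exact IsMultilinear.deg_smul ((ψ.hat_multilinear _ _).map_linear
      (B.bIns (φ.hat l) (r Z W m))) fun d => sgn k (e * d)

theorem bIns_hat_mem {X Y Z W : S} (l : Str V X Y) (t : Str V Z W)
    (y : Arrow B.toGrQuiver (φ.obj Y) (ψ.obj Z)) :
    B.bIns (φ.hat l) (y.2 : B.Hom _ _) (ψ.hat t) ∈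
      B.gr (φ.obj X) (ψ.obj W) (l.deg + y.1 + t.deg + 1) := by
  rw [← CocatHom.csum_csum_bIns]
  refine φ.csum_mem fun a ha => ψ.csum_mem fun c hc => ?_
  rw [B.bIns_tprod]
  convert B.b_mem _ using 2
  rw [Str.deg_append, Str.deg, ha, hc]
  ring

/-- The hypothesis is confined to the pieces of `s`: in `exists_singlePart` the degree of the
constructed component is known only on the letters of the string in question. -/
theorem preTransB_mem {e : ℤ} {r : PreTrans φ ψ} {X Y : S} {s : Str V X Y}
    (hr : ∀ Z W (l : Str V X Z) (m : Str V Z W) (t : Str V W Y), l.append (m.append t) = s →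
      r Z W m ∈ B.gr (φ.obj Z) (ψ.obj W) (m.deg + e)) :
    preTransB φ ψ e r s ∈ B.gr (φ.obj X) (ψ.obj Y) (s.deg + e + 1) := by
  refine Str.sum3_mem fun Z W l m t h => Submodule.smul_mem _ _ ?_
  convert bIns_hat_mem l t ⟨m.deg + e, r Z W m, hr Z W l m t h⟩ using 2
  rw [← h, Str.deg_append, Str.deg_append]
  ring

theorem preTransB_sub (e : ℤ) (r r' : PreTrans φ ψ) {X Y : S} (s : Str V X Y) :
    preTransB φ ψ e (r - r') s = preTransB φ ψ e r s - preTransB φ ψ e r' s := by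
  rw [eq_sub_iff_add_eq, preTransB, preTransB, preTransB, ← Str.sum3_add]
  refine Str.sum3_congr fun Z W l m t _ => ?_
  rw [← smul_add, Pi.sub_apply, Pi.sub_apply, Pi.sub_apply, map_sub, LinearMap.sub_apply,
    sub_add_cancel]

end Differential

-- The square of `B₁`.

section Square

variable {S : Type u} {A : OpQuiver.{uk, u, v} k S} {S' : Type u'}

/-- The left side has the shape produced by `bIns_cocycle`, the right side is the iterated
differential. The signs agree because `(e + 1)|t₂| + e|t₁| = e(|t₁| + |t₂|) + |t₂|`. -/
theorem preTransB_regroup {B : OpQuiver.{uk, u', v'} k S'} (φ ψ : CocatHom A.toGrQuiver B.toGrQuiver)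
    (e : ℤ) (r : PreTrans φ ψ) {X Y : S} (s : Str A.toGrQuiver X Y) :
    (s.sum3 fun _ _ a q t => sgn k (e * t.deg) • a.sum2 fun _ a₁ a₂ => t.sum2 fun _ t₁ t₂ =>
      sgn k t₂.deg • B.bIns (φ.hat a₁) (B.bIns (φ.hat a₂) (r _ _ q) (ψ.hat t₁)) (ψ.hat t₂)) =
    s.sum3 fun _ _ l m t => sgn k ((e + 1) * t.deg) •
      B.bIns (φ.hat l) (preTransB φ ψ e r m) (ψ.hat t) := by
  have h1 : ∀ (Z W : S) (l : Str A.toGrQuiver X Z) (m : Str A.toGrQuiver Z W)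
      (t : Str A.toGrQuiver W Y), sgn k ((e + 1) * t.deg) •
        B.bIns (φ.hat l) (preTransB φ ψ e r m) (ψ.hat t) =
      m.sum3 fun _ _ a q c => sgn k ((e + 1) * t.deg + e * c.deg) •
        B.bIns (φ.hat l) (B.bIns (φ.hat a) (r _ _ q) (ψ.hat c)) (ψ.hat t) := by
    intro Z W l m t
    rw [preTransB, ← LinearMap.flip_apply, LinearMap.map_strSum3, Str.smul_sum3]
    refine Str.sum3_congr fun Z' W' a q c _ => ?_
    rw [map_smul, smul_smul, ← sgn_add]; rfl
  simp only [h1]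
  rw [← Str.sum3_split_outer s fun _ _ _ _ a₁ a₂ q t₁ t₂ =>
    sgn k ((e + 1) * t₂.deg + e * t₁.deg) •
        B.bIns (φ.hat a₁) (B.bIns (φ.hat a₂) (r _ _ q) (ψ.hat t₁)) (ψ.hat t₂)]
  refine Str.sum3_congr fun Z W a q t _ => ?_
  rw [Str.smul_sum2]
  refine Str.sum2_congr fun Z' a₁ a₂ _ => ?_
  rw [Str.smul_sum2]
  refine Str.sum2_congr fun Z'' t₁ t₂ h => ?_
  rw [smul_smul, ← sgn_add, ← h, Str.deg_append]
  congr 2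
  ring

theorem CocatHom.csum_csum_pre_bIns {B : OpQuiver.{uk, u', v'} k S'}
    (φ ψ : CocatHom A.toGrQuiver B.toGrQuiver) {X Y Z W : S} (a : Str A.toGrQuiver X Y)
    (t : Str A.toGrQuiver Z W) (y : Arrow B.toGrQuiver (φ.obj Y) (ψ.obj Z)) :
    (φ.csum a fun c => ψ.csum t fun c' => sgn k (y.1 + c'.deg) •
      B.pre (fun u => B.b (u.append (.cons y c'))) c) =
    sgn k (y.1 + t.deg) • B.bIns (φ.csum a (B.pre T.tprod)) (y.2 : B.Hom _ _) (ψ.hat t) := by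
  have h := φ.csum_map₂ ψ ((B.bIns (X := φ.obj X) (W := ψ.obj W)).flip y.2.1) a t
    (B.pre T.tprod) T.tprod
  rw [LinearMap.flip_apply] at h
  rw [CocatHom.hat, ← h]
  simp only [CocatHom.smul_csum]
  refine φ.csum_congr fun c _ => ψ.csum_congr fun c' hc => ?_
  rw [hc]
  congr 1
  have := (((B.bIns (X := φ.obj X) (W := ψ.obj W)).flip y.2.1).flip (T.tprod c')).map_pre T.tprod c
  refine Eq.trans ?_ this.symm
  congr 1
  funext u
  exact (B.bIns_tprod u y c').symm

theorem CocatHom.csum_csum_pre_bIns' {B : OpQuiver.{uk, u', v'} k S'}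
    (φ ψ : CocatHom A.toGrQuiver B.toGrQuiver) {X Y Z W : S} (a : Str A.toGrQuiver X Y)
    (t : Str A.toGrQuiver Z W) (y : Arrow B.toGrQuiver (φ.obj Y) (ψ.obj Z)) :
    (φ.csum a fun c => ψ.csum t fun c' => B.pre (fun u => B.b (c.append (.cons y u))) c') =
    B.bIns (φ.hat a) (y.2 : B.Hom _ _) (ψ.csum t (B.pre T.tprod)) := by
  have h := φ.csum_map₂ ψ ((B.bIns (X := φ.obj X) (W := ψ.obj W)).flip y.2.1) a t
    T.tprod (B.pre T.tprod)
  rw [LinearMap.flip_apply] at h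
  rw [CocatHom.hat, ← h]
  refine φ.csum_congr fun c _ => ψ.csum_congr fun c' hc => ?_
  have := (B.bIns (T.tprod c) (y.2 : B.Hom _ _)).map_pre T.tprod c'
  refine Eq.trans ?_ this.symm
  congr 1
  funext u
  exact (B.bIns_tprod c y u).symm

theorem CocatHom.csum_bIns_bIns {B : OpQuiver.{uk, u', v'} k S'}
    (φ ψ : CocatHom A.toGrQuiver B.toGrQuiver) {X Y Z W X' W' : S} (a₁ : Str A.toGrQuiver X' X)
    (a₂ : Str A.toGrQuiver X Y) (t₁ : Str A.toGrQuiver Z W) (t₂ : Str A.toGrQuiver W W')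
    (y : Arrow B.toGrQuiver (φ.obj Y) (ψ.obj Z)) :
    (φ.csum a₁ fun c₁ => φ.csum a₂ fun c₂ => ψ.csum t₁ fun d₁ => ψ.csum t₂ fun d₂ =>
      sgn k d₂.deg • B.b (c₁.append (.cons (B.bArr (c₂.append (.cons y d₁))) d₂))) =
    sgn k t₂.deg •
      B.bIns (φ.hat a₁) (B.bIns (φ.hat a₂) (y.2 : B.Hom _ _) (ψ.hat t₁)) (ψ.hat t₂) := by
  have h : ∀ c₁ : Str B.toGrQuiver (φ.obj X') (φ.obj X), (φ.csum a₂ fun c₂ => ψ.csum t₁ fun d₁ => ψ.csum t₂ fun d₂ =>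
      sgn k d₂.deg • B.b (c₁.append (.cons (B.bArr (c₂.append (.cons y d₁))) d₂))) =
      ψ.csum t₂ fun d₂ => sgn k t₂.deg • B.bIns (T.tprod c₁)
        (B.bIns (φ.hat a₂) (y.2 : B.Hom _ _) (ψ.hat t₁)) (T.tprod d₂) := by
    intro c₁
    have h1 : ∀ c₂ : Str B.toGrQuiver (φ.obj X) (φ.obj Y), (ψ.csum t₁ fun d₁ => ψ.csum t₂ fun d₂ =>
        sgn k d₂.deg • B.b (c₁.append (.cons (B.bArr (c₂.append (.cons y d₁))) d₂))) =
        ψ.csum t₂ fun d₂ => ψ.csum t₁ fun d₁ =>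
        sgn k d₂.deg • B.b (c₁.append (.cons (B.bArr (c₂.append (.cons y d₁))) d₂)) :=
      fun c₂ => CocatHom.csum_comm ψ ψ t₁ t₂ _
    simp only [h1]
    rw [CocatHom.csum_comm φ ψ a₂ t₂]
    refine ψ.csum_congr fun d₂ hd => ?_
    rw [hd]
    have h2 := φ.csum_csum_bIns ψ a₂ t₁ (y.2 : B.Hom _ _)
    rw [← h2]
    rw [← LinearMap.flip_apply, LinearMap.map_csum, CocatHom.smul_csum]
    refine φ.csum_congr fun c₂ _ => ?_
    rw [LinearMap.map_csum, CocatHom.smul_csum]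
    refine ψ.csum_congr fun d₁ _ => ?_
    congr 1
    rw [B.bIns_tprod c₂]
    exact (B.bIns_tprod c₁ (B.bArr (c₂.append (.cons y d₁))) d₂).symm
  simp only [h, ← CocatHom.smul_csum]
  rw [φ.csum_csum_bIns ψ a₁ t₂]

variable {B : AInfCat.{uk, u', v'} k S'} (φ ψ : AInfFunctor A B.toOpQuiver)

/-- This is the relation `b` after `b` equals zero of the target, evaluated on the image of `a`,
then `y`, then the image of `t`, and sorted by whether the inner `b` acts before `y`, absorbs `y`,
or acts after it. In the two outer cases the functor equations of `φ` and `ψ` move the inner `b` to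
the source. -/
theorem bIns_cocycle {X Y Z W : S} (a : Str A.toGrQuiver X Y) (t : Str A.toGrQuiver Z W)
    (y : Arrow B.toGrQuiver (φ.obj Y) (ψ.obj Z)) :
    sgn k (y.1 + t.deg) • B.bIns (A.pre φ.hat a) (y.2 : B.Hom _ _) (ψ.hat t) +
    (a.sum2 fun _ a₁ a₂ => t.sum2 fun _ t₁ t₂ => sgn k t₂.deg •
      B.bIns (φ.hat a₁) (B.bIns (φ.hat a₂) (y.2 : B.Hom _ _) (ψ.hat t₁)) (ψ.hat t₂)) +
    B.bIns (φ.hat a) (y.2 : B.Hom _ _) (A.pre ψ.hat t) = 0 := by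
  have h0 : (φ.csum a fun c => ψ.csum t fun c' =>
      B.pre B.b (c.append (.cons y c'))) = 0 := by
    have hb : ∀ (c : Str B.toGrQuiver (φ.obj X) (φ.obj Y)) (c' : Str B.toGrQuiver (ψ.obj Z) (ψ.obj W)),
        B.pre B.b (c.append (.cons y c')) = (0 : B.Hom (φ.obj X) (ψ.obj W)) :=
      fun c c' => (Str.sum_map_splits3 (c.append (.cons y c')) fun _ _ l m r => sgn k r.deg •
        B.b (l.append (.cons (B.bArr m) r))).symm.trans (B.b_b _)
    simp only [hb, CocatHom.csum_zero]
  simp only [OpQuiver.pre_append_cons, CocatHom.csum_add] at h0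
  rw [← h0, φ.csum_csum_pre_bIns, φ.csum_csum_pre_bIns', φ.csum_pre_tprod, ψ.csum_pre_tprod]
  congr 2
  simp only [CocatHom.csum_sum2_comm, CocatHom.csum_sum2, CocatHom.csum_bIns_bIns]

/-- The square of the differential of transformations. -/
theorem preTransB_sub_pre {e : ℤ} {r : PreTrans φ.toCocatHom ψ.toCocatHom}
    (hr : r ∈ Trans φ.toCocatHom ψ.toCocatHom e) {X Y : S} (s : Str A.toGrQuiver X Y) :
    preTransB φ.toCocatHom ψ.toCocatHom (e + 1)
        (fun X Y t => preTransB φ.toCocatHom ψ.toCocatHom e r t - sgn k e • A.pre (r X Y) t) s -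
      sgn k (e + 1) • A.pre
        (fun t => preTransB φ.toCocatHom ψ.toCocatHom e r t - sgn k e • A.pre (r X Y) t) s =
      -A.pre (A.pre (r X Y)) s := by
  have hY : (s.sum3 fun _ _ a q t => sgn k (e * t.deg) •
      ((sgn k (q.deg + e + t.deg) • B.bIns (A.pre φ.hat a) (r _ _ q) (ψ.hat t) +
      (a.sum2 fun _ a₁ a₂ => t.sum2 fun _ t₁ t₂ => sgn k t₂.deg •
        B.bIns (φ.hat a₁) (B.bIns (φ.hat a₂) (r _ _ q) (ψ.hat t₁)) (ψ.hat t₂))) +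
      B.bIns (φ.hat a) (r _ _ q) (A.pre ψ.hat t))) = 0 :=
    Str.sum3_eq_zero fun Z W a q t _ => by
      rw [bIns_cocycle φ ψ a t ⟨q.deg + e, r Z W q, (hr Z W).2 q⟩, smul_zero]
  -- The terms where the source `b` precedes `r` in a product are sorted by the piece it falls into:
  -- the `ψ`-part, the argument of `r`, or the `φ`-part.
  have hX := OpQuiver.pre_sum3_split s fun Z W l m t => sgn k (e * t.deg) •
    B.bIns (φ.hat l) (r _ _ m) (ψ.hat t)
  have hX1 : (s.sum3 fun Z W a q t => A.pre (fun t => sgn k (e * t.deg) •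
      B.bIns (φ.hat a) (r _ _ q) (ψ.hat t)) t) = sgn k e • s.sum3 fun _ _ a q t =>
        sgn k (e * t.deg) • B.bIns (φ.hat a) (r _ _ q) (A.pre ψ.hat t) := by
    rw [Str.smul_sum3]
    refine Str.sum3_congr fun Z W a q t _ => ?_
    rw [LinearMap.map_pre, smul_smul, ← sgn_add, ← OpQuiver.pre_smul]
    refine OpQuiver.pre_congr fun t' ht => ?_
    rw [ht]
    congr 2
    ring
  have hX2 : (s.sum3 fun Z W a q t => sgn k t.deg • A.pre (fun u => sgn k (e * t.deg) •
      B.bIns (φ.hat a) (r _ _ u) (ψ.hat t)) q) = s.sum3 fun _ _ a q t =>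
        sgn k ((e + 1) * t.deg) • B.bIns (φ.hat a) (A.pre (r _ _) q) (ψ.hat t) := by
    refine Str.sum3_congr fun Z W a q t _ => ?_
    rw [OpQuiver.pre_smul, smul_smul, ← sgn_add, ← LinearMap.flip_apply, LinearMap.map_pre]
    congr 2
    ring
  have hX3 : (s.sum3 fun Z W a q t => sgn k (q.deg + t.deg) • A.pre (fun u => sgn k (e * t.deg) •
      B.bIns (φ.hat u) (r _ _ q) (ψ.hat t)) a) = sgn k e • s.sum3 fun _ _ a q t =>
        sgn k (e * t.deg) • sgn k (q.deg + e + t.deg) •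
          B.bIns (A.pre φ.hat a) (r _ _ q) (ψ.hat t) := by
    rw [Str.smul_sum3]
    refine Str.sum3_congr fun Z W a q t _ => ?_
    have := ((B.bIns.flip (r Z W q)).flip (ψ.hat t)).map_pre (A := A) φ.hat a
    rw [OpQuiver.pre_smul]
    refine (congrArg (fun z => sgn k (q.deg + t.deg) • sgn k (e * t.deg) • z) this.symm).trans ?_
    simp only [smul_smul, ← sgn_add]
    refine congrArg (· • _) (sgn_eq_of_eq_add_two_mul (-e) (by ring))
  have hZ := preTransB_regroup φ.toCocatHom ψ.toCocatHom e r s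
  rw [hX1, hX2, hX3] at hX
  simp only [smul_add, Str.sum3_add] at hY
  rw [hZ] at hY
  have hL : preTransB φ.toCocatHom ψ.toCocatHom (e + 1)
      (fun X Y t => preTransB φ.toCocatHom ψ.toCocatHom e r t - sgn k e • A.pre (r X Y) t) s =
      (s.sum3 fun _ _ l m t => sgn k ((e + 1) * t.deg) •
        B.bIns (φ.hat l) (preTransB φ.toCocatHom ψ.toCocatHom e r m) (ψ.hat t)) -
      sgn k e • s.sum3 fun _ _ a q t =>
        sgn k ((e + 1) * t.deg) • B.bIns (φ.hat a) (A.pre (r _ _) q) (ψ.hat t) := by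
    rw [eq_sub_iff_add_eq, Str.smul_sum3, preTransB, ← Str.sum3_add]
    refine Str.sum3_congr fun Z W l m t _ => ?_
    rw [map_sub, map_smul, LinearMap.sub_apply, LinearMap.smul_apply, smul_sub,
      smul_comm (sgn k e), sub_add_cancel]
  rw [hL, OpQuiver.pre_sub, OpQuiver.pre_smul]
  change _ - sgn k (e + 1) • (A.pre (fun s => s.sum3 _) s - _) = _
  rw [hX, sgn_succ, neg_smul, smul_sub, smul_add, smul_add, sgn_smul_sgn_smul, sgn_smul_sgn_smul,
    sgn_smul_sgn_smul]
  -- The terms with `b` inside the argument of `r` cancel in pairs, and the remaining ones apart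
  -- from the double codifferential are exactly the vanishing sum `hY`.
  refine sub_eq_zero.1 (Eq.trans ?_ hY)
  abel

end Square

/-! ### More sums over decompositions -/

namespace Str

variable {S : Type u} {V : GrQuiver.{uk, u, v} k S} {M : Type w} [AddCommGroup M]

/-- The sum of `F l x r` over all letters `x` of `s = l · x · r`. -/
def sumLetters : ∀ {X Y : S} (_ : Str V X Y)
    (_ : ∀ Z W, Str V X Z → Arrow V Z W → Str V W Y → M), M
  | _, _, .nil _, _ => 0
  | _, _, .cons x s, F => F _ _ (.nil _) x s + s.sumLetters fun _ _ l y r => F _ _ (.cons x l) y r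

theorem sumLetters_congr : ∀ {X Y : S} {s : Str V X Y}
    {F G : ∀ Z W, Str V X Z → Arrow V Z W → Str V W Y → M},
    (∀ Z W l x r, l.append (.cons x r) = s → F Z W l x r = G Z W l x r) →
      s.sumLetters F = s.sumLetters G
  | _, _, .nil _, _, _, _ => rfl
  | _, _, .cons x s, F, G, h => by
      rw [sumLetters, sumLetters, h _ _ _ _ _ rfl]
      congr 1
      exact sumLetters_congr fun Z W l y r hs => h _ _ _ _ _ (by rw [append, hs])

theorem _root_.LinearMap.map_sumLetters {N : Type*} [Module k M] [AddCommGroup N] [Module k N]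
    (f : M →ₗ[k] N) : ∀ {X Y : S} (s : Str V X Y)
    (F : ∀ Z W, Str V X Z → Arrow V Z W → Str V W Y → M),
    f (s.sumLetters F) = s.sumLetters fun Z W l x r => f (F Z W l x r)
  | _, _, .nil _, _ => map_zero f
  | _, _, .cons x s, F => by rw [sumLetters, sumLetters, map_add, f.map_sumLetters s]

theorem sum2_left_nil {X Y : S} (s : Str V X Y) (F : ∀ Z, Str V X Z → Str V Z Y → M) :
    (s.sum2 fun Z l r => if l.length = 0 then F Z l r else 0) = F X (.nil X) s := by
  cases s with
  | nil => simp [length]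
  | cons x s => simp [sum2_cons, length, sum2_zero]

theorem sum2_right_nil {X Y : S} (s : Str V X Y) (F : ∀ Z, Str V X Z → Str V Z Y → M) :
    (s.sum2 fun Z l r => if r.length = 0 then F Z l r else 0) = F Y s (.nil Y) := by
  induction s with
  | nil => simp [length]
  | cons x s ih =>
    rw [sum2_cons, ih, if_neg (by simp [length]), zero_add]

theorem sum3_outer_nil {X Y : S} (s : Str V X Y)
    (F : ∀ Z W, Str V X Z → Str V Z W → Str V W Y → M) :
    (s.sum3 fun Z W l m r => if l.length + r.length = 0 then F Z W l m r else 0) =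
      F X Y (.nil X) s (.nil Y) := by
  unfold sum3
  rw [← sum2_right_nil s fun W m r => F X W (.nil X) m r,
    ← sum2_left_nil s fun Z l t => t.sum2 fun W m r => if r.length = 0 then F Z W l m r else 0]
  refine sum2_congr fun Z l t _ => ?_
  split_ifs with h
  · simp only [h, zero_add]
  · exact sum2_eq_zero fun _ _ _ _ => if_neg (by omega)

theorem sum3_mid_single {X Y : S} (s : Str V X Y)
    (F : ∀ Z W, Str V X Z → Str V Z W → Str V W Y → M) :
    (s.sum3 fun Z W l m r => if m.length = 1 then F Z W l m r else 0) =
      s.sumLetters fun Z W l x r => F Z W l (.single x) r := by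
  induction s with
  | nil => simp [sum3, length, sumLetters]
  | cons x s ih =>
    have h := ih fun Z W l m r => F Z W (.cons x l) m r
    rw [sum3, sum2_cons, sumLetters, ← h, sum2_cons, if_neg (by simp [length]), zero_add]
    congr 1
    have h2 := sum2_left_nil s fun W m r => F _ W (.nil _) (.cons x m) r
    refine Eq.trans ?_ h2
    exact sum2_congr fun Z m r _ => if_congr (by simp [length]) rfl rfl

/-- A cut of a given string is determined by the length of its left piece, so a single term
survives. -/
theorem sum2_append_of_length {X Y Z : S} (a : Str V X Y) (b : Str V Y Z)
    {F : ∀ W, Str V X W → Str V W Z → M} (h : ∀ W l r, l.length ≠ a.length → F W l r = 0) :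
    (a.append b).sum2 F = F Y a b := by
  induction a with
  | nil =>
    rw [nil_append, ← sum2_left_nil b F]
    refine sum2_congr fun W l r _ => ?_
    split_ifs with hl
    · rfl
    · exact h _ _ _ hl
  | cons x a ih =>
    rw [append, sum2_cons, h _ _ _ (by simp [length]), zero_add]
    exact ih b fun W l r hl => h _ _ _ (by simpa [length] using hl)

theorem exists_append_of_length : ∀ {X Y : S} (s : Str V X Y) (m n : ℕ), s.length = m + n →
    ∃ (Z : S) (a : Str V X Z) (b : Str V Z Y), a.append b = s ∧ a.length = m ∧ b.length = n
  | X, _, s, 0, n, h => ⟨X, .nil X, s, rfl, rfl, by simpa using h⟩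
  | _, _, .nil _, m + 1, n, h => by simp only [length] at h; omega
  | _, _, .cons x s, m + 1, n, h => by
      obtain ⟨Z, a, b, rfl, ha, hb⟩ := exists_append_of_length s m n (by
        simp only [length] at h; omega)
      exact ⟨Z, .cons x a, b, rfl, by simp [length, ha], hb⟩

end Str

theorem bTrans_eq_pre {S : Type u} {A : OpQuiver.{uk, u, v} k S} {S' : Type u'}
    {W : GrQuiver.{uk, u', v'} k S'} {φ ψ : CocatHom A.toGrQuiver W} (r : PreTrans φ ψ) {X Y : S}
    (s : Str A.toGrQuiver X Y) : bTrans r s = A.pre (r X Y) s :=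
  Str.sum_map_splits3 s fun _ _ l m t => sgn k t.deg • r X Y (l.append (.cons (A.bArr m) t))

theorem sum_map_filter_eq_sum_map_ite {ι : Type*} {M : Type*} [AddCommMonoid M] (l : List ι) (p : ι → Prop)
    [DecidablePred p] (f : ι → M) :
    ((l.filter fun i => p i).map f).sum = (l.map fun i => if p i then f i else 0).sum := by
  induction l with
  | nil => simp
  | cons i l ih => by_cases h : p i <;> simp [h, ih]

theorem bTransProper_eq_sum3 {S : Type u} {A : OpQuiver.{uk, u, v} k S} {S' : Type u'}
    {W : GrQuiver.{uk, u', v'} k S'} {φ ψ : CocatHom A.toGrQuiver W} (r : PreTrans φ ψ) {X Y : S}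
    (s : Str A.toGrQuiver X Y) : bTransProper r s = s.sum3 fun _ _ l m t =>
      if 0 < l.length + t.length then sgn k t.deg • r X Y (l.append (.cons (A.bArr m) t)) else 0 := by
  unfold bTransProper
  rw [sum_map_filter_eq_sum_map_ite]
  exact Str.sum_map_splits3 s fun _ _ l m t => if 0 < l.length + t.length then
    sgn k t.deg • r X Y (l.append (.cons (A.bArr m) t)) else 0

/-- The term missing from the proper sum has `a + c = 0`: it is `bₖr₁`, the one for which the
recurrent formula is solved. -/
theorem bTransProper_add {S : Type u} {A : OpQuiver.{uk, u, v} k S} {S' : Type u'}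
    {W : GrQuiver.{uk, u', v'} k S'} {φ ψ : CocatHom A.toGrQuiver W} (r : PreTrans φ ψ) {X Y : S}
    (s : Str A.toGrQuiver X Y) :
    bTransProper r s + r X Y (.single (A.bArr s)) = A.pre (r X Y) s := by
  have h := Str.sum3_outer_nil s fun _ _ l m t =>
    sgn k t.deg • r X Y (l.append (.cons (A.bArr m) t))
  rw [Str.deg, sgn_zero, one_smul] at h
  change _ = r X Y (.single (A.bArr s)) at h
  rw [← h, bTransProper_eq_sum3, ← Str.sum3_add]
  refine Str.sum3_congr fun Z W l m t _ => ?_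
  by_cases h0 : l.length + t.length = 0
  · rw [if_neg (by omega), if_pos h0, zero_add]
  · rw [if_pos (by omega), if_neg h0, add_zero]

/-! ### The differential of the tensor module -/

/-- Leibniz rule. Operators act from the right, so `d` acquires the sign of the factor `t` when it
acts on `s`. -/
theorem dStr_append {S : Type u} (Q : DGQuiver.{uk, u, v} k S) : ∀ {X Y Z : S}
    (s : Str Q.toGrQuiver X Y) (t : Str Q.toGrQuiver Y Z), dStr Q (s.append t) =
      sgn k t.deg • T.mul (dStr Q s) (T.tprod t) + T.mul (T.tprod s) (dStr Q t)
  | _, _, _, .nil _, t => by simp [dStr, T.nil_mul]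
  | _, _, _, .cons x s, t => by
      have h1 : T.mul (T.tprod (.single x)) (T.mul (T.tprod s) (dStr Q t)) =
          T.mul (T.tprod (.cons x s)) (dStr Q t) := by
        rw [← T.mul_assoc, T.mul_tprod]; rfl
      have h2 : T.tprod (.cons (Q.dArr x) (s.append t)) =
          T.mul (T.tprod (.cons (Q.dArr x) s)) (T.tprod t) := by
        rw [T.mul_tprod]; rfl
      rw [Str.append, dStr, dStr, dStr_append Q s t, map_add, map_smul, ← T.mul_assoc, h1, h2,
        map_add, LinearMap.add_apply, smul_add, map_smul, LinearMap.smul_apply, smul_smul,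
        ← sgn_add, Str.deg_append, add_comm t.deg, add_assoc]

theorem T.diff_mul {S : Type u} (Q : DGQuiver.{uk, u, v} k S) {X Y Z : S} (a : T Q.toGrQuiver X Y)
    {n : ℕ} {e : ℤ} {c : T Q.toGrQuiver Y Z} (hc : c ∈ T.part Y Z n e) :
    T.diff Q X Z (T.mul a c) =
      sgn k e • T.mul (T.diff Q X Y a) c + T.mul a (T.diff Q Y Z c) := by
  unfold T.part at hc
  induction hc using Submodule.span_induction with
  | mem x hx =>
    obtain ⟨t, -, rfl, rfl⟩ := hx
    induction a using T.induction with
    | tprod s => simp [T.diff, dStr_append]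
    | zero => simp
    | add a b ha hb => simp only [map_add, LinearMap.add_apply, ha, hb, smul_add]; abel
    | smul c a ha =>
      simp only [map_smul, LinearMap.smul_apply, ha, smul_add]; rw [smul_comm c]
  | zero => simp
  | add x y _ _ hx hy => simp only [map_add, hx, hy, smul_add]; abel
  | smul c x _ hx => simp only [map_smul, hx, smul_add]; rw [smul_comm c]

namespace Free

/-! ### Decomposable elements of the free quiver -/

section Pure

variable {S : Type u} (V : GrQuiver.{uk, u, v} k S)

/-- The element `x₁ ⊗ ⋯ ⊗ xₙ` of the summand with index `t`. -/
def pureElem {X Y : S} (t : PTree) (w : Str V X Y) (h : w.length = t.leaves) :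
    Arrow (quiver V) X Y :=
  have hm : Finsupp.single t (T.tprod w) ∈ homDeg V X Y (w.deg + t.verts) :=
    single_mem_homDeg V (Submodule.subset_span ⟨w, h, by ring, rfl⟩)
  ⟨w.deg + t.verts, ⟨⟨_, homDeg_le V X Y _ hm⟩, hm⟩⟩

variable {V}

/-- An element of degree `d` is a finite sum over trees of tensors of one degree, each a combination
of decomposable ones. The last clause is phrased as an equality of arrows to avoid transporting
along `w.deg + t.verts = d`; the induction itself runs on the underlying finitely supported
functions. -/
theorem gr_induction {X Y : S} {d : ℤ} {P : (quiver V).gr X Y d → Prop} (zero : P 0)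
    (add : ∀ x y, P x → P y → P (x + y)) (smul : ∀ (c : k) x, P x → P (c • x))
    (pure : ∀ (t : PTree) (w : Str V X Y) (h : w.length = t.leaves) (x : (quiver V).gr X Y d),
      (⟨d, x⟩ : Arrow (quiver V) X Y) = pureElem V t w h → P x) (x : (quiver V).gr X Y d) : P x := by
  let N : Submodule k ((quiver V).gr X Y d) :=
    { carrier := {x | P x}
      zero_mem' := zero
      add_mem' := fun {a b} ha hb => add a b ha hb
      smul_mem' := fun c {a} ha => smul c a ha }
  let ι : (quiver V).gr X Y d →ₗ[k] (PTree →₀ T V X Y) :=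
    (Hom V X Y).subtype.comp ((gr V X Y d).subtype)
  have hι : Function.Injective ι := fun a b h => Subtype.ext (Subtype.ext h)
  suffices h : ι x ∈ N.map ι by
    obtain ⟨y, hy, hyx⟩ := h
    rw [← hι hyx]; exact hy
  have hx : ∀ t, ι x t ∈ T.part X Y t.leaves (d - t.verts) := x.2
  rw [← Finsupp.sum_single (ι x)]
  refine Submodule.sum_mem _ fun t _ => ?_
  have ht := hx t
  generalize ι x t = a at ht
  unfold T.part at ht
  induction ht using Submodule.span_induction with
  | mem a ha =>
    obtain ⟨w, hw, hd, rfl⟩ := ha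
    obtain rfl : w.deg + t.verts = d := by rw [hd]; ring
    exact ⟨_, pure t w hw _ rfl, rfl⟩
  | zero => simp
  | add a b _ _ ha hb => rw [Finsupp.single_add]; exact Submodule.add_mem _ ha hb
  | smul c a _ ha => rw [← Finsupp.smul_single]; exact Submodule.smul_mem _ _ ha

/-- The letter is a decomposable tensor in a single summand. -/
def IsPure {X Y : S} (x : Arrow (quiver V) X Y) : Prop :=
  ∃ t w h, x = pureElem V t w h

/-- Letters are replaced from left to right: the prefix `l` is already decomposable, and each
treated letter is appended to it. -/
theorem multilinear_ext {X Y : S} {M : Type w} [AddCommGroup M] [Module k M]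
    {f g : Str (quiver V) X Y → M} (hf : IsMultilinear f) (hg : IsMultilinear g)
    (h : ∀ s : Str (quiver V) X Y, s.All IsPure → f s = g s) (s : Str (quiver V) X Y) : f s = g s := by
  suffices H : ∀ {Z : S} (r : Str (quiver V) Z Y) (l : Str (quiver V) X Z), l.All IsPure →
      f (l.append r) = g (l.append r) from H s (.nil X) trivial
  clear s
  intro Z r
  induction r with
  | nil => intro l hl; rw [Str.append_nil]; exact h l hl
  | cons x r ih =>
    intro l hl
    obtain ⟨d, x⟩ := x
    induction x using gr_induction with
    | zero => rw [hf.zero, hg.zero]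
    | add x y hx hy => rw [hf.add, hg.add, hx, hy]
    | smul c x hx => rw [hf.smul, hg.smul, hx]
    | pure t w hw x hx =>
      rw [hx]
      have := ih hf hg h (l.append (Str.single (pureElem V t w hw))) (by
        rw [Str.all_append]
        exact ⟨hl, ⟨t, w, hw, rfl⟩, trivial⟩)
      rw [Str.append_assoc] at this
      exact this

open Classical in
/-- The index of the summand which contains a decomposable letter. -/
def treeOf {X Y : S} (x : Arrow (quiver V) X Y) : PTree :=
  if h : IsPure x then h.choose else .leaf

theorem IsPure.exists_eq {X Y : S} {x : Arrow (quiver V) X Y} (h : IsPure x) :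
    ∃ w h, x = pureElem V (treeOf x) w h := by
  have := h.choose_spec
  rwa [← show treeOf x = h.choose from dif_pos h] at this

theorem IsPure.eq_single {X Y : S} {x : Arrow (quiver V) X Y} (h : IsPure x) :
    x.2.1.1 = Finsupp.single (treeOf x) (x.2.1.1 (treeOf x)) := by
  obtain ⟨w, hw, hx⟩ := h.exists_eq
  generalize treeOf x = t at *
  subst hx
  simp [pureElem]

/-- The indices of the summands which contain the letters. -/
def trees : ∀ {X Y : S}, Str (quiver V) X Y → List PTree
  | _, _, .nil _ => []
  | _, _, .cons x s => treeOf x :: trees s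

theorem length_trees : ∀ {X Y : S} (s : Str (quiver V) X Y), (trees s).length = s.length
  | _, _, .nil _ => rfl
  | _, _, .cons x s => by simp [trees, Str.length, length_trees s]

/-- The tensor underlying a product of decomposable letters. -/
def tens {X Y : S} (s : Str (quiver V) X Y) : T V X Y := forestProd V s (trees s)

/-- Decomposable letters each live on one tree, so their product lives on one forest and is
described by the single tensor `tens s`. -/
theorem forestProd_eq_single : ∀ {X Y : S} {s : Str (quiver V) X Y}, s.All IsPure →
    forestProd V s = Finsupp.single (trees s) (tens s)
  | _, _, .nil _, _ => by simp [tens, trees, forestProd]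
  | _, _, .cons x s, h => by
      have h1 := h.1.eq_single
      have h2 := forestProd_eq_single h.2
      rw [tens, forestProd, h1, h2, consForest_single_single]
      simp [trees]

theorem tens_cons {X Y Z : S} {x : Arrow (quiver V) X Y} {s : Str (quiver V) Y Z}
    (hx : IsPure x) (hs : s.All IsPure) : tens (.cons x s) =
      sgn k ((treeOf x).verts * s.deg) • T.mul (x.2.1.1 (treeOf x)) (tens s) := by
  have h1 := hx.eq_single
  have h2 := forestProd_eq_single hs
  rw [tens, forestProd, h1, h2, consForest_single_single]
  simp [trees]

theorem tens_mem {X Y : S} (s : Str (quiver V) X Y) :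
    tens s ∈ T.part X Y (PTree.leavesL (trees s)) (s.deg - PTree.vertsL (trees s)) :=
  (forestProd_mem V s (trees s)).1

theorem tens_append {X Y Z : S} {s : Str (quiver V) X Y} {t : Str (quiver V) Y Z}
    (hs : s.All IsPure) (ht : t.All IsPure) : tens (s.append t) =
      sgn k (PTree.vertsL (trees s) * t.deg) • T.mul (tens s) (tens t) := by
  induction s with
  | nil => simp [tens, trees, forestProd, PTree.vertsL, T.nil_mul]
  | cons x s ih =>
    rw [Str.append, tens_cons hs.1 ((Str.all_append _ _).2 ⟨hs.2, ht⟩), ih hs.2 ht,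
      tens_cons hs.1 hs.2, map_smul, smul_smul, map_smul, LinearMap.smul_apply, smul_smul,
      ← T.mul_assoc, ← sgn_add, ← sgn_add, Str.deg_append, trees, PTree.vertsL]
    congr 2
    push_cast
    ring

/-- The product of a string with one letter in a single summand. -/
theorem forestProd_append_cons {X Y Z W : S} {l : Str (quiver V) X Y} {r : Str (quiver V) Z W}
    (hl : l.All IsPure) (hr : r.All IsPure) (y : Arrow (quiver V) Y Z) {t : PTree} {a : T V Y Z}
    (hy : y.2.1.1 = Finsupp.single t a) :
    forestProd V (l.append (.cons y r)) = Finsupp.single (trees l ++ t :: trees r)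
      (sgn k (PTree.vertsL (trees l) * (y.1 + r.deg) + t.verts * r.deg) •
        T.mul (tens l) (T.mul a (tens r))) := by
  induction l with
  | nil =>
    rw [Str.nil_append, forestProd, hy, forestProd_eq_single hr, consForest_single_single]
    simp [tens, trees, forestProd, PTree.vertsL, T.nil_mul]
  | cons x l ih =>
    rw [Str.append, forestProd, ih hl.2 y hy, hl.1.eq_single, consForest_single_single,
      tens_cons hl.1 hl.2]
    simp only [trees, List.cons_append, map_smul, LinearMap.smul_apply, smul_smul, ← sgn_add,
      T.mul_assoc, PTree.vertsL, Str.deg_append, Str.deg]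
    congr 3
    push_cast
    ring

end Pure

/-! ### The relation for the operations of the free category -/

section Relation

variable {S : Type u} (Q : DGQuiver.{uk, u, v} k S)

/-- The linear part of the codifferential, on tensors indexed by forests. -/
def forestB₁ (X Y : S) :
    (List PTree →₀ T Q.toGrQuiver X Y) →ₗ[k] (List PTree →₀ T Q.toGrQuiver X Y) :=
  Finsupp.lsum k fun F =>
    sgn k (PTree.vertsL F) • (Finsupp.lsingle F).comp (T.diff Q X Y) +
    ((PTree.expansionsL F).map fun p => sgn k (1 + p.2) • Finsupp.lsingle p.1).sum

theorem list_sum_linearMap_apply {M N ι : Type*} [AddCommGroup M] [Module k M] [AddCommGroup N]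
    [Module k N] (l : List ι) (f : ι → M →ₗ[k] N) (x : M) :
    (l.map f).sum x = (l.map fun i => f i x).sum := by
  induction l with
  | nil => simp
  | cons i l ih => simp [ih]

theorem b₁_single {X Y : S} (t : PTree) (a : T Q.toGrQuiver X Y) :
    b₁ Q X Y (Finsupp.single t a) = sgn k t.verts • Finsupp.single t (T.diff Q X Y a) +
      (t.expansions.map fun p => sgn k (1 + p.2) • Finsupp.single p.1 a).sum := by
  simp [b₁, list_sum_linearMap_apply]

theorem forestB₁_single {X Y : S} (F : List PTree) (a : T Q.toGrQuiver X Y) :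
    forestB₁ Q X Y (Finsupp.single F a) =
      sgn k (PTree.vertsL F) • Finsupp.single F (T.diff Q X Y a) +
      ((PTree.expansionsL F).map fun p => sgn k (1 + p.2) • Finsupp.single p.1 a).sum := by
  simp [forestB₁, list_sum_linearMap_apply]

/-- Leibniz rule for the linear part. Acting on the first tree crosses a tail of degree `n`. Acting
on the tail raises its degree to `n + 1`, and the resulting extra sign `(-1)^{|t|}` matches the
shift by `t.verts` of the vertex numbers in `expansionsL`. -/
theorem forestB₁_consForest {X Y Z : S} {n : ℤ} (t : PTree) (a : T Q.toGrQuiver X Y)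
    (F : List PTree) {c : T Q.toGrQuiver Y Z}
    (hc : c ∈ T.part Y Z (PTree.leavesL F) (n - PTree.vertsL F)) :
    forestB₁ Q X Z (consForest Q.toGrQuiver n (Finsupp.single t a) (Finsupp.single F c)) =
      sgn k n • consForest Q.toGrQuiver n (b₁ Q X Y (Finsupp.single t a)) (Finsupp.single F c) +
      consForest Q.toGrQuiver (n + 1) (Finsupp.single t a) (forestB₁ Q Y Z (Finsupp.single F c)) := by
  have hA : ∀ l : List (PTree × ℕ), consForest Q.toGrQuiver n
      (l.map fun p => sgn k (1 + p.2) • Finsupp.single p.1 a).sum (Finsupp.single F c) =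
      (l.map fun p => sgn k (1 + p.2) • Finsupp.single (p.1 :: F)
        (sgn k (p.1.verts * n) • T.mul a c)).sum := by
    intro l
    induction l with
    | nil => simp
    | cons p l ih =>
      simp only [List.map_cons, List.sum_cons, map_add, LinearMap.add_apply, ih, map_smul,
        LinearMap.smul_apply, consForest_single_single]
  have hB : ∀ l : List (List PTree × ℕ), consForest Q.toGrQuiver (n + 1) (Finsupp.single t a)
      (l.map fun p => sgn k (1 + p.2) • Finsupp.single p.1 c).sum =
      (l.map fun p => sgn k (1 + p.2) • Finsupp.single (t :: p.1)
        (sgn k (t.verts * (n + 1)) • T.mul a c)).sum := by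
    intro l
    induction l with
    | nil => simp
    | cons p l ih =>
      simp only [List.map_cons, List.sum_cons, map_add, ih, map_smul,
        consForest_single_single]
  rw [consForest_single_single, forestB₁_single, b₁_single, forestB₁_single, map_add, map_add,
    LinearMap.add_apply, hA, hB, map_smul, T.diff_mul Q a hc, map_smul, LinearMap.smul_apply,
    map_smul, consForest_single_single, consForest_single_single, PTree.expansionsL, List.map_append,
    List.sum_append, List.map_map, List.map_map, smul_add (sgn k n), List.smul_sum, List.map_map]
  have h1 : (t.expansions.map ((fun p : List PTree × ℕ => sgn k (1 + p.2) • Finsupp.single p.1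
        (sgn k (t.verts * n) • T.mul a c)) ∘ fun p => (p.1 :: F, p.2))) =
      t.expansions.map ((fun x => sgn k n • x) ∘ fun p => sgn k (1 + p.2) •
        Finsupp.single (p.1 :: F) (sgn k (p.1.verts * n) • T.mul a c)) := by
    refine List.map_congr_left fun p hp => ?_
    simp only [Function.comp_apply, Finsupp.smul_single, smul_smul, ← sgn_add,
      (PTree.expansions_spec t p hp).2]
    congr 2
    refine sgn_eq_of_eq_add_two_mul (-n) ?_
    push_cast; ring
  have h2 : ((PTree.expansionsL F).map ((fun p : List PTree × ℕ => sgn k (1 + p.2) •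
        Finsupp.single p.1 (sgn k (t.verts * n) • T.mul a c)) ∘ fun p => (t :: p.1, t.verts + p.2))) =
      (PTree.expansionsL F).map fun p => sgn k (1 + p.2) • Finsupp.single (t :: p.1)
        (sgn k (t.verts * (n + 1)) • T.mul a c) := by
    refine List.map_congr_left fun p hp => ?_
    simp only [Function.comp_apply, Finsupp.smul_single, smul_smul, ← sgn_add]
    congr 3
    push_cast; ring
  have h3 : sgn k (PTree.vertsL (t :: F)) • Finsupp.single (t :: F) (sgn k (t.verts * n) •
      (sgn k (n - PTree.vertsL F) • T.mul (T.diff Q X Y a) c + T.mul a (T.diff Q Y Z c))) =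
      sgn k n • sgn k t.verts • Finsupp.single (t :: F)
        (sgn k (t.verts * n) • T.mul (T.diff Q X Y a) c) +
      sgn k (PTree.vertsL F) • Finsupp.single (t :: F)
        (sgn k (t.verts * (n + 1)) • T.mul a (T.diff Q Y Z c)) := by
    simp only [Finsupp.smul_single, smul_add, Finsupp.single_add, smul_smul, ← sgn_add, PTree.vertsL]
    congr 4
    · push_cast; ring
    · push_cast; ring
  rw [h1, h2, h3]
  abel

/-- Applying `b₁` to one letter at a time is the linear part of the codifferential; peeling off
letters reduces this to the Leibniz rule `forestB₁_consForest`. -/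
theorem sumLetters_forestProd {X Y : S} {s : Str (quiver Q.toGrQuiver) X Y} (hs : s.All IsPure) :
    (s.sumLetters fun _ _ l x r => sgn k r.deg •
      forestProd Q.toGrQuiver (l.append (.cons ((free Q).bArr (.single x)) r))) =
      forestB₁ Q X Y (forestProd Q.toGrQuiver s) := by
  induction s with
  | nil => simp [Str.sumLetters, forestProd, forestB₁_single, PTree.expansionsL, T.diff, dStr]
  | cons x s ih =>
    rw [Str.sumLetters, forestProd, hs.1.eq_single, forestProd_eq_single hs.2,
      forestB₁_consForest Q _ _ _ (tens_mem s), ← hs.1.eq_single, ← forestProd_eq_single hs.2,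
      ← ih hs.2, LinearMap.map_sumLetters]
    congr 1
    refine Str.sumLetters_congr fun Z W l y r h => ?_
    have hd : (l.append (.cons ((free Q).bArr (.single y)) r)).deg = s.deg + 1 := by
      rw [← h]
      simp only [Str.deg_append, Str.deg, OpQuiver.bArr, Str.single]
      ring
    rw [Str.append, forestProd, hd, map_smul]

end Relation

end Free

/-- A new edge is adjacent to the root, and then comes from grouping some consecutive subtrees, or
it lies within a subtree. The root has number one, so numbers in the forest shift by one. A grouping
vertex follows the root and the vertices of the preceding trees, whence the shift by two. -/
theorem PTree.expansions_graft : ∀ F : List PTree, 2 ≤ F.length → expansions (graft F) =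
    ((groupings F).map fun p => (graft p.1, p.2 + 2)) ++
      (expansionsL F).map fun p => (graft p.1, 1 + p.2)
  | [], h => by simp at h
  | [_], h => by simp at h
  | t₁ :: t₂ :: ts, _ => by
      simp [graft, expansions, expansionsL, Function.comp_def, add_assoc]

theorem sum_map_range_eq_sum {M : Type*} [AddCommMonoid M] (n : ℕ) (f : ℕ → M) :
    ((List.range n).map f).sum = ∑ i ∈ Finset.range n, f i := by
  induction n with
  | zero => simp
  | succ n ih => rw [List.range_succ, Finset.sum_range_succ, List.map_append, List.sum_append, ih]; simp

theorem PTree.sum_map_groupings {M : Type*} [AddCommMonoid M] (F : List PTree)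
    (f : List PTree × ℕ → M) : ((groupings F).map f).sum =
      ∑ i ∈ Finset.range (F.length + 1), ∑ j ∈ Finset.range (F.length + 1),
        if i + 2 ≤ j ∧ j - i < F.length then
          f (F.take i ++ graft ((F.take j).drop i) :: F.drop j, vertsL (F.take i)) else 0 := by
  have h : ∀ (l : List ℕ) (g : ℕ → List (List PTree × ℕ)), ((l.flatMap g).map f).sum =
      (l.map fun i => ((g i).map f).sum).sum := by
    intro l g
    induction l with
    | nil => simp
    | cons i l ih => simp [ih]
  rw [groupings, h, sum_map_range_eq_sum]
  refine Finset.sum_congr rfl fun i _ => ?_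
  rw [List.map_map, sum_map_filter_eq_sum_map_ite, sum_map_range_eq_sum]
  rfl

namespace Free

section Relation

variable {S : Type u} (Q : DGQuiver.{uk, u, v} k S)

theorem sum2_trees {V : GrQuiver.{uk, u, v} k S} {M : Type w} [AddCommGroup M] {X Y : S}
    (s : Str (quiver V) X Y) (f : List PTree → List PTree → M) :
    (s.sum2 fun _ l r => f (trees l) (trees r)) =
      ∑ i ∈ Finset.range ((trees s).length + 1), f ((trees s).take i) ((trees s).drop i) := by
  induction s generalizing f with
  | nil => simp [trees]
  | cons x s ih =>
    rw [Str.sum2_cons]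
    simp only [trees]
    rw [ih fun A B => f (treeOf x :: A) B, List.length_cons, Finset.sum_range_succ' _ ((trees s).length + 1), add_comm]
    simp only [List.take_succ_cons, List.drop_succ_cons, List.take_zero, List.drop_zero]

/-- Rewrites a sum over cuts as a sum over pairs of positions, to be matched with the indexing of
`groupings`. -/
theorem sum3_trees {V : GrQuiver.{uk, u, v} k S} {M : Type w} [AddCommGroup M] {X Y : S}
    (s : Str (quiver V) X Y) (f : List PTree → List PTree → List PTree → M) :
    (s.sum3 fun _ _ l m r => f (trees l) (trees m) (trees r)) =
      ∑ i ∈ Finset.range ((trees s).length + 1), ∑ j ∈ Finset.range ((trees s).length + 1),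
        if i ≤ j then f ((trees s).take i) (((trees s).take j).drop i) ((trees s).drop j)
        else 0 := by
  unfold Str.sum3
  simp only [fun (Z : S) (l : Str (quiver V) X Z) (t : Str (quiver V) Z Y) =>
    sum2_trees t fun B C => f (trees l) B C]
  rw [sum2_trees s fun A B => ∑ j ∈ Finset.range (B.length + 1), f A (B.take j) (B.drop j)]
  refine Finset.sum_congr rfl fun i hi => ?_
  rw [Finset.mem_range] at hi
  have hI : (Finset.range ((trees s).length + 1)).filter (fun j => i ≤ j) =
      Finset.Ico i ((trees s).length + 1) := by
    ext j; simp [and_comm]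
  rw [← Finset.sum_filter, hI, Finset.sum_Ico_eq_sum_range, List.length_drop]
  rw [show (trees s).length + 1 - i = (trees s).length - i + 1 by omega]
  refine Finset.sum_congr rfl fun j _ => ?_
  rw [List.drop_take, List.drop_drop, Nat.add_sub_cancel_left]

/-- The root adds one internal vertex and shifts all vertex numbers in the subtrees by one; hence
the first minus sign. A new edge at the root has sign `(-1)^{1 + (p.2 + 2)}`, which gives the
second. -/
theorem b₁_graft {X Y : S} {F : List PTree} (hF : 2 ≤ F.length) (a : T Q.toGrQuiver X Y) :
    b₁ Q X Y (Finsupp.single (PTree.graft F) a) =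
      -Finsupp.lmapDomain (T Q.toGrQuiver X Y) k PTree.graft (forestB₁ Q X Y (Finsupp.single F a)) -
      ((PTree.groupings F).map fun p => sgn k p.2 • Finsupp.single (PTree.graft p.1) a).sum := by
  have h1 : ∀ l : List (List PTree × ℕ), (l.map ((fun p : PTree × ℕ => sgn k (1 + p.2) •
      Finsupp.single p.1 a) ∘ fun p => (PTree.graft p.1, p.2 + 2))).sum =
      -(l.map fun p => sgn k p.2 • Finsupp.single (PTree.graft p.1) a).sum := by
    intro l
    induction l with
    | nil => simp
    | cons p l ih =>
      simp only [List.map_cons, List.sum_cons, ih, Function.comp_apply, neg_add]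
      congr 1
      rw [← neg_smul, ← sgn_succ]
      congr 1
      refine sgn_eq_of_eq_add_two_mul 1 ?_
      push_cast; ring
  have h2 : ∀ l : List (List PTree × ℕ), (l.map ((fun p : PTree × ℕ => sgn k (1 + p.2) •
      Finsupp.single p.1 a) ∘ fun p => (PTree.graft p.1, 1 + p.2))).sum =
      -Finsupp.lmapDomain (T Q.toGrQuiver X Y) k PTree.graft
        (l.map fun p => sgn k (1 + p.2) • Finsupp.single p.1 a).sum := by
    intro l
    induction l with
    | nil => simp
    | cons p l ih =>
      simp only [List.map_cons, List.sum_cons, ih, Function.comp_apply, map_add, neg_add, map_smul,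
        Finsupp.lmapDomain_apply, Finsupp.mapDomain_single]
      congr 1
      rw [← neg_smul, ← sgn_succ]
      congr 2
      push_cast; ring
  have hL : Finsupp.lmapDomain (T Q.toGrQuiver X Y) k PTree.graft
      (Finsupp.single F (T.diff Q X Y a)) = Finsupp.single (PTree.graft F) (T.diff Q X Y a) := by
    simp
  rw [b₁_single, forestB₁_single, PTree.expansions_graft F hF, List.map_append, List.sum_append,
    List.map_map, List.map_map, h1, h2, PTree.verts_graft F hF, map_add, map_smul, hL, Nat.cast_add, Nat.cast_one, sgn_succ,
    neg_smul]
  abel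

theorem bArr_val {X Y : S} {m : Str (quiver Q.toGrQuiver) X Y} (hm : m.All IsPure)
    (h : 2 ≤ m.length) : (((free Q).bArr m).2.1.1 : PTree →₀ T Q.toGrQuiver X Y) =
      Finsupp.single (PTree.graft (trees m)) (tens m) := by
  have := preB_eq Q m h
  rw [forestProd_eq_single hm, Finsupp.lmapDomain_apply, Finsupp.mapDomain_single] at this
  exact this

/-- Applying a higher operation in the middle replaces consecutive trees by their graft and leaves
the underlying tensor unchanged, up to the sign given by the vertices to the left. This is the sign
attached to a grouping in `b₁_graft`. -/
theorem forestProd_bArr {X Y Z W : S} {l : Str (quiver Q.toGrQuiver) X Y}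
    {m : Str (quiver Q.toGrQuiver) Y Z} {r : Str (quiver Q.toGrQuiver) Z W}
    (hl : l.All IsPure) (hm : m.All IsPure) (hr : r.All IsPure) (h : 2 ≤ m.length) :
    sgn k r.deg • forestProd Q.toGrQuiver (l.append (.cons ((free Q).bArr m) r)) =
      sgn k (PTree.vertsL (trees l)) • Finsupp.single
        (trees l ++ PTree.graft (trees m) :: trees r) (tens (l.append (m.append r))) := by
  rw [forestProd_append_cons hl hr _ (bArr_val Q hm h),
    tens_append hl ((Str.all_append _ _).2 ⟨hm, hr⟩), tens_append hm hr,
    PTree.verts_graft _ (by rwa [length_trees]),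
    show ((free Q).bArr m).1 = m.deg + 1 from rfl]
  simp only [Finsupp.smul_single, map_smul, smul_smul, ← sgn_add]
  congr 2
  refine sgn_eq_of_eq_add_two_mul r.deg ?_
  simp only [Str.deg_append]
  push_cast
  ring

/-- Changing a letter preserves the length, so truncation by length preserves multilinearity.
Identities valid only for strings of length at least two thereby come within reach of
`multilinear_ext`. -/
theorem _root_.AInf.IsMultilinear.ite_length {V : GrQuiver.{uk, u, v} k S} {M : Type w}
    [AddCommGroup M] [Module k M] {X Y : S} {f : Str V X Y → M} (p : ℕ → Prop) [DecidablePred p]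
    (add : ∀ {Z W : S} (s : Str V X Z) (t : Str V W Y) (d : ℤ) (x y : V.gr Z W d),
      p (s.length + (t.length + 1)) → f (s.append (.cons ⟨d, x + y⟩ t)) =
        f (s.append (.cons ⟨d, x⟩ t)) + f (s.append (.cons ⟨d, y⟩ t)))
    (smul : ∀ {Z W : S} (s : Str V X Z) (t : Str V W Y) (d : ℤ) (c : k) (x : V.gr Z W d),
      p (s.length + (t.length + 1)) → f (s.append (.cons ⟨d, c • x⟩ t)) =
        c • f (s.append (.cons ⟨d, x⟩ t))) :
    IsMultilinear fun s => if p s.length then f s else 0 where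
  add s t d x y := by
    simp only [Str.length_append, Str.length]
    split_ifs with h
    · exact add s t d x y h
    · simp
  smul s t d c x := by
    simp only [Str.length_append, Str.length]
    split_ifs with h
    · exact smul s t d c x h
    · simp

/-- For a string of length at least two the middle piece is empty, a single letter, the whole
string, or strictly in between. The empty case vanishes, and the other three are exclusive and give
the three summands. -/
theorem smul_preB_eq_add {X Y Z W : S} {l : Str (quiver Q.toGrQuiver) X Z}
    (m : Str (quiver Q.toGrQuiver) Z W) {r : Str (quiver Q.toGrQuiver) W Y}
    (y : Arrow (quiver Q.toGrQuiver) Z W) {a : T Q.toGrQuiver X Y}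
    (hs : 2 ≤ l.length + (m.length + r.length))
    (h0 : m.length = 0 → preB Q (l.append (.cons y r)) = 0)
    (h2 : 2 ≤ m.length → sgn k r.deg • forestProd Q.toGrQuiver (l.append (.cons y r)) =
      sgn k (PTree.vertsL (trees l)) •
        Finsupp.single (trees l ++ PTree.graft (trees m) :: trees r) a) :
    sgn k r.deg • preB Q (l.append (.cons y r)) =
      (if m.length = 1 then Finsupp.lmapDomain (T Q.toGrQuiver X Y) k PTree.graft
        (sgn k r.deg • forestProd Q.toGrQuiver (l.append (.cons y r))) else 0) +
      (if l.length + r.length = 0 then sgn k r.deg • preB Q (l.append (.cons y r)) else 0) +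
      if 2 ≤ (trees m).length ∧ 0 < (trees l).length + (trees r).length then
        sgn k (PTree.vertsL (trees l)) •
          Finsupp.single (PTree.graft (trees l ++ PTree.graft (trees m) :: trees r)) a else 0 := by
  have hlen : (l.append (.cons y r)).length = l.length + (r.length + 1) := by
    rw [Str.length_append, Str.length]
  simp only [length_trees]
  rcases Nat.lt_or_ge m.length 2 with hm | hm
  · rw [if_neg (show ¬(l.length + r.length = 0) by omega),
      if_neg (show ¬(2 ≤ m.length ∧ 0 < l.length + r.length) by omega), add_zero, add_zero]
    split_ifs with h1
    · rw [map_smul, preB_eq Q _ (by omega)]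
    · rw [h0 (by omega), smul_zero]
  · rw [if_neg (show ¬(m.length = 1) by omega), zero_add]
    by_cases h3 : l.length + r.length = 0
    · rw [if_pos h3, if_neg (by omega), add_zero]
    · rw [if_neg h3, if_pos (by omega), preB_eq Q _ (by omega), ← map_smul, h2 hm,
        map_smul, Finsupp.lmapDomain_apply, Finsupp.mapDomain_single, zero_add]

/-- Three kinds of terms occur: `b₁` on a letter followed by `bₖ`, `bₖ` followed by `b₁`, and
composites of two higher operations. By `b₁_graft` the second kind is minus the sum of the others,
the composites of higher operations corresponding to new edges at the root. -/
theorem pre_preB_of_all_isPure {X Y : S} {s : Str (quiver Q.toGrQuiver) X Y}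
    (hs : 2 ≤ s.length) (hp : s.All IsPure) : (free Q).pre (preB Q) s = 0 := by
  let G := Finsupp.lmapDomain (T Q.toGrQuiver X Y) k PTree.graft
  let f : List PTree → List PTree → List PTree → (PTree →₀ T Q.toGrQuiver X Y) := fun A B C =>
    if 2 ≤ B.length ∧ 0 < A.length + C.length then
      sgn k (PTree.vertsL A) • Finsupp.single (PTree.graft (A ++ PTree.graft B :: C)) (tens s) else 0
  have h1 : (free Q).pre (preB Q) s =
      (s.sum3 fun _ _ l m r => if m.length = 1 then G (sgn k r.deg •
        forestProd Q.toGrQuiver (l.append (.cons ((free Q).bArr m) r))) else 0) +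
      (s.sum3 fun _ _ l m r => if l.length + r.length = 0 then
        sgn k r.deg • preB Q (l.append (.cons ((free Q).bArr m) r)) else 0) +
      s.sum3 fun _ _ l m r => f (trees l) (trees m) (trees r) := by
    rw [← Str.sum3_add, ← Str.sum3_add]
    refine Str.sum3_congr fun Z W l m r h => ?_
    have hall := (Str.all_append (V := quiver Q.toGrQuiver) l (m.append r)).1 (h ▸ hp)
    have hall' := (Str.all_append (V := quiver Q.toGrQuiver) m r).1 hall.2
    have hlen : l.length + (m.length + r.length) = s.length :=
      (congrArg (l.length + ·) (Str.length_append m r).symm).trans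
        ((Str.length_append l (m.append r)).symm.trans (congrArg Str.length h))
    refine smul_preB_eq_add Q m ((free Q).bArr m) (hlen ▸ hs) (fun h0 => ?_) (fun h2 => ?_)
    · cases m with
      | nil => exact OpQuiver.bArr_nil_append (A := free Q) (preB_multilinear Q X Y) l r
      | cons x m => exact absurd h0 (Nat.succ_ne_zero _)
    · exact (forestProd_bArr Q hall.1 hall'.1 hall'.2 h2).trans
        (congrArg (fun u => sgn k (PTree.vertsL (trees l)) • Finsupp.single
          (trees l ++ PTree.graft (trees m) :: trees r) (tens u)) h)
  have h2 : (s.sum3 fun _ _ l m r => if m.length = 1 then G (sgn k r.deg •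
      forestProd Q.toGrQuiver (l.append (.cons ((free Q).bArr m) r))) else 0) =
      G (forestB₁ Q X Y (Finsupp.single (trees s) (tens s))) := by
    rw [Str.sum3_mid_single s fun _ _ l m r => G (sgn k r.deg •
      forestProd Q.toGrQuiver (l.append (.cons ((free Q).bArr m) r))),
      ← LinearMap.map_sumLetters]
    exact congrArg G ((sumLetters_forestProd Q hp).trans (by rw [forestProd_eq_single hp]))
  have h3 : (s.sum3 fun _ _ l m r => if l.length + r.length = 0 then
      sgn k r.deg • preB Q (l.append (.cons ((free Q).bArr m) r)) else 0) =
      b₁ Q X Y (Finsupp.single (PTree.graft (trees s)) (tens s)) := by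
    rw [Str.sum3_outer_nil s fun _ _ l m r =>
      sgn k r.deg • preB Q (l.append (.cons ((free Q).bArr m) r)), Str.deg, sgn_zero, one_smul,
      ← bArr_val Q hp hs]
    rfl
  have h4 : (s.sum3 fun _ _ l m r => f (trees l) (trees m) (trees r)) =
      ((PTree.groupings (trees s)).map fun p =>
        sgn k p.2 • Finsupp.single (PTree.graft p.1) (tens s)).sum := by
    rw [sum3_trees s f, PTree.sum_map_groupings]
    refine Finset.sum_congr rfl fun i hi => Finset.sum_congr rfl fun j hj => ?_
    simp only [Finset.mem_range] at hi hj
    simp only [f, List.length_drop, List.length_take, ← ite_and]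
    -- A middle piece of at least two letters that is not the whole string is the same as `i + 2 ≤
    -- j` together with `j - i < length`.
    refine if_congr ?_ rfl rfl
    omega
  rw [h1, h2, h3, h4, b₁_graft Q (by rwa [length_trees])]
  abel

/-- The defining relation of an `A_∞`-category holds in `𝓕𝒬` on strings of length at least two. -/
theorem pre_preB_of_two_le {X Y : S} {s : Str (quiver Q.toGrQuiver) X Y} (hs : 2 ≤ s.length) :
    (free Q).pre (preB Q) s = 0 := by
  have hm : IsMultilinear ((free Q).pre (preB Q (X := X) (Y := Y))) :=
    OpQuiver.pre_multilinear (A := free Q) (preB_multilinear Q X Y)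
  have h := multilinear_ext (V := Q.toGrQuiver)
    (IsMultilinear.ite_length (f := (free Q).pre (preB Q (X := X) (Y := Y))) (fun n => 2 ≤ n)
      (fun s t d x y _ => hm.add s t d x y) fun s t d c x _ => hm.smul s t d c x)
    (g := fun _ => (0 : PTree →₀ T Q.toGrQuiver X Y)) ⟨by simp, by simp⟩ (fun t ht => by
      split_ifs with hl
      · exact pre_preB_of_all_isPure Q hl ht
      · rfl) s
  exact (if_pos hs).symm.trans h

end Relation

end Free

theorem pre_free_b_of_two_le {S : Type u} (Q : DGQuiver.{uk, u, v} k S) {X Y : S}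
    {s : Str (free Q).toGrQuiver X Y} (hs : 2 ≤ s.length) : (free Q).pre (free Q).b s = 0 := by
  apply Subtype.ext
  exact ((Free.Hom Q.toGrQuiver X Y).subtype.map_pre (A := free Q) (free Q).b s).trans
    (Free.pre_preB_of_two_le Q hs)

-- Generation of s𝓕𝒬 by s𝒬.

theorem Str.All.mono {S : Type u} {V : GrQuiver.{uk, u, v} k S}
    {P R : ∀ {X Y : S}, Arrow V X Y → Prop} (h : ∀ {X Y : S} (x : Arrow V X Y), P x → R x) :
    ∀ {X Y : S} {s : Str V X Y}, s.All P → s.All R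
  | _, _, .nil _, _ => trivial
  | _, _, .cons x _, hs => ⟨h x hs.1, hs.2.mono h⟩

theorem Str.All.of_forall {S : Type u} {V : GrQuiver.{uk, u, v} k S}
    {P : ∀ {X Y : S}, Arrow V X Y → Prop} (h : ∀ {X Y : S} (x : Arrow V X Y), P x) :
    ∀ {X Y : S} (s : Str V X Y), s.All P
  | _, _, .nil _ => trivial
  | _, _, .cons x s => ⟨h x, .of_forall h s⟩

namespace Free

variable {S : Type u}

/-- A tensor in the summand indexed by a forest is, up to sign, a product of decomposable letters
indexed by its trees. -/
theorem exists_forestProd_eq {V : GrQuiver.{uk, u, v} k S} : ∀ (F : List PTree) {X Y : S} (w : Str V X Y),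
    w.length = PTree.leavesL F → ∃ s : Str (quiver V) X Y, s.length = F.length ∧
      s.deg = w.deg + PTree.vertsL F ∧
      (∃ e, forestProd V s = Finsupp.single F (sgn k e • T.tprod w)) ∧
      s.All fun x => ∃ t ∈ F, ∃ w h, x = pureElem V t w h
  | [], X, Y, w, hw => by
      cases w with
      | nil => exact ⟨.nil X, rfl, by simp [Str.deg, PTree.vertsL], ⟨0, by simp [forestProd]⟩, trivial⟩
      | cons x w => simp [Str.length, PTree.leavesL] at hw
  | t :: F, X, Y, w, hw => by
      obtain ⟨Z, a, b, rfl, ha, hb⟩ := w.exists_append_of_length t.leaves (PTree.leavesL F) hw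
      obtain ⟨s, hs, hd, ⟨e, he⟩, hall⟩ := exists_forestProd_eq F b hb
      refine ⟨.cons (pureElem V t a ha) s, by simp [Str.length, hs], ?_, ⟨t.verts * s.deg + e, ?_⟩,
        ⟨t, List.mem_cons_self, a, ha, rfl⟩,
        hall.mono fun x ⟨t', ht', h⟩ => ⟨t', List.mem_cons_of_mem _ ht', h⟩⟩
      · simp only [Str.deg, hd, Str.deg_append, PTree.vertsL, pureElem]
        push_cast; ring
      · rw [forestProd, he]
        change consForest V s.deg (Finsupp.single t (T.tprod a)) _ = _
        rw [consForest_single_single, map_smul, T.mul_tprod, smul_smul, sgn_add]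

/-- A decomposable tensor on a tree with a root vertex is, up to sign, the value of an operation on
decomposable tensors on the subtrees. The clause `smul` serves to remove that sign. -/
theorem pureElem_induction (Q : DGQuiver.{uk, u, v} k S)
    {P : ∀ {X Y : S}, Arrow (free Q).toGrQuiver X Y → Prop}
    (smul : ∀ {X Y : S} (d : ℤ) (c : k) (x : (free Q).gr X Y d), P ⟨d, x⟩ → P ⟨d, c • x⟩)
    (incl : ∀ {X Y : S} (x : Arrow Q.toGrQuiver X Y), P (incl Q x))
    (b : ∀ {X Y : S} (s : Str (free Q).toGrQuiver X Y), 2 ≤ s.length → s.All P → P ((free Q).bArr s))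
    (t : PTree) {X Y : S} (w : Str Q.toGrQuiver X Y) (h : w.length = t.leaves) :
    P (pureElem Q.toGrQuiver t w h) := by
  -- `PTree` is nested through `List`, so the induction over subtrees goes through `sizeOf`.
  induction hn : sizeOf t using Nat.strong_induction_on generalizing t X Y with
  | _ n ih =>
  subst hn
  match t, h with
  | .leaf, h =>
    match w, h with
    | .nil _, h => simp [Str.length, PTree.leaves] at h
    | .cons _ (.cons _ _), h => simp [Str.length, PTree.leaves] at h
    | .cons x (.nil _), h =>
      have := incl x
      rwa [show AInf.incl Q x = pureElem Q.toGrQuiver .leaf (.cons x (.nil _)) h from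
        Arrow.ext (by simp [AInf.incl, pureElem, Str.deg, PTree.verts]) rfl] at this
  | .node t₁ t₂ ts, h =>
    obtain ⟨s, hs, hd, ⟨e, he⟩, hall⟩ := exists_forestProd_eq (t₁ :: t₂ :: ts) w
      (by rw [h]; simp [PTree.leaves, PTree.leavesL])
    have h2 : 2 ≤ s.length := by rw [hs]; simp
    have hb := smul _ (sgn k e) _ (b s h2 (hall.mono fun x hx => by
      obtain ⟨t, ht, w', h', rfl⟩ := hx
      have : sizeOf t < sizeOf (PTree.node t₁ t₂ ts) := by
        rw [PTree.node.sizeOf_spec]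
        rcases List.mem_cons.1 ht with rfl | ht
        · omega
        rcases List.mem_cons.1 ht with rfl | ht
        · omega
        · have := List.sizeOf_lt_of_mem ht
          omega
      exact ih _ this t w' h' rfl))
    have hval : (((free Q).bArr s).2.1.1 : PTree →₀ T Q.toGrQuiver X Y) =
        Finsupp.single (.node t₁ t₂ ts) (sgn k e • T.tprod w) := by
      have := preB_eq Q s h2
      rw [he, Finsupp.lmapDomain_apply, Finsupp.mapDomain_single] at this
      exact this
    have heq : (⟨_, sgn k e • ((free Q).bArr s).2⟩ : Arrow (free Q).toGrQuiver X Y) =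
        pureElem Q.toGrQuiver (.node t₁ t₂ ts) w h := by
      refine Arrow.ext ?_ (Subtype.ext ?_)
      · change s.deg + 1 = w.deg + (PTree.node t₁ t₂ ts).verts
        rw [hd]
        simp only [PTree.vertsL, PTree.verts]
        push_cast; ring
      · change sgn k e • (((free Q).bArr s).2.1.1 : PTree →₀ T Q.toGrQuiver X Y) =
          Finsupp.single (.node t₁ t₂ ts) (T.tprod w)
        rw [hval, ← Finsupp.smul_single, sgn_smul_sgn_smul]
    exact heq ▸ hb

end Free

/-- The arrows of `s𝓕𝒬` are generated by `s𝒬` under the operations `bₙ`, `n ≥ 2`. -/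
theorem free_induction {S : Type u} (Q : DGQuiver.{uk, u, v} k S)
    {P : ∀ {X Y : S}, Arrow (free Q).toGrQuiver X Y → Prop}
    (zero : ∀ {X Y : S} (d : ℤ), P (⟨d, 0⟩ : Arrow (free Q).toGrQuiver X Y))
    (add : ∀ {X Y : S} (d : ℤ) (x y : (free Q).gr X Y d), P ⟨d, x⟩ → P ⟨d, y⟩ → P ⟨d, x + y⟩)
    (smul : ∀ {X Y : S} (d : ℤ) (c : k) (x : (free Q).gr X Y d), P ⟨d, x⟩ → P ⟨d, c • x⟩)
    (incl : ∀ {X Y : S} (x : Arrow Q.toGrQuiver X Y), P (incl Q x))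
    (b : ∀ {X Y : S} (s : Str (free Q).toGrQuiver X Y), 2 ≤ s.length → s.All P → P ((free Q).bArr s))
    {X Y : S} (x : Arrow (free Q).toGrQuiver X Y) : P x := by
  obtain ⟨d, x⟩ := x
  refine Free.gr_induction (V := Q.toGrQuiver) (P := fun x => P ⟨d, x⟩) (zero d) (add d) (smul d) ?_ x
  intro t w h x hx
  change P (show Arrow (Free.quiver Q.toGrQuiver) X Y from ⟨d, x⟩)
  exact hx ▸ Free.pureElem_induction Q smul incl b t w h

/-- A multilinear function on strings vanishes on strings of length one if it vanishes on the
generators and on the values of `bₙ`, `n ≥ 2`. -/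
theorem free_eq_zero_of_single {S : Type u} (Q : DGQuiver.{uk, u, v} k S) {M : S → S → Type w}
    [∀ X Y, AddCommGroup (M X Y)] [∀ X Y, Module k (M X Y)]
    {f : ∀ X Y, Str (free Q).toGrQuiver X Y → M X Y} (hf : ∀ X Y, IsMultilinear (f X Y))
    (incl : ∀ {X Y : S} (x : Arrow Q.toGrQuiver X Y), f X Y (.single (incl Q x)) = 0)
    (b : ∀ {X Y : S} (s : Str (free Q).toGrQuiver X Y), 2 ≤ s.length →
      s.All (fun {X Y} x => f X Y (.single x) = 0) → f X Y (.single ((free Q).bArr s)) = 0)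
    {X Y : S} (x : Arrow (free Q).toGrQuiver X Y) : f X Y (.single x) = 0 := by
  refine free_induction Q (P := fun {X Y} x => f X Y (.single x) = 0)
    (fun d => (hf _ _).zero (.nil _) (.nil _) d) (fun d x y hx hy => ?_) (fun d c x hx => ?_)
    incl b x
  · refine ((hf _ _).add (.nil _) (.nil _) d x y).trans ?_
    exact (congrArg₂ (· + ·) hx hy).trans (add_zero 0)
  · refine ((hf _ _).smul (.nil _) (.nil _) d c x).trans ?_
    exact (congrArg (c • ·) hx).trans (smul_zero c)

-- The `A_∞`-relations of 𝓕𝒬 in all lengths.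

namespace OpQuiver

variable {S : Type u} {A : OpQuiver.{uk, u, v} k S} {M : Type w} [AddCommGroup M] [Module k M]

theorem pre_nil {X : S} {F : Str A.toGrQuiver X X → M} (hF : IsMultilinear F) :
    A.pre F (.nil X) = 0 := by
  simp only [pre, Str.sum3, Str.sum2_nil, bArr_nil_append hF, smul_zero]

theorem pre_single {X Y : S} {F : Str A.toGrQuiver X Y → M} (hF : IsMultilinear F)
    (x : Arrow A.toGrQuiver X Y) : A.pre F (.single x) = F (.single (A.bArr (.single x))) := by
  simp only [pre, Str.sum3, Str.single, Str.sum2_cons, Str.sum2_nil, bArr_nil_append hF, smul_zero,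
    Str.deg, sgn_zero, one_smul, zero_add, add_zero]
  rfl

/-- An insertion that leaves a single letter must swallow the whole string. -/
theorem pre_eq_of_forall_length_ne_one {X Y : S} {F : Str A.toGrQuiver X Y → M}
    (hF : ∀ t : Str A.toGrQuiver X Y, t.length ≠ 1 → F t = 0)
    (s : Str A.toGrQuiver X Y) : A.pre F s = F (.single (A.bArr s)) := by
  have h := Str.sum3_outer_nil s fun _ _ l m t => sgn k t.deg • F (l.append (.cons (A.bArr m) t))
  rw [Str.deg, sgn_zero, one_smul] at h
  change _ = F (.single (A.bArr s)) at h
  rw [← h]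
  refine Str.sum3_congr fun Z W l m t _ => ?_
  split_ifs with h0
  · rfl
  · rw [hF _ (by rw [Str.length_append, Str.length]; omega), smul_zero]

theorem pre_pre_eq_zero {X Y : S} {F : Str A.toGrQuiver X Y → M} (hF : IsMultilinear F)
    {s : Str A.toGrQuiver X Y} (h : ∀ Z W (l : Str A.toGrQuiver X Z) (m : Str A.toGrQuiver Z W)
      (r : Str A.toGrQuiver W Y), l.append (m.append r) = s → A.pre A.b m = 0) :
    A.pre (A.pre F) s = 0 := by
  rw [pre_pre hF]
  refine Str.sum3_eq_zero fun Z W l m r hs => ?_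
  rw [h Z W l m r hs]
  simp

end OpQuiver

/-- The defining relation of an `A_∞`-category holds in `𝓕𝒬`. -/
theorem pre_free_b {S : Type u} (Q : DGQuiver.{uk, u, v} k S) {X Y : S}
    (s : Str (free Q).toGrQuiver X Y) : (free Q).pre (free Q).b s = 0 := by
  have hm : ∀ X Y, IsMultilinear ((free Q).pre (free Q).b (X := X) (Y := Y)) := fun X Y =>
    OpQuiver.pre_multilinear ((free Q).b_multilinear X Y)
  have hne : ∀ {X Y : S} (t : Str (free Q).toGrQuiver X Y), t.length ≠ 1 →
      (free Q).pre (free Q).b t = 0 := by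
    intro X Y t ht
    match t with
    | .nil X => exact OpQuiver.pre_nil ((free Q).b_multilinear X X)
    | .cons x (.nil _) => exact absurd rfl ht
    | .cons x (.cons y s) => exact pre_free_b_of_two_le Q (by simp [Str.length])
  -- Length one, that is `b₁² = 0`, is deduced from the relations in the other lengths by induction
  -- over the generation of s𝓕𝒬; on generators it is `d² = 0`.
  have h1 : ∀ {X Y : S} (x : Arrow (free Q).toGrQuiver X Y),
      (free Q).pre (free Q).b (.single x) = 0 := by
    intro X Y x
    refine free_eq_zero_of_single Q hm (fun x => ?_) (fun {X Y} s hs h => ?_) x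
    · rename_i X Y
      rw [OpQuiver.pre_single ((free Q).b_multilinear _ _), bArr_incl]
      have h0 : incl Q (Q.dArr (Q.dArr x)) = ⟨x.1 + 1 + 1, 0⟩ := by
        refine Arrow.ext rfl ?_
        have : (Q.dArr (Q.dArr x)).2 = 0 := Subtype.ext (Q.d_d _)
        change ((inclVal Q (Q.dArr (Q.dArr x)).2).1 : (free Q).Hom _ _) = 0
        rw [this]
        have := inclVal_smul (Q := Q) (x.1 + 1 + 1) 0 (0 : Q.gr X Y _)
        rw [zero_smul, zero_smul] at this
        exact congrArg Subtype.val this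
      have h2 := congrArg (fun y : Arrow (free Q).toGrQuiver _ _ => y.2.1) (bArr_incl (Q.dArr x))
      refine h2.trans ?_
      rw [h0]
      rfl
    -- The sum in the relation is zero off length one, so its value at the letter `bArr s` is the
    -- threefold application of `b` to `s`. Grouped the other way, this contains the relation on
    -- pieces of `s`, known by `hne` or by the induction hypothesis on the letters.
    · rw [← OpQuiver.pre_eq_of_forall_length_ne_one hne]
      refine OpQuiver.pre_pre_eq_zero ((free Q).b_multilinear _ _) fun Z W l m r hs' => ?_
      by_cases hl : m.length = 1
      · match m, hl with
        | .cons x (.nil _), _ =>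
          rw [← hs', Str.all_append, Str.all_append] at h
          exact h.2.1.1
        | .cons x (.cons y m), h => simp [Str.length] at h
      · exact hne m hl
  by_cases hl : s.length = 1
  · match s, hl with
    | .cons x (.nil _), _ => exact h1 x
    | .cons x (.cons y m), h => simp [Str.length] at h
  · exact hne s hl

theorem pre_pre_free {S : Type u} (Q : DGQuiver.{uk, u, v} k S) {M : Type w} [AddCommGroup M]
    [Module k M] {X Y : S} {F : Str (free Q).toGrQuiver X Y → M} (hF : IsMultilinear F)
    (s : Str (free Q).toGrQuiver X Y) : (free Q).pre ((free Q).pre F) s = 0 :=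
  OpQuiver.pre_pre_eq_zero hF fun _ _ _ m _ _ => pre_free_b Q m

-- Freeness of s𝓕𝒬 over s𝒬.

namespace Free

section Unforest

variable {S : Type u} {V : GrQuiver.{uk, u, v} k S}

/-- The tensor `x₁ ⊗ ⋯ ⊗ xₙ` in the summand indexed by `t` (zero unless `t` has `n` leaves). -/
def pureVal (t : PTree) {X Y : S} (w : Str V X Y) : (quiver V).Hom X Y :=
  if h : w.length = t.leaves then (pureElem V t w h).2.1 else 0

theorem pureVal_val (t : PTree) {X Y : S} (w : Str V X Y) :
    (Hom V X Y).subtype (pureVal t w) =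
      Finsupp.lsingle (R := k) t (if w.length = t.leaves then T.tprod w else 0) := by
  unfold pureVal
  split_ifs with h
  · rfl
  · rw [map_zero]; rfl

theorem pureVal_multilinear (t : PTree) (X Y : S) :
    IsMultilinear (pureVal (V := V) t (X := X) (Y := Y)) := by
  have h := ((IsMultilinear.ite_length (f := T.tprod (V := V) (X := X) (Y := Y))
    (fun n => n = t.leaves) (fun s r d x y _ => (T.tprod_multilinear X Y).add s r d x y)
    fun s r d c x _ => (T.tprod_multilinear X Y).smul s r d c x).map_linear
      (Finsupp.lsingle (R := k) t))
  simp only [← pureVal_val] at h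
  exact ⟨fun s r d x y => Subtype.ext (h.add s r d x y),
    fun s r d c x => Subtype.ext (h.smul s r d c x)⟩

/-- The inverse of `forestProd` on the summand indexed by a forest. -/
def unforest : List PTree → ∀ {X Y : S}, Str V X Y → T (quiver V) X Y
  | [], _, _, .nil X => T.tprod (.nil X)
  | [], _, _, .cons _ _ => 0
  | t :: F, _, _, w => w.sum2 fun _ l r => sgn k (t.verts * (r.deg + PTree.vertsL F)) •
      T.mul (T.letter (pureVal t l)) (unforest F r)

theorem unforest_multilinear : ∀ (F : List PTree) (X Y : S),
    IsMultilinear (unforest (V := V) F (X := X) (Y := Y))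
  | [], X, Y => by
      have h : ∀ {Z W : S} (s : Str V X Z) (x : Arrow V Z W) (t : Str V W Y),
          unforest [] (s.append (.cons x t)) = 0 := by
        intro Z W s x t
        cases s <;> rfl
      exact ⟨fun s t d x y => by rw [h, h, h, add_zero], fun s t d c x => by rw [h, h, smul_zero]⟩
  | t :: F, X, Y => by
      have ih := unforest_multilinear F
      change IsMultilinear fun w : Str V X Y => w.sum2 _
      refine IsMultilinear.sum2 (fun Z r => ?_) fun Z l => ?_
      · exact (((pureVal_multilinear t X Z).map_linear T.letter).map_linear
          (T.mul.flip (unforest F r))).const_smul _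
      · exact ((ih Z Y).map_linear (T.mul (T.letter (pureVal t l)))).deg_smul
          fun n => sgn k (t.verts * (n + PTree.vertsL F))

/-- `pureVal t` vanishes unless the left piece has as many letters as `t` has leaves, which leaves
only the cut after `a`. The sign in `unforest` equals that in `consForest`, since `n` is the degree
of the tail including its internal vertices. -/
theorem lift_unforest_mul (t : PTree) (F : List PTree) {X Y Z : S} (a : Str V X Y)
    (ha : a.length = t.leaves) {n : ℤ} {m : ℕ} {c : T V Y Z} (hc : c ∈ T.part Y Z m (n - PTree.vertsL F)) :
    T.lift (unforest (t :: F)) (unforest_multilinear _ _ _) (T.mul (T.tprod a) c) =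
      sgn k (t.verts * n) • T.mul (T.letter (pureVal t a))
        (T.lift (unforest F) (unforest_multilinear _ _ _) c) := by
  unfold T.part at hc
  induction hc using Submodule.span_induction with
  | mem c hc =>
    obtain ⟨w, -, hw, rfl⟩ := hc
    rw [T.mul_tprod, T.lift_tprod, T.lift_tprod, unforest, Str.sum2_append_of_length, hw]
    · congr 3; ring
    · intro W l r hl
      rw [pureVal, dif_neg (by rwa [← ha])]
      simp
  | zero => simp
  | add x y _ _ hx hy => simp only [map_add, hx, hy, smul_add]
  | smul c x _ hx => simp only [map_smul, hx]; rw [smul_comm]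

/-- This is the source of freeness: the numbers of leaves prescribe where to cut a tensor on a
forest, so the product of decomposable letters is recovered from its tensor and its list of trees.
Each sign occurs twice and cancels. -/
theorem lift_unforest_tens : ∀ {X Y : S} {s : Str (quiver V) X Y}, s.All IsPure →
    T.lift (unforest (trees s)) (unforest_multilinear _ _ _) (tens s) = T.tprod s
  | _, _, .nil X, _ => by
      simp [trees, tens, forestProd, unforest]
  | _, _, .cons x s, h => by
      obtain ⟨a, ha, hx⟩ := h.1.exists_eq
      have hv : x.2.1.1 (treeOf x) = T.tprod a := by
        have := congrArg (fun y : Arrow (quiver V) _ _ => y.2.1.1 (treeOf x)) hx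
        refine this.trans ?_
        change Finsupp.single (treeOf x) (T.tprod a) (treeOf x) = _
        rw [Finsupp.single_eq_same]
      have hp : pureVal (treeOf x) a = x.2.1 := by
        rw [pureVal, dif_pos ha, ← hx]
      rw [tens_cons h.1 h.2, map_smul, hv, trees, lift_unforest_mul _ _ a ha (tens_mem s),
        sgn_smul_sgn_smul, lift_unforest_tens h.2, hp, T.letter_apply, T.mul_tprod]
      rfl

end Unforest

variable {S : Type u} {Q : DGQuiver.{uk, u, v} k S} {M : Type w} [AddCommGroup M] [Module k M]

/-- Auxiliary to `exists_linearMap_free`: the linear map with prescribed values on the trivial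
tree and on the values of the operations. -/
def extend {X Y : S} {g G} (hg : IsMultilinear (M := M) (V := Q.toGrQuiver) (X := X) (Y := Y) g)
    (hG : IsMultilinear (M := M) (V := quiver Q.toGrQuiver) (X := X) (Y := Y) G) :
    (PTree →₀ T Q.toGrQuiver X Y) →ₗ[k] M :=
  Finsupp.lsum k fun t => match t with
    | .leaf => T.lift g hg
    | .node t₁ t₂ ts => (T.lift G hG).comp
        (T.lift (unforest (t₁ :: t₂ :: ts)) (unforest_multilinear _ _ _))

theorem extend_single_leaf {X Y : S} {g G}
    (hg : IsMultilinear (M := M) (V := Q.toGrQuiver) (X := X) (Y := Y) g)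
    (hG : IsMultilinear (M := M) (V := quiver Q.toGrQuiver) (X := X) (Y := Y) G)
    (s : Str Q.toGrQuiver X Y) : extend hg hG (Finsupp.single .leaf (T.tprod s)) = g s := by
  rw [extend, Finsupp.lsum_single, T.lift_tprod]

/-- A tree with a root vertex is the graft of a unique forest of at least two trees, so no value is
prescribed twice. It suffices to compare on decomposable letters, where `unforest` undoes the
operation. -/
theorem extend_preB {X Y : S} {g G} (hg : IsMultilinear (M := M) (V := Q.toGrQuiver) (X := X) (Y := Y) g)
    (hG : IsMultilinear (M := M) (V := quiver Q.toGrQuiver) (X := X) (Y := Y) G)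
    {s : Str (quiver Q.toGrQuiver) X Y} (hs : 2 ≤ s.length) : extend hg hG (preB Q s) = G s := by
  have hm := (preB_multilinear Q X Y).map_linear (extend hg hG)
  have h := multilinear_ext (IsMultilinear.ite_length (f := fun s => extend hg hG (preB Q s))
      (fun n => 2 ≤ n) (fun s t d x y _ => hm.add s t d x y) fun s t d c x _ => hm.smul s t d c x)
    (IsMultilinear.ite_length (f := G) (fun n => 2 ≤ n) (fun s t d x y _ => hG.add s t d x y)
      fun s t d c x _ => hG.smul s t d c x) (fun s hp => ?_) s
  · simpa only [if_pos hs] using h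
  · split_ifs with h2
    · rw [preB_eq Q s h2, forestProd_eq_single hp, Finsupp.lmapDomain_apply,
        Finsupp.mapDomain_single, extend, Finsupp.lsum_single]
      have h3 := lift_unforest_tens hp
      have h4 : 2 ≤ (trees s).length := by rwa [length_trees]
      revert h3
      generalize tens s = a
      match trees s, h4 with
      | t₁ :: t₂ :: ts, _ =>
        intro h3
        change T.lift G hG (T.lift (unforest (t₁ :: t₂ :: ts)) _ a) = G s
        rw [h3, T.lift_tprod]
    · rfl

end Free

/-- `s𝓕𝒬` is freely generated by `s𝒬` under the operations `bₙ`, `n ≥ 2`. -/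
theorem exists_linearMap_free {S : Type u} {Q : DGQuiver.{uk, u, v} k S} {M : Type w} [AddCommGroup M]
    [Module k M] {X Y : S} (g : Arrow Q.toGrQuiver X Y → M)
    (hadd : ∀ (d : ℤ) (x y : Q.gr X Y d), g ⟨d, x + y⟩ = g ⟨d, x⟩ + g ⟨d, y⟩)
    (hsmul : ∀ (d : ℤ) (c : k) (x : Q.gr X Y d), g ⟨d, c • x⟩ = c • g ⟨d, x⟩)
    {G : Str (free Q).toGrQuiver X Y → M} (hG : IsMultilinear G) :
    ∃ r : (free Q).Hom X Y →ₗ[k] M, (∀ x, r (incl Q x).2 = g x) ∧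
      ∀ s : Str (free Q).toGrQuiver X Y, 2 ≤ s.length → r ((free Q).b s) = G s := by
  -- The trivial tree has one leaf, so the values of `f` off length one do not matter; zero keeps it
  -- multilinear.
  let f : Str Q.toGrQuiver X Y → M := fun
    | .cons x (.nil _) => g x
    | _ => 0
  have hf : IsMultilinear f := by
    constructor
    · intro Z W s t d x y
      cases s with
      | nil =>
        cases t with
        | nil => exact hadd d x y
        | cons a t => exact (add_zero 0).symm
      | cons a s => cases s <;> cases t <;> exact (add_zero 0).symm
    · intro Z W s t d c x
      cases s with
      | nil =>
        cases t with
        | nil => exact hsmul d c x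
        | cons a t => exact (smul_zero c).symm
      | cons a s => cases s <;> cases t <;> exact (smul_zero c).symm
  refine ⟨(Free.extend hf hG).comp (Free.Hom Q.toGrQuiver X Y).subtype, fun x => ?_, fun s hs => ?_⟩
  · exact Free.extend_single_leaf hf hG (.single x)
  · exact Free.extend_preB hf hG hs

-- The differential `B₁` as a linear operator.

section TransD

variable {S : Type u} {F : OpQuiver.{uk, u, v} k S} {S' : Type u'} {B : OpQuiver.{uk, u', v'} k S'}
  {φ ψ : CocatHom F.toGrQuiver B.toGrQuiver}

theorem preTransB_congr (e : ℤ) {r r' : PreTrans φ ψ} {X Y : S} {s : Str F.toGrQuiver X Y}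
    (h : ∀ Z W (l : Str F.toGrQuiver X Z) (m : Str F.toGrQuiver Z W) (t : Str F.toGrQuiver W Y),
      l.append (m.append t) = s → r Z W m = r' Z W m) :
    preTransB φ ψ e r s = preTransB φ ψ e r' s :=
  Str.sum3_congr fun Z W l m t hs => by rw [h Z W l m t hs]

/-- The differential `r ↦ rb - (-1)^e br` on arbitrary systems of functions. -/
def transD (φ ψ : CocatHom F.toGrQuiver B.toGrQuiver) (e : ℤ) : PreTrans φ ψ →ₗ[k] PreTrans φ ψ where
  toFun r := fun X Y s => preTransB φ ψ e r s - sgn k e • F.pre (r X Y) s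
  map_add' r r' := by
    funext X Y s
    have h1 : preTransB φ ψ e (r + r') s = preTransB φ ψ e r s + preTransB φ ψ e r' s := by
      rw [← sub_eq_iff_eq_add, ← preTransB_sub, add_sub_cancel_right]
    have h2 : F.pre ((r + r') X Y) s = F.pre (r X Y) s + F.pre (r' X Y) s :=
      OpQuiver.pre_add _ _ _
    simp only [Pi.add_apply, h1]
    rw [show F.pre (r X Y + r' X Y) s = _ from h2, smul_add]
    abel
  map_smul' c r := by
    funext X Y s
    have h1 : preTransB φ ψ e (c • r) s = c • preTransB φ ψ e r s := by
      simp only [preTransB, Str.smul_sum3, Pi.smul_apply, map_smul, LinearMap.smul_apply]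
      exact Str.sum3_congr fun Z W l m t _ => smul_comm _ _ _
    have h2 : F.pre ((c • r) X Y) s = c • F.pre (r X Y) s := OpQuiver.pre_smul _ _ _
    simp only [RingHom.id_apply, Pi.smul_apply, smul_sub]
    rw [h1, smul_comm c (sgn k e), ← h2]
    rfl

theorem transD_apply (e : ℤ) (r : PreTrans φ ψ) {X Y : S} (s : Str F.toGrQuiver X Y) :
    transD φ ψ e r X Y s = preTransB φ ψ e r s - sgn k e • F.pre (r X Y) s := rfl

theorem transD_mem {e : ℤ} {r : PreTrans φ ψ} (hr : r ∈ Trans φ ψ e) :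
    transD φ ψ e r ∈ Trans φ ψ (e + 1) := fun X Y =>
  ⟨(preTransB_multilinear e (fun X Y => (hr X Y).1) X Y).fun_sub
      ((OpQuiver.pre_multilinear (hr X Y).1).const_smul _), fun s => by
    rw [← add_assoc]
    refine Submodule.sub_mem _ (preTransB_mem fun Z W _ m _ _ => (hr Z W).2 m)
      (Submodule.smul_mem _ _ (Str.sum3_mem fun Z W l m t hs => Submodule.smul_mem _ _ ?_))
    have := (hr X Y).2 (l.append (.cons (F.bArr m) t))
    convert this using 1
    rw [← hs]
    simp only [Str.deg_append, Str.deg, OpQuiver.bArr]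
    congr 1; ring⟩

end TransD

-- Transformations out of 𝓕𝒬 and their restriction to 𝒬.

section FreeSource

variable {S : Type u} {Q : DGQuiver.{uk, u, v} k S} {S' : Type u'} {A : AInfCat.{uk, u', v'} k S'}

/-- The target relations and the functor equations reduce the square to the double codifferential of
the source, which vanishes by `pre_pre_free`. -/
theorem transD_transD {φ ψ : AInfFunctor (free Q) A.toOpQuiver} {e : ℤ}
    {r : PreTrans φ.toCocatHom ψ.toCocatHom} (hr : r ∈ Trans φ.toCocatHom ψ.toCocatHom e) :
    transD φ.toCocatHom ψ.toCocatHom (e + 1) (transD φ.toCocatHom ψ.toCocatHom e r) = 0 := by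
  funext X Y s
  refine (preTransB_sub_pre φ ψ hr s).trans ?_
  rw [pre_pre_free Q (hr X Y).1]
  exact neg_zero

theorem sAInf_D {B : OpQuiver.{uk, u', v'} k S'} {φ ψ : AInfFunctor (free Q) B} {e : ℤ}
    (r : Trans φ.toCocatHom ψ.toCocatHom e) :
    (sAInf φ ψ).D e r = transD φ.toCocatHom ψ.toCocatHom e r.1 := by
  funext X Y s
  change transB r s - sgn k e • bTrans r.1 s = _
  rw [transB_eq_preTransB, bTrans_eq_pre]
  rfl

/-- A transformation with only its component on strings of length one possibly non-zero vanishes if it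
vanishes on the generators and its differential vanishes on all strings of length at least two. -/
theorem eq_zero_of_transD {B : OpQuiver.{uk, u', v'} k S'}
    {φ ψ : CocatHom (free Q).toGrQuiver B.toGrQuiver} {e : ℤ} {r : PreTrans φ ψ}
    (hr : ∀ X Y, IsMultilinear (r X Y))
    (hne : ∀ {X Y : S} (s : Str (free Q).toGrQuiver X Y), s.length ≠ 1 → r X Y s = 0)
    (hincl : ∀ {X Y : S} (x : Arrow Q.toGrQuiver X Y), r X Y (.single (incl Q x)) = 0)
    (hD : ∀ {X Y : S} (s : Str (free Q).toGrQuiver X Y), 2 ≤ s.length →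
      transD φ ψ e r X Y s = 0) : r = 0 := by
  have h1 : ∀ {X Y : S} (x : Arrow (free Q).toGrQuiver X Y), r X Y (.single x) = 0 := by
    intro X Y x
    refine free_eq_zero_of_single Q hr hincl (fun {X Y} s hs h => ?_) x
    have h2 := hD s hs
    -- Pieces of length one are letters of `s`, covered by the induction hypothesis; on all other
    -- pieces `r` vanishes. Only `bₖr₁` is left in the differential.
    have h3 : preTransB φ ψ e r s = preTransB φ ψ e 0 s := by
      refine preTransB_congr e fun Z W l m t hs' => ?_
      by_cases hl : m.length = 1
      · match m, hl with
        | .cons x (.nil _), _ =>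
          rw [← hs', Str.all_append, Str.all_append] at h
          exact h.2.1.1
        | .cons x (.cons y m), h => simp [Str.length] at h
      · exact hne m hl
    have h4 : preTransB φ ψ e 0 s = 0 := by
      have := preTransB_sub e (0 : PreTrans φ ψ) 0 s
      rwa [sub_self, sub_self] at this
    rw [transD_apply, h3, h4, zero_sub, neg_eq_zero, OpQuiver.pre_eq_of_forall_length_ne_one hne] at h2
    rw [← sgn_smul_sgn_smul (k := k) e (r X Y _), h2, smul_zero]
  funext X Y s
  by_cases hl : s.length = 1
  · match s, hl with
    | .cons x (.nil _), _ => exact h1 x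
    | .cons x (.cons y m), h => simp [Str.length] at h
  · exact hne s hl

/-- Restriction is a chain map, since on empty strings and on single generators `B₁` involves only
`r₀`, the functor components of length one, and `r₁` on the subcomplex s𝒬. -/
theorem restr_D {B : OpQuiver.{uk, u', v'} k S'} {φ ψ : AInfFunctor (free Q) B} {e : ℤ}
    (r : Trans φ.toCocatHom ψ.toCocatHom e) :
    restr φ ψ ((sAInf φ ψ).D e r) =
      (sA1 (restrFunctor φ) (restrFunctor ψ)).D e ⟨restr φ ψ r.1, restr_mem φ ψ e r.1 r.2⟩ := by
  refine Prod.ext ?_ ?_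
  · funext X
    change transB r (.nil X) - sgn k e • bTrans r.1 (.nil X) = B.b _
    rw [bTrans_eq_pre, OpQuiver.pre_nil (r.2 X X).1, smul_zero, sub_zero]
    simp only [transB, Str.splits3, Str.splits, List.flatMap_cons, List.flatMap_nil, List.map_cons,
      List.map_nil, List.append_nil, CocatHom.comps, List.sum_cons, List.sum_nil, add_zero, Str.deg,
      mul_zero, sgn_zero, one_smul, Str.append]
    refine congrArg (fun y => B.b (.single y)) (Arrow.ext ?_ rfl)
    exact zero_add e
  · funext X Y x
    change transB r (.single (incl Q x)) - sgn k e • bTrans r.1 (.single (incl Q x)) = _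
    rw [bTrans_eq_pre, OpQuiver.pre_single (r.2 X Y).1, bArr_incl]
    have h3 : (Str.single (incl Q x)).splits3 =
      [⟨.nil X, .nil X, .single (incl Q x)⟩, ⟨.nil X, .single (incl Q x), .nil Y⟩,
        ⟨.single (incl Q x), .nil Y, .nil Y⟩] := rfl
    have hc : ∀ χ : AInfFunctor (free Q) B, χ.comps (.single (incl Q x)) =
        [.single ((restrFunctor χ).arr x)] := fun χ => by
      refine congrArg (fun y => [Str.single y]) (Arrow.ext ?_ rfl)
      exact add_zero x.1
    have hn : ∀ (χ : AInfFunctor (free Q) B) (Z : S), χ.comps (.nil Z) = [.nil _] := fun _ _ => rfl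
    have ht : ∀ Z : S, transArr r (.nil Z) = ⟨e, r.1 Z Z (.nil Z), (restr_mem φ ψ e r.1 r.2).1 Z⟩ :=
      fun Z => Arrow.ext (zero_add e) rfl
    have ht' : transArr r (.single (incl Q x)) = ⟨x.1 + e, r.1 X Y (.single (incl Q x)),
        ((restr_mem φ ψ e r.1 r.2).2 X Y).2.2 x⟩ :=
      Arrow.ext (congrArg (· + e) (add_zero x.1)) rfl
    have hB : transB r (.single (incl Q x)) =
        (B.b (.single ⟨x.1 + e, r.1 X Y (.single (incl Q x)),
          ((restr_mem φ ψ e r.1 r.2).2 X Y).2.2 x⟩) : B.Hom (φ.obj X) (ψ.obj Y)) +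
        (B.b (.cons ((restrFunctor φ).arr x)
          (.single ⟨e, r.1 Y Y (.nil Y), (restr_mem φ ψ e r.1 r.2).1 Y⟩)) :
            B.Hom (φ.obj X) (ψ.obj Y)) +
        sgn k (e * x.1) • (B.b (.cons ⟨e, r.1 X X (.nil X), (restr_mem φ ψ e r.1 r.2).1 X⟩
          (.single ((restrFunctor ψ).arr x))) : B.Hom (φ.obj X) (ψ.obj Y)) := by
      have hd : (Str.single (incl Q x)).deg = x.1 := add_zero x.1
      unfold transB
      rw [h3]
      simp only [List.map_cons, List.map_nil, List.sum_cons, List.sum_nil, hc, hn, ht, ht', hd,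
        add_zero, show ∀ Z : S, (Str.nil (V := (free Q).toGrQuiver) Z).deg = 0 from fun _ => rfl,
        mul_zero, sgn_zero, one_smul]
      simp only [Str.append, Str.single]
      rw [add_comm]
      rfl
    exact congrArg (· - sgn k e • r.1 X Y (.single (incl Q (Q.dArr x)))) hB

-- The defect of a homotopy.

section Defect

variable {φ ψ : AInfFunctor (free Q) A.toOpQuiver} {P : Cx.{uk, w} k}

/-- A homogeneous map to `sA_∞(𝓕𝒬,𝒜)(φ,ψ)` as a linear map to systems of functions. -/
def transMap {m : ℤ} (f : GrMap P (sAInf φ ψ).gr m) :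
    P.carrier →ₗ[k] PreTrans φ.toCocatHom ψ.toCocatHom := f.1

theorem transMap_mem {m : ℤ} (f : GrMap P (sAInf φ ψ).gr m) {i : ℤ} {p : P.carrier}
    (hp : p ∈ P.gr i) : transMap f p ∈ Trans φ.toCocatHom ψ.toCocatHom (i + m) := f.2 i p hp

variable (φ ψ) in
/-- The restriction map `r ↦ (r₀, r₁|_{s𝒬})` on systems of functions. -/
def restrLin : PreTrans φ.toCocatHom ψ.toCocatHom →ₗ[k]
    PreTrans1 (restrFunctor φ) (restrFunctor ψ) := restr φ ψ

/-- The defect `pu - (pd)h - (ph)B₁` of a homotopy, at `p` of degree `i`. -/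
def defect (U : GrMap P (sAInf φ ψ).gr 0) (h : GrMap P (sAInf φ ψ).gr (-1)) (i : ℤ)
    (p : P.carrier) : PreTrans φ.toCocatHom ψ.toCocatHom :=
  transMap U p - transMap h (P.d p) - transD φ.toCocatHom ψ.toCocatHom (i + -1) (transMap h p)

variable {U : GrMap P (sAInf φ ψ).gr 0} {h : GrMap P (sAInf φ ψ).gr (-1)}

theorem isHomotopy_iff_defect : IsHomotopy U h ↔ ∀ i, ∀ p ∈ P.gr i, defect U h i p = 0 := by
  refine forall_congr' fun i => forall_congr' fun p => forall_congr' fun hp => ?_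
  have h1 := sAInf_D (φ := φ) (ψ := ψ) ⟨transMap h p, transMap_mem h hp⟩
  rw [defect, sub_sub, sub_eq_zero]
  exact ⟨fun hh => hh.trans (congrArg (transMap h (P.d p) + ·) h1),
    fun hh => hh.trans (congrArg (transMap h (P.d p) + ·) h1.symm)⟩

theorem isHomotopy_restrMap_iff : IsHomotopy (restrMap U) (restrMap h) ↔
    ∀ i, ∀ p ∈ P.gr i, restrLin φ ψ (defect U h i p) = 0 := by
  refine forall_congr' fun i => forall_congr' fun p => forall_congr' fun hp => ?_
  have h1 := (congrArg (restr φ ψ) (sAInf_D (φ := φ) (ψ := ψ)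
    ⟨transMap h p, transMap_mem h hp⟩)).symm.trans (restr_D ⟨transMap h p, transMap_mem h hp⟩)
  rw [defect, map_sub, map_sub, sub_sub, sub_eq_zero]
  exact ⟨fun hh => hh.trans (congrArg (restrLin φ ψ (transMap h (P.d p)) + ·) h1.symm),
    fun hh => hh.trans (congrArg (restrLin φ ψ (transMap h (P.d p)) + ·) h1)⟩

theorem defect_mem {i : ℤ} {p : P.carrier} (hp : p ∈ P.gr i) :
    defect U h i p ∈ Trans φ.toCocatHom ψ.toCocatHom i := by
  have h1 := transMap_mem U hp
  have h2 := transMap_mem h (P.d_mem i p hp)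
  have h3 := transD_mem (transMap_mem h hp)
  rw [add_zero] at h1
  rw [add_neg_cancel_right] at h2
  rw [neg_add_cancel_right] at h3
  exact Submodule.sub_mem _ (Submodule.sub_mem _ h1 h2) h3

theorem IsChainMap.transMap_d (hU : IsChainMap U) {i : ℤ} {p : P.carrier} (hp : p ∈ P.gr i) :
    transMap U (P.d p) = transD φ.toCocatHom ψ.toCocatHom i (transMap U p) := by
  have h1 := (hU i p hp).trans (sAInf_D (φ := φ) (ψ := ψ) ⟨transMap U p, transMap_mem U hp⟩)
  have h2 : transMap U (P.d p) = transD φ.toCocatHom ψ.toCocatHom (i + 0) (transMap U p) := h1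
  rwa [add_zero] at h2

/-- Follows from `B₁² = 0`, from `d² = 0` and from `u` being a chain map: both sides equal `(pd)u -
((pd)h)B₁`. -/
theorem transD_defect (hU : IsChainMap U) {i : ℤ} {p : P.carrier} (hp : p ∈ P.gr i) :
    transD φ.toCocatHom ψ.toCocatHom i (defect U h i p) = defect U h (i + 1) (P.d p) := by
  have h2 := transD_transD (transMap_mem h hp)
  rw [neg_add_cancel_right] at h2
  rw [defect, map_sub, map_sub, defect, P.d_d, map_zero, hU.transMap_d hp, h2,
    add_neg_cancel_right, sub_zero, sub_zero]

/-- The recurrent formula is the vanishing of the defect at `s`, solved for the term in which `b`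
swallows the whole string. Its sign is `-(-1)^{i-1} = (-1)^i`. -/
theorem defect_eq_zero_iff {i : ℤ} {p : P.carrier} (hp : p ∈ P.gr i) {X Y : S}
    (s : Str (free Q).toGrQuiver X Y) : defect U h i p X Y s = 0 ↔
      sgn k i • transMap h p X Y (.single ((free Q).bArr s)) =
        transMap U p X Y s - transMap h (P.d p) X Y s -
          transB (e := i + -1) ⟨transMap h p, transMap_mem h hp⟩ s -
          sgn k i • bTransProper (transMap h p) s := by
  have hs : sgn k (i + -1) = -sgn k i := by
    rw [← neg_neg (sgn k (i + -1)), ← sgn_succ, neg_add_cancel_right]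
  have h1 : defect U h i p X Y s = transMap U p X Y s - transMap h (P.d p) X Y s -
      (transB (e := i + -1) ⟨transMap h p, transMap_mem h hp⟩ s - sgn k (i + -1) •
        (free Q).pre (transMap h p X Y) s) := by
    rw [transB_eq_preTransB]; rfl
  rw [h1, ← bTransProper_add, hs, neg_smul, smul_add, eq_comm (a := sgn k i • _),
    ← sub_eq_zero (b := sgn k i • transMap h p X Y _)]
  refine Eq.congr ?_ rfl
  abel

/-- Vanishing in lengths at least two forces vanishing in length one: the defect at `p` is then
concentrated in length one and zero on generators, while its differential is the defect at `pd`,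
again zero in lengths at least two. `eq_zero_of_transD` concludes. -/
theorem isHomotopy_iff_of_restrMap (hU : IsChainMap U)
    (hr : IsHomotopy (restrMap U) (restrMap h)) : IsHomotopy U h ↔
      ∀ i, ∀ p ∈ P.gr i, ∀ (X Y : S) (s : Str (free Q).toGrQuiver X Y), 2 ≤ s.length →
        defect U h i p X Y s = 0 := by
  rw [isHomotopy_iff_defect]
  refine ⟨fun hh i p hp X Y s _ => by rw [hh i p hp]; rfl, fun hh i p hp => ?_⟩
  rw [isHomotopy_restrMap_iff] at hr
  refine eq_zero_of_transD (e := i) (fun X Y => (defect_mem hp X Y).1) (fun {X Y} s hs => ?_)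
    (fun {X Y} x => congrFun (congrFun (congrFun (congrArg Prod.snd (hr i p hp)) X) Y) x)
    fun {X Y} s hs => ?_
  · match s with
    | .nil X => exact congrFun (congrArg Prod.fst (hr i p hp)) X
    | .cons x (.nil _) => exact absurd rfl hs
    | .cons x (.cons y s) => exact hh i p hp _ _ _ (by simp [Str.length])
  · rw [transD_defect hU hp]
    exact hh _ _ (P.d_mem i p hp) _ _ s hs

end Defect

end FreeSource

/-- The pointwise limit of an eventually stationary sequence of linear maps; each linearity identity
can be read off at one late index. -/
theorem exists_linearMap_eventually_eq {M : Type v} {N : Type w} [AddCommGroup M] [Module k M]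
    [AddCommGroup N] [Module k N] (f : ℕ → M →ₗ[k] N)
    (h : ∀ x, ∃ z, ∀ᶠ n in Filter.atTop, f n x = z) :
    ∃ g : M →ₗ[k] N, ∀ x, ∀ᶠ n in Filter.atTop, f n x = g x := by
  choose g hg using h
  refine ⟨⟨⟨g, fun x y => ?_⟩, fun c x => ?_⟩, hg⟩
  · obtain ⟨n, h1, h2, h3⟩ := ((hg (x + y)).and ((hg x).and (hg y))).exists
    rw [← h1, ← h2, ← h3, map_add]
  · obtain ⟨n, h1, h2⟩ := ((hg (c • x)).and (hg x)).exists
    exact h1.symm.trans ((map_smul (f n) c x).trans (congrArg (c • ·) h2))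

-- Transformations assembled from their components.

section Parts

variable {S : Type u} {V : GrQuiver.{uk, u, v} k S} {S' : Type u'} {W : GrQuiver.{uk, u', v'} k S'}
  {φ ψ : CocatHom V W}

/-- The system of functions with the given values on strings of length one, and zero on the others. -/
def singlePart (ρ : ∀ X Y, V.Hom X Y →ₗ[k] W.Hom (φ.obj X) (ψ.obj Y)) : PreTrans φ ψ
  | _, _, .nil _ => 0
  | _, _, .cons x (.nil _) => ρ _ _ x.2
  | _, _, .cons _ (.cons _ _) => 0

theorem singlePart_single (ρ : ∀ X Y, V.Hom X Y →ₗ[k] W.Hom (φ.obj X) (ψ.obj Y)) {X Y : S}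
    (x : Arrow V X Y) : singlePart ρ X Y (.single x) = ρ X Y x.2 := rfl

theorem singlePart_single_mem {ρ : ∀ X Y, V.Hom X Y →ₗ[k] W.Hom (φ.obj X) (ψ.obj Y)} {e : ℤ} {X Y : S}
    {x : Arrow V X Y} (h : ρ X Y x.2 ∈ W.gr (φ.obj X) (ψ.obj Y) (x.1 + e)) :
    singlePart ρ X Y (.single x) ∈ W.gr (φ.obj X) (ψ.obj Y) ((Str.single x).deg + e) := by
  rwa [singlePart_single, show (Str.single x).deg = x.1 from add_zero x.1]

theorem singlePart_of_length_ne_one (ρ : ∀ X Y, V.Hom X Y →ₗ[k] W.Hom (φ.obj X) (ψ.obj Y))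
    {X Y : S} (s : Str V X Y) (hs : s.length ≠ 1) : singlePart ρ X Y s = 0 := by
  match s with
  | .nil _ => rfl
  | .cons _ (.nil _) => exact absurd rfl hs
  | .cons _ (.cons _ _) => rfl

theorem singlePart_multilinear (ρ : ∀ X Y, V.Hom X Y →ₗ[k] W.Hom (φ.obj X) (ψ.obj Y)) (X Y : S) :
    IsMultilinear (singlePart ρ X Y) := by
  constructor
  · intro Z W s t d x y
    cases s with
    | nil =>
      cases t with
      | nil => exact map_add (ρ _ _) _ _
      | cons a t => exact (add_zero 0).symm
    | cons a s => cases s <;> cases t <;> exact (add_zero 0).symm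
  · intro Z W s t d c x
    cases s with
    | nil =>
      cases t with
      | nil => exact map_smul (ρ _ _) _ _
      | cons a t => exact (smul_zero c).symm
    | cons a s => cases s <;> cases t <;> exact (smul_zero c).symm

/-- The system of functions with the given values on empty strings, and zero on the others. -/
def nilPart (c : ∀ X, W.Hom (φ.obj X) (ψ.obj X)) : PreTrans φ ψ
  | _, _, .nil X => c X
  | _, _, .cons _ _ => 0

theorem nilPart_mem {e : ℤ} {c : ∀ X, W.Hom (φ.obj X) (ψ.obj X)}
    (hc : ∀ X, c X ∈ W.gr (φ.obj X) (ψ.obj X) e) : nilPart c ∈ Trans φ ψ e := fun X Y => by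
  refine ⟨⟨fun s t d x y => ?_, fun s t d a x => ?_⟩, fun s => ?_⟩
  · cases s <;> exact (add_zero 0).symm
  · cases s <;> exact (smul_zero a).symm
  · cases s with
    | nil =>
      have := hc X
      rwa [← zero_add e] at this
    | cons x s => exact Submodule.zero_mem _

variable (φ ψ) in
/-- The system of functions with the given values on strings of length at least two, and zero on the
others. -/
def longPart : (∀ n : {n : ℕ // 1 < n}, PreComp φ ψ n) →ₗ[k] PreTrans φ ψ where
  toFun H := fun X Y s => if h : 1 < s.length then H ⟨s.length, h⟩ X Y ⟨s, rfl⟩ else 0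
  map_add' H H' := by
    funext X Y s
    simp only [Pi.add_apply]
    split_ifs
    · rfl
    · exact (add_zero 0).symm
  map_smul' c H := by
    funext X Y s
    simp only [Pi.smul_apply, RingHom.id_apply]
    split_ifs
    · rfl
    · exact (smul_zero c).symm

theorem longPart_apply (H : ∀ n : {n : ℕ // 1 < n}, PreComp φ ψ n) {X Y : S} {s : Str V X Y} {n : ℕ}
    (hn : 1 < n) (hs : s.length = n) : longPart φ ψ H X Y s = H ⟨n, hn⟩ X Y ⟨s, hs⟩ := by
  subst hs
  exact dif_pos hn

theorem longPart_of_length_le_one (H : ∀ n : {n : ℕ // 1 < n}, PreComp φ ψ n) {X Y : S}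
    {s : Str V X Y} (hs : ¬1 < s.length) : longPart φ ψ H X Y s = 0 := dif_neg hs

theorem longPart_mem {e : ℤ} {H : ∀ n : {n : ℕ // 1 < n}, PreComp φ ψ n}
    (hH : ∀ n : {n : ℕ // 1 < n}, H n ∈ Comp φ ψ n e) : longPart φ ψ H ∈ Trans φ ψ e := fun X Y => by
  refine ⟨⟨fun {Z Z'} s t d x y => ?_, fun {Z Z'} s t d c x => ?_⟩, fun s => ?_⟩
  · have hl : ∀ z : V.gr Z Z' d, (s.append (.cons ⟨d, z⟩ t)).length = s.length + (t.length + 1) :=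
      fun z => by rw [Str.length_append, Str.length]
    by_cases h : 1 < s.length + (t.length + 1)
    · rw [longPart_apply H h (hl _), longPart_apply H h (hl _), longPart_apply H h (hl _)]
      exact (hH ⟨_, h⟩ X Y).1 s t d x y _ _ _
    · rw [longPart_of_length_le_one H (by rwa [hl]), longPart_of_length_le_one H (by rwa [hl]),
        longPart_of_length_le_one H (by rwa [hl]), add_zero]
  · have hl : ∀ z : V.gr Z Z' d, (s.append (.cons ⟨d, z⟩ t)).length = s.length + (t.length + 1) :=
      fun z => by rw [Str.length_append, Str.length]
    by_cases h : 1 < s.length + (t.length + 1)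
    · rw [longPart_apply H h (hl _), longPart_apply H h (hl _)]
      exact (hH ⟨_, h⟩ X Y).2.1 s t d c x _ _
    · rw [longPart_of_length_le_one H (by rwa [hl]), longPart_of_length_le_one H (by rwa [hl]),
        smul_zero]
  · by_cases h : 1 < s.length
    · rw [longPart_apply H h rfl]
      exact (hH ⟨_, h⟩ X Y).2.2 ⟨s, rfl⟩
    · rw [longPart_of_length_le_one H h]
      exact Submodule.zero_mem _

end Parts

-- Solving for the component of length one.

section Existence

variable {S : Type u} {Q : DGQuiver.{uk, u, v} k S} {S' : Type u'} {B : OpQuiver.{uk, u', v'} k S'}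
  {φ ψ : CocatHom (free Q).toGrQuiver B.toGrQuiver}

/-- Only the values of `ρ` on the letters of `s` enter. This locality makes the recursion in
`exists_singlePart` well founded. -/
theorem preTransB_singlePart_congr (e : ℤ)
    {ρ ρ' : ∀ X Y, (free Q).Hom X Y →ₗ[k] B.Hom (φ.obj X) (ψ.obj Y)} {X Y : S}
    {s : Str (free Q).toGrQuiver X Y} (h : s.All fun {X Y} x => ρ X Y x.2 = ρ' X Y x.2) :
    preTransB φ ψ e (singlePart ρ) s = preTransB φ ψ e (singlePart ρ') s := by
  refine preTransB_congr e fun Z W l m t hs => ?_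
  match m with
  | .nil _ => rfl
  | .cons x (.nil _) =>
    rw [← hs, Str.all_append, Str.all_append] at h
    exact h.2.1.1
  | .cons _ (.cons _ _) => rfl

theorem eventually_all {V : GrQuiver.{uk, u, v} k S} {p : ℕ → ∀ {X Y : S}, Arrow V X Y → Prop} :
    ∀ {X Y : S} {s : Str V X Y}, s.All (fun x => ∀ᶠ n in Filter.atTop, p n x) →
      ∀ᶠ n in Filter.atTop, s.All (p n)
  | _, _, .nil _, _ => Filter.Eventually.of_forall fun _ => trivial
  | _, _, .cons _ _, h => h.1.and (eventually_all h.2)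

/-- The equation prescribes `ρ` on the value of an operation at `s` in terms of `ρ` on the letters
of `s`. By freeness, each `ρ` gives a `ρ'` with the values so computed, and a fixed point of this
assignment is sought. The iterates starting from zero become stationary on every arrow, by induction
over generation, and their limit is a fixed point. -/
theorem exists_singlePart (e : ℤ) {g : ∀ X Y, Arrow Q.toGrQuiver X Y → B.Hom (φ.obj X) (ψ.obj Y)}
    (hadd : ∀ X Y (d : ℤ) (x y : Q.gr X Y d), g X Y ⟨d, x + y⟩ = g X Y ⟨d, x⟩ + g X Y ⟨d, y⟩)
    (hsmul : ∀ X Y (d : ℤ) (c : k) (x : Q.gr X Y d), g X Y ⟨d, c • x⟩ = c • g X Y ⟨d, x⟩)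
    (hg : ∀ X Y (x : Arrow Q.toGrQuiver X Y), g X Y x ∈ B.gr (φ.obj X) (ψ.obj Y) (x.1 + e))
    {R : PreTrans φ ψ} (hR : R ∈ Trans φ ψ (e + 1)) :
    ∃ ρ : ∀ X Y, (free Q).Hom X Y →ₗ[k] B.Hom (φ.obj X) (ψ.obj Y),
      singlePart ρ ∈ Trans φ ψ e ∧ (∀ X Y x, ρ X Y (incl Q x).2 = g X Y x) ∧
      ∀ (X Y : S) (s : Str (free Q).toGrQuiver X Y), 2 ≤ s.length →
        transD φ ψ e (singlePart ρ) X Y s = R X Y s := by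
  have step : ∀ ρ : ∀ X Y, (free Q).Hom X Y →ₗ[k] B.Hom (φ.obj X) (ψ.obj Y), ∃ ρ' :
      ∀ X Y, (free Q).Hom X Y →ₗ[k] B.Hom (φ.obj X) (ψ.obj Y), ∀ X Y,
      (∀ x, ρ' X Y (incl Q x).2 = g X Y x) ∧ ∀ s : Str (free Q).toGrQuiver X Y, 2 ≤ s.length →
        ρ' X Y ((free Q).b s) = sgn k e • (preTransB φ ψ e (singlePart ρ) s - R X Y s) := by
    intro ρ
    choose ρ' h using fun X Y => exists_linearMap_free (g X Y) (hadd X Y) (hsmul X Y)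
      (((preTransB_multilinear e (singlePart_multilinear ρ) X Y).fun_sub
        (hR X Y).1).const_smul (sgn k e))
    exact ⟨ρ', h⟩
  choose Φ hΦ using step
  let f : ℕ → ∀ X Y, (free Q).Hom X Y →ₗ[k] B.Hom (φ.obj X) (ψ.obj Y) := fun n => Φ^[n] 0
  have hf : ∀ n, f (n + 1) = Φ (f n) := fun n => Function.iterate_succ_apply' Φ n 0
  have hev : ∀ {X Y : S} (x : Arrow (free Q).toGrQuiver X Y),
      ∀ᶠ n in Filter.atTop, f (n + 1) X Y x.2 = f n X Y x.2 := by
    intro X Y x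
    refine free_induction Q (P := fun {X Y} x => ∀ᶠ n in Filter.atTop, f (n + 1) X Y x.2 = f n X Y x.2)
      (fun d => ?_) (fun d x y hx hy => ?_) (fun d c x hx => ?_) (fun {X Y} x => ?_)
      (fun {X Y} s hs h => ?_) x
    · refine Filter.Eventually.of_forall fun n => ?_
      exact (map_zero _).trans (map_zero _).symm
    · filter_upwards [hx, hy] with n h1 h2
      exact (map_add _ _ _).trans ((congrArg₂ (· + ·) h1 h2).trans (map_add _ _ _).symm)
    · filter_upwards [hx] with n h1
      exact (map_smul _ _ _).trans ((congrArg (c • ·) h1).trans (map_smul _ _ _).symm)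
    -- From the first iterate on, the value on generators is `g`; the zeroth iterate is zero.
    · filter_upwards [Filter.eventually_ge_atTop 1] with n hn
      obtain ⟨m, rfl⟩ := Nat.exists_eq_add_of_le' hn
      rw [hf (m + 1), hf m, (hΦ _ X Y).1, (hΦ _ X Y).1]
    -- Once all letters of `s` are stationary from `N` on, the value at `s` is stationary from `N +
    -- 1` on.
    · have h1 := eventually_all h
      obtain ⟨N, hN⟩ := Filter.eventually_atTop.1 h1
      refine Filter.eventually_atTop.2 ⟨N + 1, fun n hn => ?_⟩
      obtain ⟨m, rfl⟩ := Nat.exists_eq_add_of_le' (show 1 ≤ n by omega)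
      have h2 := preTransB_singlePart_congr (φ := φ) (ψ := ψ) e (hN m (by omega))
      change f (m + 1 + 1) X Y ((free Q).b s) = f (m + 1) X Y ((free Q).b s)
      rw [hf (m + 1), (hΦ _ X Y).2 s hs, h2, hf m, (hΦ _ X Y).2 s hs]
  have hlim : ∀ X Y (y : (free Q).Hom X Y), ∃ z, ∀ᶠ n in Filter.atTop, f n X Y y = z := by
    intro X Y y
    have hy : y ∈ ⨆ d, (free Q).gr X Y d := by
      rw [((free Q).internal X Y).submodule_iSup_eq_top]
      trivial
    induction hy using Submodule.iSup_induction' with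
    | mem d x hx =>
      obtain ⟨N, hN⟩ := Filter.eventually_atTop.1 (hev ⟨d, x, hx⟩)
      refine ⟨f N X Y x, Filter.eventually_atTop.2 ⟨N, fun n hn => ?_⟩⟩
      induction n, hn using Nat.le_induction with
      | base => rfl
      | succ n hn ih => exact (hN n hn).trans ih
    | zero => exact ⟨0, Filter.Eventually.of_forall fun n => map_zero _⟩
    | add x y _ _ hx hy =>
      obtain ⟨a, ha⟩ := hx
      obtain ⟨b, hb⟩ := hy
      refine ⟨a + b, ?_⟩
      filter_upwards [ha, hb] with n h1 h2
      rw [map_add, h1, h2]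
  choose ρ hρ using fun X Y => exists_linearMap_eventually_eq (fun n => f n X Y) (hlim X Y)
  have hincl : ∀ X Y x, ρ X Y (incl Q x).2 = g X Y x := by
    intro X Y x
    obtain ⟨n, hn, h1⟩ :=
      ((hρ X Y (incl Q x).2).and (Filter.eventually_ge_atTop 1)).exists
    obtain ⟨m, rfl⟩ := Nat.exists_eq_add_of_le' h1
    rw [← hn, hf m, (hΦ _ X Y).1]
  have hb : ∀ (X Y : S) (s : Str (free Q).toGrQuiver X Y), 2 ≤ s.length →
      ρ X Y ((free Q).b s) = sgn k e • (preTransB φ ψ e (singlePart ρ) s - R X Y s) := by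
    intro X Y s hs
    have h0 : s.All fun {X Y} x => ∀ᶠ n in Filter.atTop, f n X Y x.2 = ρ X Y x.2 :=
      .of_forall (fun x => hρ _ _ _) s
    have h1 := eventually_all h0
    -- An index `n` is chosen at which the letters of `s` have reached their limits and for which
    -- iterate `n + 1` has done so at `b s`.
    obtain ⟨n, h2, h3⟩ := (((Filter.tendsto_add_atTop_nat 1).eventually
      (hρ X Y ((free Q).b s))).and h1).exists
    rw [← h2, hf n, (hΦ _ X Y).2 s hs, preTransB_singlePart_congr e h3]
  refine ⟨ρ, ?_, hincl, fun X Y s hs => ?_⟩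
  -- `exists_linearMap_free` says nothing about degrees, so homogeneity is proved afterwards by
  -- generation, with the local hypothesis of `preTransB_mem`.
  · have hmem : ∀ {X Y : S} (x : Arrow (free Q).toGrQuiver X Y),
        ρ X Y x.2 ∈ B.gr (φ.obj X) (ψ.obj Y) (x.1 + e) := by
      intro X Y x
      refine free_induction Q (P := fun {X Y} x => ρ X Y x.2 ∈ B.gr (φ.obj X) (ψ.obj Y) (x.1 + e))
        (fun d => ?_) (fun d x y hx hy => ?_) (fun d c x hx => ?_) (fun {X Y} x => ?_)
        (fun {X Y} s hs h => ?_) x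
      · exact (map_zero (ρ _ _)).symm ▸ Submodule.zero_mem _
      · exact (map_add (ρ _ _) _ _).symm ▸ Submodule.add_mem _ hx hy
      · exact (map_smul (ρ _ _) _ _).symm ▸ Submodule.smul_mem _ _ hx
      · rw [hincl]
        exact hg X Y x
      · change ρ X Y ((free Q).b s) ∈ B.gr (φ.obj X) (ψ.obj Y) (s.deg + 1 + e)
        rw [hb X Y s hs, add_right_comm]
        refine Submodule.smul_mem _ _ (Submodule.sub_mem _ (preTransB_mem fun Z W l m t hs' => ?_) ?_)
        · match m with
          | .nil _ => exact Submodule.zero_mem _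
          | .cons x (.nil _) =>
            rw [← hs', Str.all_append, Str.all_append] at h
            exact singlePart_single_mem h.2.1.1
          | .cons _ (.cons _ _) => exact Submodule.zero_mem _
        · rw [add_assoc]
          exact (hR X Y).2 s
    intro X Y
    refine ⟨singlePart_multilinear ρ X Y, fun s => ?_⟩
    match s with
    | .nil _ => exact Submodule.zero_mem _
    | .cons x (.nil _) =>
      exact singlePart_single_mem (hmem x)
    | .cons _ (.cons _ _) => exact Submodule.zero_mem _
  · rw [transD_apply, OpQuiver.pre_eq_of_forall_length_ne_one (singlePart_of_length_ne_one ρ)]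
    change _ - sgn k e • ρ X Y ((free Q).b s) = _
    rw [hb X Y s hs, sgn_smul_sgn_smul, sub_sub_cancel]

end Existence

-- Homotopies with prescribed restriction and components.

section Solution

variable {S : Type u} {Q : DGQuiver.{uk, u, v} k S} {S' : Type u'} {A : AInfCat.{uk, u', v'} k S'}
  {φ ψ : AInfFunctor (free Q) A.toOpQuiver} {P : Cx.{uk, w} k}

/-- A homogeneous map to `sA₁(𝒬,𝒜)(φ,ψ)` as a linear map to pairs of systems of functions. -/
def transMap₁ {m : ℤ} (f : GrMap P (sA1 (restrFunctor φ) (restrFunctor ψ)).gr m) :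
    P.carrier →ₗ[k] PreTrans1 (restrFunctor φ) (restrFunctor ψ) := f.1

theorem transMap₁_mem {m : ℤ} (f : GrMap P (sA1 (restrFunctor φ) (restrFunctor ψ)).gr m) {i : ℤ}
    {p : P.carrier} (hp : p ∈ P.gr i) :
    transMap₁ f p ∈ Trans1 (restrFunctor φ) (restrFunctor ψ) (i + m) := f.2 i p hp

/-- The components on strings of length at least two, as a linear map to systems of functions. -/
def longMap {m : ℤ} (H : ∀ n : {n : ℕ // 1 < n}, GrMap P (Comp φ.toCocatHom ψ.toCocatHom n) m) :
    P.carrier →ₗ[k] PreTrans φ.toCocatHom ψ.toCocatHom :=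
  (longPart φ.toCocatHom ψ.toCocatHom).comp (LinearMap.pi fun n => (H n).1)

theorem longMap_mem {m : ℤ} (H : ∀ n : {n : ℕ // 1 < n}, GrMap P (Comp φ.toCocatHom ψ.toCocatHom n) m)
    {i : ℤ} {p : P.carrier} (hp : p ∈ P.gr i) :
    longMap H p ∈ Trans φ.toCocatHom ψ.toCocatHom (i + m) :=
  longPart_mem fun n => (H n).2 i p hp

theorem longMap_of_length_le_one {m : ℤ}
    (H : ∀ n : {n : ℕ // 1 < n}, GrMap P (Comp φ.toCocatHom ψ.toCocatHom n) m) (p : P.carrier)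
    {X Y : S} {s : Str (free Q).toGrQuiver X Y} (hs : ¬1 < s.length) : longMap H p X Y s = 0 :=
  longPart_of_length_le_one _ hs

theorem longMap_compMap {m : ℤ} (h : GrMap P (sAInf φ ψ).gr m) (p : P.carrier) {X Y : S}
    {s : Str (free Q).toGrQuiver X Y} (hs : 1 < s.length) :
    longMap (fun n => compMap h n) p X Y s = transMap h p X Y s :=
  longPart_apply _ hs rfl

/-- The system of functions `r` is a possible value at `p` of a homotopy with restriction `h'` and
components `H`. -/
structure IsSolution (U : GrMap P (sAInf φ ψ).gr 0)
    (h' : GrMap P (sA1 (restrFunctor φ) (restrFunctor ψ)).gr (-1))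
    (H : ∀ n : {n : ℕ // 1 < n}, GrMap P (Comp φ.toCocatHom ψ.toCocatHom n) (-1)) (i : ℤ)
    (p : P.carrier) (r : PreTrans φ.toCocatHom ψ.toCocatHom) : Prop where
  mem : r ∈ Trans φ.toCocatHom ψ.toCocatHom (i + -1)
  restr : restrLin φ ψ r = transMap₁ h' p
  long : ∀ (X Y : S) (s : Str (free Q).toGrQuiver X Y), 1 < s.length → r X Y s = longMap H p X Y s
  -- At `pd` only the prescribed components of length at least two occur, so the conditions for
  -- different `p` are independent of each other.
  eq : ∀ (X Y : S) (s : Str (free Q).toGrQuiver X Y), 1 < s.length →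
    transD φ.toCocatHom ψ.toCocatHom (i + -1) r X Y s =
      transMap U p X Y s - longMap H (P.d p) X Y s

namespace IsSolution

variable {U : GrMap P (sAInf φ ψ).gr 0} {h' : GrMap P (sA1 (restrFunctor φ) (restrFunctor ψ)).gr (-1)}
  {H : ∀ n : {n : ℕ // 1 < n}, GrMap P (Comp φ.toCocatHom ψ.toCocatHom n) (-1)} {i : ℤ}
  {p q : P.carrier} {r r' : PreTrans φ.toCocatHom ψ.toCocatHom}

/-- The difference of two solutions has only a component of length one, vanishes on generators, and
satisfies the homogeneous equation; `eq_zero_of_transD` applies. -/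
theorem unique (h : IsSolution U h' H i p r) (h₂ : IsSolution U h' H i p r') : r = r' := by
  rw [← sub_eq_zero]
  have hr : restrLin φ ψ (r - r') = 0 := by rw [map_sub, h.restr, h₂.restr, sub_self]
  refine eq_zero_of_transD (e := i + -1) (fun X Y => (Submodule.sub_mem _ h.mem h₂.mem X Y).1)
    (fun {X Y} s hs => ?_)
    (fun {X Y} x => congrFun (congrFun (congrFun (congrArg Prod.snd hr) X) Y) x)
    fun {X Y} s hs => ?_
  · match s with
    | .nil X => exact congrFun (congrArg Prod.fst hr) X
    | .cons x (.nil _) => exact absurd rfl hs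
    | .cons x (.cons y s) =>
      have hl : 1 < (Str.cons x (.cons y s)).length := by simp [Str.length]
      exact sub_eq_zero.2 ((h.long _ _ _ hl).trans (h₂.long _ _ _ hl).symm)
  · rw [map_sub]
    exact sub_eq_zero.2 ((h.eq X Y s hs).trans (h₂.eq X Y s hs).symm)

/-- Together with `unique` and `smul` this makes the solution depend linearly on `p`. -/
theorem add (h : IsSolution U h' H i p r) (h₂ : IsSolution U h' H i q r') :
    IsSolution U h' H i (p + q) (r + r') where
  mem := Submodule.add_mem _ h.mem h₂.mem
  restr := by rw [map_add, map_add, h.restr, h₂.restr]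
  long X Y s hs := by
    rw [map_add]
    exact congrArg₂ (· + ·) (h.long X Y s hs) (h₂.long X Y s hs)
  eq X Y s hs := by
    rw [map_add, map_add, map_add, map_add]
    exact (congrArg₂ (· + ·) (h.eq X Y s hs) (h₂.eq X Y s hs)).trans (sub_add_sub_comm _ _ _ _)

theorem smul (c : k) (h : IsSolution U h' H i p r) : IsSolution U h' H i (c • p) (c • r) where
  mem := Submodule.smul_mem _ _ h.mem
  restr := by rw [map_smul, map_smul, h.restr]
  long X Y s hs := by
    rw [map_smul]
    exact congrArg (c • ·) (h.long X Y s hs)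
  eq X Y s hs := by
    rw [map_smul, map_smul, map_smul, map_smul]
    exact (congrArg (c • ·) (h.eq X Y s hs)).trans (smul_sub _ _ _)

variable (U h' H) in
-- The component of length zero and those of length at least two are already known. Their
-- differential is moved to the right-hand side, and `exists_singlePart` supplies the component of
-- length one.
theorem exists_of_mem (hp : p ∈ P.gr i) : ∃ r, IsSolution U h' H i p r := by
  have hm := transMap₁_mem h' hp
  have hR0 : nilPart (transMap₁ h' p).1 + longMap H p ∈ Trans φ.toCocatHom ψ.toCocatHom (i + -1) :=
    Submodule.add_mem _ (nilPart_mem hm.1) (longMap_mem H hp)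
  have hR : transMap U p - longMap H (P.d p) - transD φ.toCocatHom ψ.toCocatHom (i + -1)
      (nilPart (transMap₁ h' p).1 + longMap H p) ∈ Trans φ.toCocatHom ψ.toCocatHom (i + -1 + 1) := by
    have h1 := transMap_mem U hp
    have h2 := longMap_mem H (P.d_mem i p hp)
    rw [add_zero, ← neg_add_cancel_right i 1] at h1
    rw [add_right_comm] at h2
    exact Submodule.sub_mem _ (Submodule.sub_mem _ h1 h2) (transD_mem hR0)
  obtain ⟨ρ, hρ, hincl, heq⟩ := exists_singlePart (i + -1) (g := (transMap₁ h' p).2)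
    (fun X Y => (hm.2 X Y).1) (fun X Y => (hm.2 X Y).2.1) (fun X Y => (hm.2 X Y).2.2) hR
  refine ⟨nilPart (transMap₁ h' p).1 + longMap H p + singlePart ρ,
    Submodule.add_mem _ hR0 hρ, Prod.ext ?_ ?_, fun X Y s hs => ?_, fun X Y s hs => ?_⟩
  · funext X
    have h1 : longMap H p X X (.nil X) = 0 := longMap_of_length_le_one H p (by simp [Str.length])
    have h2 : ∀ y : A.Hom (φ.obj X) (ψ.obj X), y + longMap H p X X (.nil X) + 0 = y := fun y => by
      rw [h1, add_zero, add_zero]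
    exact h2 _
  · funext X Y x
    have h1 : longMap H p X Y (.single (incl Q x)) = 0 :=
      longMap_of_length_le_one H p (by simp [Str.single, Str.length])
    change 0 + longMap H p X Y (.single (incl Q x)) + ρ X Y (incl Q x).2 = _
    rw [h1, add_zero, zero_add, hincl]
  · match s with
    | .nil _ => simp [Str.length] at hs
    | .cons _ (.nil _) => simp [Str.length] at hs
    | .cons x (.cons y s) =>
      change 0 + longMap H p X Y (.cons x (.cons y s)) + 0 = _
      rw [zero_add, add_zero]
  · rw [map_add]
    exact (congrArg (transD φ.toCocatHom ψ.toCocatHom (i + -1)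
      (nilPart (transMap₁ h' p).1 + longMap H p) X Y s + ·) (heq X Y s hs)).trans
      (add_sub_cancel _ _)

end IsSolution

/-- The solutions for homogeneous `p` are unique, hence linear, and glue to one map on `P`. By
construction its defect vanishes in lengths at least two, and the hypotheses on `U` and `h'` dispose
of the rest. -/
theorem exists_homotopy {U : GrMap P (sAInf φ ψ).gr 0} (hU : IsChainMap U)
    {h' : GrMap P (sA1 (restrFunctor φ) (restrFunctor ψ)).gr (-1)}
    (hh' : IsHomotopy (restrMap U) h')
    (H : ∀ n : {n : ℕ // 1 < n}, GrMap P (Comp φ.toCocatHom ψ.toCocatHom n) (-1)) :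
    ∃ h : GrMap P (sAInf φ ψ).gr (-1), IsHomotopy U h ∧ restrMap h = h' ∧
      ∀ n : {n : ℕ // 1 < n}, compMap h n = H n := by
  choose r hr using fun (i : ℤ) (p : P.gr i) => IsSolution.exists_of_mem U h' H p.2
  obtain ⟨h, hh⟩ := exists_linearMap_of_isInternal P.internal
    (N := PreTrans φ.toCocatHom ψ.toCocatHom) fun i =>
      { toFun := r i
        map_add' := fun p q => (hr i (p + q)).unique ((hr i p).add (hr i q))
        map_smul' := fun c p => (hr i (c • p)).unique ((hr i p).smul c) }
  have hsol : ∀ i, ∀ p ∈ P.gr i, IsSolution U h' H i p (h p) := fun i p hp => by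
    have := hr i ⟨p, hp⟩
    rwa [← show h p = r i ⟨p, hp⟩ from hh i ⟨p, hp⟩] at this
  let f : GrMap P (sAInf φ ψ).gr (-1) := ⟨h, fun i p hp => (hsol i p hp).mem⟩
  have hf : restrMap f = h' := Subtype.ext (linearMap_ext_of_isInternal P.internal
    fun i p hp => (hsol i p hp).restr)
  refine ⟨f, (isHomotopy_iff_of_restrMap hU (hf ▸ hh')).2 fun i p hp X Y s hs => ?_, hf, fun n =>
    Subtype.ext (linearMap_ext_of_isInternal P.internal fun i p hp => ?_)⟩
  · have h1 := (hsol i p hp).eq X Y s hs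
    -- The equation at `p` refers to the prescribed components at `pd`; the solution at `pd` has
    -- precisely these.
    have h2 := (hsol _ _ (P.d_mem i p hp)).long X Y s hs
    change transMap U p X Y s - h (P.d p) X Y s -
      transD φ.toCocatHom ψ.toCocatHom (i + -1) (h p) X Y s = 0
    rw [h1, h2, sub_self]
  · funext X Y s
    exact ((hsol i p hp).long X Y s.1 (by rw [s.2]; exact n.2)).trans
      (longPart_apply _ n.2 s.2)

/-- Gives injectivity: two homotopies with the same data are solutions of the same problem at every
`p`. -/
theorem isSolution_of_isHomotopy {U : GrMap P (sAInf φ ψ).gr 0} {h : GrMap P (sAInf φ ψ).gr (-1)}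
    (hh : IsHomotopy U h) {i : ℤ} {p : P.carrier} (hp : p ∈ P.gr i) :
    IsSolution U (restrMap h) (fun n => compMap h n) i p (transMap h p) where
  mem := transMap_mem h hp
  restr := rfl
  long X Y s hs := (longMap_compMap h p hs).symm
  eq X Y s hs := by
    have h1 := congrFun (congrFun (congrFun (isHomotopy_iff_defect.1 hh i p hp) X) Y) s
    rw [longMap_compMap h _ hs]
    exact (sub_eq_zero.1 h1).symm

end Solution

end AInf

end

theorem mainTheorem6 {k : Type uk} [CommRing k] {S : Type u} (Q : DGQuiver.{uk, u, v} k S)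
    {S' : Type u'} (A : AInfCat.{uk, u', v'} k S')
    (φ ψ : AInfFunctor (free Q) A.toOpQuiver) (P : Cx.{uk, w} k)
    (U : GrMap P (sAInf φ ψ).gr 0) (hU : IsChainMap U) :
    Set.BijOn
        (fun h : GrMap P (sAInf φ ψ).gr (-1) =>
          ((restrMap h, fun n => compMap h n) :
            GrMap P (sA1 (restrFunctor φ) (restrFunctor ψ)).gr (-1) ×
              (∀ n : {n : ℕ // 1 < n}, GrMap P (Comp φ.toCocatHom ψ.toCocatHom n) (-1))))
        {h | IsHomotopy U h}
        {D | IsHomotopy (restrMap U) D.1} ∧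
      ∀ h : GrMap P (sAInf φ ψ).gr (-1), IsHomotopy (restrMap U) (restrMap h) →
        (IsHomotopy U h ↔
          ∀ (i : ℤ) (p : P.carrier) (hp : p ∈ P.gr i) (X Y : S)
            (s : Str (free Q).toGrQuiver X Y), 1 < s.length →
            sgn k i • h.1 p X Y (.single ((free Q).bArr s)) =
              U.1 p X Y s - h.1 (P.d p) X Y s
              - transB (e := i + -1) ⟨h.1 p, h.2 i p hp⟩ s
              - sgn k i • bTransProper (h.1 p) s) := by
  refine ⟨⟨fun h hh => ?_, fun h hh h₂ hh₂ heq => ?_, fun D hD => ?_⟩, fun h hr => ?_⟩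
  · refine isHomotopy_restrMap_iff.2 fun i p hp => ?_
    rw [isHomotopy_iff_defect.1 hh i p hp, map_zero]
  · have h1 : restrMap h = restrMap h₂ := congrArg Prod.fst heq
    have h2 : (fun n : {n : ℕ // 1 < n} => compMap h n) =
        fun n : {n : ℕ // 1 < n} => compMap h₂ n :=
      congrArg Prod.snd heq
    refine Subtype.ext (linearMap_ext_of_isInternal P.internal fun i p hp => ?_)
    have h3 := isSolution_of_isHomotopy hh hp
    rw [h1, h2] at h3
    exact h3.unique (isSolution_of_isHomotopy hh₂ hp)
  · obtain ⟨h, hh, h1, h2⟩ := exists_homotopy hU hD D.2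
    exact ⟨h, hh, Prod.ext h1 (funext h2)⟩
  -- With the restriction under control, only strings of length at least two have to be tested, and
  -- there the vanishing defect is the recurrent formula.
  · rw [isHomotopy_iff_of_restrMap hU hr]
    exact forall_congr' fun i => forall_congr' fun p => forall_congr' fun hp => forall_congr' fun X =>
      forall_congr' fun Y => forall_congr' fun s => forall_congr' fun _ => defect_eq_zero_iff hp s
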